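/- A recursive tree of size $n$ is a rooted unordered tree whose $n$ vertices carry the labels $1,\dots,n$ such that the labels along the path from the root to any vertex are increasing; a random recursive tree of size $n\ge 1$ is one of the $(n-1)!$ recursive trees of size $n$ chosen uniformly at random. Given a tree and a non-empty set of selected nodes, the following edge-removal procedure isolates the selected nodes: at each step one of the edges of the current forest is chosen uniformly at random and removed, which splits one of the trees of the forest into two; any tree that then contains no selected node is discarded, all others are kept. The procedure stops when the forest consists only of the isolated selected nodes. For $1\le \ell\le n$ let $L_{n,\ell}$ be the number of removed edges (cuts) when this procedure is applied to a random recursive tree of size $n$ in order to isolate the last $\ell$ nodes, i.e. those labelled $n+1-\ell,\dots,n$. Theorem. Let $\ell\ge 1$ be a fixed integer. For every integer $s\ge 1$, as $n\to\infty$, $$\mathbb{E}\big(L_{n,\ell}^{\,s}\big)=\frac{\ell}{s+\ell}\cdot\frac{n^s}{\log^s n}+O\Big(\frac{n^s}{\log^{s+1} n}\Big),$$ where the implied constant may depend on $\ell$ and $s$. Moreover, $\frac{\log n}{n}L_{n,\ell}$ converges in distribution, as $n\to\infty$, to a beta-distributed random variable $\beta(\ell,1)$ with parameters $\ell$ and $1$.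 -/

import Mathlib

open MeasureTheory ProbabilityTheory Filter Asymptotics

namespace NodeIsolation

/-- A labelled tree (the vertices are the labels) is a recursive tree if it can be rooted at a
vertex such that the labels along the path from the root to any vertex are strictly increasing.
The root is then the smallest label. -/
def IsRecursiveTree {V : Type*} [LinearOrder V] (T : SimpleGraph V) : Prop :=
  T.IsTree ∧ ∃ root : V, ∀ (v : V) (p : T.Walk root v), p.IsPath → p.support.Pairwise (· < ·)

/-- The recursive trees of size `n`; the label `i ∈ {1, …, n}` is represented by
`i - 1 : Fin n`. -/
def RecursiveTree (n : ℕ) : Type :=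
  {T : SimpleGraph (Fin n) // IsRecursiveTree T}

instance (n : ℕ) : Finite (RecursiveTree n) :=
  inferInstanceAs (Finite {T : SimpleGraph (Fin n) // IsRecursiveTree T})

noncomputable instance (n : ℕ) : Fintype (RecursiveTree n) := Fintype.ofFinite _

/-- The star centred at the smallest label is a recursive tree. -/
instance (n : ℕ) : Nonempty (RecursiveTree (n + 1)) := by
  refine ⟨⟨SimpleGraph.starGraph 0, SimpleGraph.isTree_starGraph 0, 0, fun v p hp => ?_⟩⟩
  cases p with
  | nil => simp
  | cons h q =>
    cases q with
    | nil =>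
      have h0 := h.ne
      simpa using Fin.pos_iff_ne_zero.mpr h0.symm
    | cons h' r =>
      exfalso
      rw [SimpleGraph.Walk.cons_isPath_iff] at hp
      have h0 := h.ne
      rcases (SimpleGraph.starGraph_adj.mp h').2 with h1 | h1
      · exact h0 h1.symm
      · apply hp.2
        subst h1
        simp

section Cutting

variable {V : Type*} [Finite V]

/-- The edges that may be cut in the forest `F` when the vertices in `S` have to be isolated:
the edges of those trees of `F` that contain a vertex of `S`. All other trees are discarded. -/
def availableEdges (S : Set V) (F : SimpleGraph V) : Set (Sym2 V) :=
  {e | e ∈ F.edgeSet ∧ ∃ x ∈ S, ∃ u ∈ e, F.Reachable x u}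

theorem ncard_edgeSet_deleteEdges_lt (S : Set V) (F : SimpleGraph V)
    (e : availableEdges S F) :
    (F.deleteEdges {(e : Sym2 V)}).edgeSet.ncard < F.edgeSet.ncard := by
  rw [SimpleGraph.edgeSet_deleteEdges]
  exact Set.ncard_sdiff_singleton_lt_of_mem e.2.1 (Set.toFinite _)

open scoped Classical in
/-- The law of the number of cuts needed to isolate the vertices in `S`, starting from the
forest `F`: as long as there is an available edge, one of the available edges is chosen uniformly
at random and removed, and the procedure continues with the resulting forest. It stops when every
vertex of `S` is isolated. -/
noncomputable def cuts (S : Set V) (F : SimpleGraph V) : PMF ℕ :=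
  if _h : Nonempty (availableEdges S F) then
    haveI : Fintype (availableEdges S F) := Fintype.ofFinite _
    (PMF.uniformOfFintype (availableEdges S F)).bind fun e =>
      (cuts S (F.deleteEdges {(e : Sym2 V)})).map (· + 1)
  else PMF.pure 0
termination_by F.edgeSet.ncard
decreasing_by exact ncard_edgeSet_deleteEdges_lt S F e

end Cutting

/-- The law of the number of random cuts needed to isolate the nodes in `S` in a random recursive
tree of size `n`, i.e. a tree chosen uniformly among all recursive trees of size `n`
(for `n = 0`, where there is no tree, the number of cuts is set to be `0`). -/
noncomputable def isolationLaw : (n : ℕ) → Set (Fin n) → PMF ℕ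
  | 0, _ => PMF.pure 0
  | n + 1, S => (PMF.uniformOfFintype (RecursiveTree (n + 1))).bind fun T => cuts S T.1

/-- The nodes labelled `n + 1 - ℓ, …, n` (with labels in `{1, …, n}`). -/
def lastNodes (ℓ n : ℕ) : Set (Fin n) :=
  {i | n + 1 - ℓ ≤ (i : ℕ) + 1}

/-- The law of `L_{n,ℓ}`, the number of random cuts needed to isolate the last `ℓ` nodes
`n + 1 - ℓ, …, n` in a random recursive tree of size `n`. -/
noncomputable def lawL (n ℓ : ℕ) : PMF ℕ :=
  isolationLaw n (lastNodes ℓ n)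

end NodeIsolation

/-!
The moments of the number of cuts satisfy a recursion, obtained by conditioning on the first cut,
whose asymptotic solution is unique to first order; the method of moments then gives the limit law.

*The recursion.* A recursive tree is the same as a map that sends every vertex to a smaller parent
(`bijective_toRecursiveTree`), so the parents are independent and uniform. Given the vertex set of
the subtree that is cut off first, both parts are independent random recursive trees
(`sum_expCuts_update`). The selected nodes are the largest labels, and so they are again the last
nodes within each part. The cuts in both parts interleave, but the two numbers of cuts are
independent and add up (`expCuts_sup`). Hence `expLast_succ`: if `K` is the size of the part that is
cut off and `R` the number of selected nodes in it, then, given `(K, R)`, the number of cuts is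
distributed as `1 + L_{K, R} + L_{n - K, ℓ - R}` with independent summands.

*The first cut.* The mixed moments of `K` and `R` of order at most two are sums of expected numbers
of common ancestors of two vertices, which are harmonic numbers on the diagonal and at most `1`
off it. Thus `𝔼 K = log n + O(1)`, `𝔼 K² = O(n)`, `𝔼 R = ℓ log n / n + O(1 / n)`,
`𝔼 R K = O(1)` and `𝔼 R (R - 1) = O(1 / n)`: the simultaneous separation of two selected nodes
is negligible.

*The expansion.* Write `g s q = n ^ s / log ^ q n`. Replacing `n` by `n - K` decreases
`g (s + 1) (q + 1)` by about `(s + 1) g s q` on average. So a sequence satisfying the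
recursive inequality with a toll `O(g s q)` is `O(g (s + 1) (q + 1))`
(`exists_le_gauge_of_le_expect`). This first yields the order of magnitude of the moments
(`momentBound_succ`). Applied to the deviation of the moment of order `t + 1` from
`c(ℓ, t + 1) g (t + 1) (t + 1)`, it also yields the expansion (`momentExpansion_succ`), provided
that the leading terms balance:
`(t + 1) c(ℓ, t) + ℓ (c(ℓ - 1, t + 1) - c(ℓ, t + 1)) = (t + 1) c(ℓ, t + 1)`.
Here the first term comes from cuts that separate no selected node, the second one from those that
separate exactly one, and the right-hand side is the mean decrease of the leading term. The solution
is `c(ℓ, s) = ℓ / (s + ℓ)`, the `s`-th moment of the beta distribution with parameters `ℓ` and `1`.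

*The limit law.* The rescaled moments converge to those of a distribution on `[0, 1]`, and the
Weierstrass approximation theorem turns this into weak convergence
(`tendsto_of_tendsto_moments`).
-/

/-! ### Expectations of functions of the number of cuts -/

namespace NodeIsolation

open scoped BigOperators

theorem toMeasure_uniformOfFintype_bind {α : Type*} [Fintype α] [Nonempty α] (q : α → PMF ℕ) :
    ((PMF.uniformOfFintype α).bind q).toMeasure
      = ∑ a, (Fintype.card α : ENNReal)⁻¹ • (q a).toMeasure := by
  ext s hs
  rw [PMF.toMeasure_bind_apply _ _ _ hs, tsum_fintype]
  simp

theorem integrable_uniformOfFintype_bind {α : Type*} [Fintype α] [Nonempty α] (q : α → PMF ℕ)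
    (F : ℕ → ℝ) (h : ∀ a, Integrable F (q a).toMeasure) :
    Integrable F ((PMF.uniformOfFintype α).bind q).toMeasure := by
  rw [toMeasure_uniformOfFintype_bind]
  exact integrable_finsetSum_measure.2 fun a _ => (h a).smul_measure (by simp)

theorem integral_uniformOfFintype_bind {α : Type*} [Fintype α] [Nonempty α] (q : α → PMF ℕ)
    (F : ℕ → ℝ) (h : ∀ a, Integrable F (q a).toMeasure) :
    ∫ k, F k ∂((PMF.uniformOfFintype α).bind q).toMeasure
      = 𝔼 a, ∫ k, F k ∂(q a).toMeasure := by
  rw [toMeasure_uniformOfFintype_bind,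
    integral_finsetSum_measure fun a _ => (h a).smul_measure (by simp)]
  simp [integral_smul_measure, Fintype.expect_eq_sum_div_card, Finset.mul_sum, div_eq_inv_mul]

theorem integrable_map_succ (p : PMF ℕ) (F : ℕ → ℝ)
    (h : Integrable (fun k => F (k + 1)) p.toMeasure) :
    Integrable F (p.map (· + 1)).toMeasure := by
  rw [← PMF.toMeasure_map (· + 1) p Measurable.of_discrete,
    integrable_map_measure AEStronglyMeasurable.of_discrete AEMeasurable.of_discrete]
  exact h

theorem integral_map_succ (p : PMF ℕ) (F : ℕ → ℝ) :
    ∫ k, F k ∂(p.map (· + 1)).toMeasure = ∫ k, F (k + 1) ∂p.toMeasure := by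
  rw [← PMF.toMeasure_map (· + 1) p Measurable.of_discrete,
    integral_map AEMeasurable.of_discrete AEStronglyMeasurable.of_discrete]

section Union

variable {V : Type*}

/-- In a union of two forests without a common non-isolated vertex, a tree meets only one of
the two. -/
theorem reachable_of_reachable_sup {G H : SimpleGraph V}
    (hd : ∀ u v w, G.Adj u v → ¬ H.Adj u w) {u x : V} (hu : ∃ v, G.Adj u v)
    (h : (G ⊔ H).Reachable u x) : G.Reachable u x := by
  obtain ⟨p⟩ := h
  induction p with
  | nil => exact SimpleGraph.Reachable.refl _
  | cons h q ih =>
    obtain ⟨v, hv⟩ := hu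
    rcases h with h | h
    · exact h.reachable.trans (ih ⟨_, h.symm⟩)
    · exact absurd h (hd _ _ _ hv)

theorem notMem_edgeSet_of_mem {G H : SimpleGraph V}
    (hd : ∀ u v w, G.Adj u v → ¬ H.Adj u w) {e : Sym2 V} (he : e ∈ G.edgeSet) :
    e ∉ H.edgeSet := by
  induction e with
  | _ a b => exact hd a b b he

theorem deleteEdges_sup_of_mem {G H : SimpleGraph V}
    (hd : ∀ u v w, G.Adj u v → ¬ H.Adj u w) {e : Sym2 V} (he : e ∈ G.edgeSet) :
    (G ⊔ H).deleteEdges {e} = G.deleteEdges {e} ⊔ H := by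
  ext a b
  have := notMem_edgeSet_of_mem hd he
  simp only [SimpleGraph.deleteEdges_adj, SimpleGraph.sup_adj, Set.mem_singleton_iff]
  constructor
  · tauto
  · rintro (h | h)
    · tauto
    · refine ⟨Or.inr h, ?_⟩
      rintro rfl
      exact this h

theorem availableEdges_sup_of_mem {G H : SimpleGraph V}
    (hd : ∀ u v w, G.Adj u v → ¬ H.Adj u w) (S : Set V) {e : Sym2 V} (he : e ∈ G.edgeSet) :
    e ∈ availableEdges S (G ⊔ H) ↔ e ∈ availableEdges S G := by
  constructor
  · rintro ⟨-, x, hx, u, hu, h⟩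
    refine ⟨he, x, hx, u, hu, ?_⟩
    have : ∃ v, G.Adj u v := by
      obtain ⟨v, rfl⟩ := hu
      exact ⟨v, he⟩
    exact (reachable_of_reachable_sup hd this h.symm).symm
  · rintro ⟨-, x, hx, u, hu, h⟩
    exact ⟨by simp [he], x, hx, u, hu, h.mono le_sup_left⟩

theorem availableEdges_sup {G H : SimpleGraph V}
    (hd : ∀ u v w, G.Adj u v → ¬ H.Adj u w) (S : Set V) :
    availableEdges S (G ⊔ H) = availableEdges S G ∪ availableEdges S H := by
  have hd' : ∀ u v w, H.Adj u v → ¬ G.Adj u w := fun u v w h h' => hd u w v h' h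
  ext e
  constructor
  · intro he
    have h1 : e ∈ (G ⊔ H).edgeSet := he.1
    rw [SimpleGraph.edgeSet_sup] at h1
    rcases h1 with h1 | h1
    · exact Or.inl ((availableEdges_sup_of_mem hd S h1).1 he)
    · exact Or.inr ((availableEdges_sup_of_mem hd' S h1).1 (by rwa [sup_comm]))
  · rintro (he | he)
    · exact (availableEdges_sup_of_mem hd S he.1).2 he
    · have := (availableEdges_sup_of_mem hd' S he.1).2 he
      rwa [sup_comm] at this

end Union

section Cuts

variable {V : Type*} [Finite V]

theorem cuts_of_isEmpty (S : Set V) (G : SimpleGraph V) (h : availableEdges S G = ∅) :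
    cuts S G = PMF.pure 0 := by
  rw [cuts, dif_neg]
  simp [h]

theorem integrable_cuts (S : Set V) (G : SimpleGraph V) (F : ℕ → ℝ) :
    Integrable F (cuts S G).toMeasure := by
  induction hn : G.edgeSet.ncard using Nat.strong_induction_on generalizing G F with
  | _ n ih =>
    rw [cuts]
    split_ifs with h
    · refine @integrable_uniformOfFintype_bind _ (Fintype.ofFinite _) h _ _ fun e => ?_
      refine integrable_map_succ _ _ ?_
      exact ih _ (hn ▸ ncard_edgeSet_deleteEdges_lt S G e) _ _ rfl
    · rw [PMF.toMeasure_pure]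
      exact integrable_dirac (by simp)

/-- The expectation of `F` at the number of cuts needed to isolate `S` in the forest `G`. -/
noncomputable def expCuts (S : Set V) (G : SimpleGraph V) (F : ℕ → ℝ) : ℝ :=
  ∫ k, F k ∂(cuts S G).toMeasure

theorem expCuts_of_isEmpty (S : Set V) (G : SimpleGraph V) (h : availableEdges S G = ∅)
    (F : ℕ → ℝ) : expCuts S G F = F 0 := by
  rw [expCuts, cuts_of_isEmpty S G h, PMF.toMeasure_pure, integral_dirac]

/-- One step of the cutting procedure. The formula also holds when no edge is available. -/
theorem ncard_mul_expCuts (S : Set V) (G : SimpleGraph V) (F : ℕ → ℝ) :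
    ((availableEdges S G).ncard : ℝ) * expCuts S G F
      = ∑ e ∈ (availableEdges S G).toFinite.toFinset,
          expCuts S (G.deleteEdges {e}) fun k => F (k + 1) := by
  classical
  by_cases h : Nonempty (availableEdges S G)
  · have : Fintype (availableEdges S G) := Fintype.ofFinite _
    have key : expCuts S G F = 𝔼 e : availableEdges S G,
        expCuts S (G.deleteEdges {(e : Sym2 V)}) fun k => F (k + 1) := by
      rw [expCuts, cuts, dif_pos h, Subsingleton.elim this (Fintype.ofFinite _)]
      rw [@integral_uniformOfFintype_bind _ (Fintype.ofFinite _) h]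
      · refine Finset.expect_congr rfl fun e _ => ?_
        rw [integral_map_succ, expCuts]
      · intro e
        exact integrable_map_succ _ _ (integrable_cuts _ _ _)
    rw [key, ← Nat.card_coe_set_eq, Nat.card_eq_fintype_card, Fintype.card_mul_expect]
    exact (Finset.sum_subtype (p := (· ∈ availableEdges S G)) _ (by simp)
      fun e => expCuts S (G.deleteEdges {e}) fun k => F (k + 1)).symm
  · have h0 : availableEdges S G = ∅ := Set.not_nonempty_iff_eq_empty'.1 h
    simp [h0]

theorem expCuts_sum {ι : Type*} (S : Set V) (G : SimpleGraph V) (s : Finset ι)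
    (F : ι → ℕ → ℝ) : expCuts S G (fun k => ∑ i ∈ s, F i k) = ∑ i ∈ s, expCuts S G (F i) :=
  integral_finsetSum _ fun i _ => integrable_cuts S G (F i)

theorem expCuts_const_mul (S : Set V) (G : SimpleGraph V) (c : ℝ) (F : ℕ → ℝ) :
    expCuts S G (fun k => c * F k) = c * expCuts S G F :=
  integral_const_mul _ _

/-- The numbers of cuts in two forests without a common non-isolated vertex are independent, and
they add up: interleaving the two procedures does not change their laws. -/
theorem expCuts_sup (S : Set V) {G H : SimpleGraph V}
    (hd : ∀ u v w, G.Adj u v → ¬ H.Adj u w) (F : ℕ → ℝ) :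
    expCuts S (G ⊔ H) F = expCuts S G fun i => expCuts S H fun j => F (i + j) := by
  induction hn : G.edgeSet.ncard + H.edgeSet.ncard using Nat.strong_induction_on
    generalizing G H F with
  | _ n ih =>
    have hd' : ∀ u v w, H.Adj u v → ¬ G.Adj u w := fun u v w h h' => hd u w v h' h
    by_cases h0 : availableEdges S G = ∅ ∧ availableEdges S H = ∅
    · rw [expCuts_of_isEmpty, expCuts_of_isEmpty _ _ h0.1, expCuts_of_isEmpty _ _ h0.2]
      rw [availableEdges_sup hd, h0.1, h0.2, Set.union_empty]
    have hdisj : Disjoint (availableEdges S G) (availableEdges S H) :=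
      Set.disjoint_left.2 fun e he he' => notMem_edgeSet_of_mem hd he.1 he'.1
    have hcard : (availableEdges S (G ⊔ H)).ncard
        = (availableEdges S G).ncard + (availableEdges S H).ncard := by
      rw [availableEdges_sup hd, Set.ncard_union_eq hdisj]
    have hpos : ((availableEdges S (G ⊔ H)).ncard : ℝ) ≠ 0 := by
      rw [Nat.cast_ne_zero, Ne, Set.ncard_eq_zero, availableEdges_sup hd, Set.union_empty_iff]
      exact h0
    refine mul_left_cancel₀ hpos ?_
    rw [ncard_mul_expCuts]
    have hfin : (availableEdges S (G ⊔ H)).toFinite.toFinset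
        = (availableEdges S G).toFinite.toFinset.disjUnion (availableEdges S H).toFinite.toFinset
          (by simpa [← Finset.disjoint_coe] using hdisj) := by
      ext e
      simp [availableEdges_sup hd]
    rw [hfin, Finset.sum_disjUnion, hcard, Nat.cast_add, add_mul]
    congr 1
    · rw [ncard_mul_expCuts]
      refine Finset.sum_congr rfl fun e he => ?_
      rw [Set.Finite.mem_toFinset] at he
      have hlt := ncard_edgeSet_deleteEdges_lt S G ⟨e, he⟩
      rw [deleteEdges_sup_of_mem hd he.1, ih _ _ _ _ rfl]
      · simp only [add_right_comm]
      · rw [← hn]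
        exact Nat.add_lt_add_right hlt _
      · intro u v w h
        exact hd u v w (SimpleGraph.deleteEdges_le _ h)
    · rw [← expCuts_const_mul]
      simp only [ncard_mul_expCuts]
      rw [expCuts_sum]
      refine Finset.sum_congr rfl fun e he => ?_
      rw [Set.Finite.mem_toFinset] at he
      have hlt := ncard_edgeSet_deleteEdges_lt S H ⟨e, he⟩
      rw [sup_comm, deleteEdges_sup_of_mem hd' he.1, sup_comm, ih _ _ _ _ rfl]
      · simp only [add_assoc]
      · rw [← hn]
        exact Nat.add_lt_add_left hlt _
      · intro u v w h h'
        exact hd u v w h (SimpleGraph.deleteEdges_le _ h')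

end Cuts

section Map

variable {V W : Type*}

theorem reachable_map_iff (φ : W ↪ V) (G : SimpleGraph W) (x : V) (u : W) :
    (G.map φ).Reachable (φ u) x ↔ ∃ y, φ y = x ∧ G.Reachable u y := by
  constructor
  · rintro ⟨p⟩
    generalize hv : φ u = v at p
    induction p generalizing u with
    | nil => exact ⟨u, hv, SimpleGraph.Reachable.refl _⟩
    | cons h q ih =>
      subst hv
      obtain ⟨-, a, b, hab, ha, hb⟩ := h
      obtain rfl := φ.injective ha
      obtain ⟨y, hy, h⟩ := ih b hb
      exact ⟨y, hy, hab.reachable.trans h⟩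
  · rintro ⟨y, rfl, h⟩
    exact h.map (SimpleGraph.Embedding.map φ G).toHom

theorem deleteEdges_map (φ : W ↪ V) (G : SimpleGraph W) (e : Sym2 W) :
    (G.map φ).deleteEdges {φ.sym2Map e} = (G.deleteEdges {e}).map φ := by
  rw [← SimpleGraph.edgeSet_inj, SimpleGraph.edgeSet_deleteEdges, SimpleGraph.edgeSet_map,
    SimpleGraph.edgeSet_map, SimpleGraph.edgeSet_deleteEdges, Set.image_sdiff φ.sym2Map.injective,
    Set.image_singleton]

theorem availableEdges_map (φ : W ↪ V) (S : Set V) (G : SimpleGraph W) :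
    availableEdges S (G.map φ) = φ.sym2Map '' availableEdges (φ ⁻¹' S) G := by
  ext e
  constructor
  · rintro ⟨he, x, hx, u, hu, h⟩
    rw [SimpleGraph.edgeSet_map] at he
    obtain ⟨e, he, rfl⟩ := he
    refine ⟨e, ?_, rfl⟩
    obtain ⟨u, hue, rfl⟩ : ∃ w ∈ e, φ w = u := Sym2.mem_map.1 hu
    obtain ⟨y, rfl, hr⟩ := (reachable_map_iff φ G x u).1 h.symm
    exact ⟨he, y, hx, u, hue, hr.symm⟩
  · rintro ⟨e, ⟨he, x, hx, u, hu, h⟩, rfl⟩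
    refine ⟨?_, φ x, hx, φ u, Sym2.mem_map.2 ⟨u, hu, rfl⟩, ?_⟩
    · rw [SimpleGraph.edgeSet_map]
      exact ⟨e, he, rfl⟩
    · exact ((reachable_map_iff φ G _ u).2 ⟨x, rfl, h.symm⟩).symm

variable [Finite V] [Finite W]

/-- The number of cuts is invariant under embeddings of the forest into a larger vertex set. -/
theorem expCuts_map (φ : W ↪ V) (S : Set V) (G : SimpleGraph W) (F : ℕ → ℝ) :
    expCuts S (G.map φ) F = expCuts (φ ⁻¹' S) G F := by
  classical
  induction hn : G.edgeSet.ncard using Nat.strong_induction_on generalizing G F with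
  | _ n ih =>
    by_cases h0 : availableEdges (φ ⁻¹' S) G = ∅
    · rw [expCuts_of_isEmpty _ _ h0, expCuts_of_isEmpty]
      rw [availableEdges_map, h0, Set.image_empty]
    have hcard : (availableEdges S (G.map φ)).ncard = (availableEdges (φ ⁻¹' S) G).ncard := by
      rw [availableEdges_map, Set.ncard_image_of_injective _ φ.sym2Map.injective]
    have hpos : ((availableEdges (φ ⁻¹' S) G).ncard : ℝ) ≠ 0 := by
      rwa [Nat.cast_ne_zero, Ne, Set.ncard_eq_zero]
    refine mul_left_cancel₀ hpos ?_
    rw [ncard_mul_expCuts, ← hcard, ncard_mul_expCuts]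
    have hfin : (availableEdges S (G.map φ)).toFinite.toFinset
        = (availableEdges (φ ⁻¹' S) G).toFinite.toFinset.map φ.sym2Map := by
      ext e
      simp [availableEdges_map]
    rw [hfin, Finset.sum_map]
    refine Finset.sum_congr rfl fun e he => ?_
    rw [Set.Finite.mem_toFinset] at he
    rw [deleteEdges_map]
    exact ih _ (hn ▸ ncard_edgeSet_deleteEdges_lt _ G ⟨e, he⟩) _ _ rfl

end Map

end NodeIsolation

/-! ### Recursive trees as parent maps -/

namespace NodeIsolation

open scoped BigOperators

/-- A recursive tree on a linear order, encoded by the map that sends each vertex to its parent: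
every vertex is sent to a smaller one, except for the smallest vertex, the root, which is sent to
itself. -/
structure ParentMap (W : Type*) [LinearOrder W] where
  /-- The parent of a vertex. -/
  toFun : W → W
  lt_or_isBot : ∀ v, toFun v < v ∨ toFun v = v ∧ IsBot v

namespace ParentMap

variable {W : Type*} [LinearOrder W]

instance : FunLike (ParentMap W) W W where
  coe := toFun
  coe_injective f g h := by cases f; cases g; congr

instance [Finite W] : Finite (ParentMap W) := DFunLike.finite _

noncomputable instance [Finite W] : Fintype (ParentMap W) := Fintype.ofFinite _

@[ext]
theorem ext {f g : ParentMap W} (h : ∀ v, f v = g v) : f = g :=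
  DFunLike.ext _ _ h

@[simp]
theorem coe_mk (f : W → W) (h : ∀ v, f v < v ∨ f v = v ∧ IsBot v) (v : W) :
    (⟨f, h⟩ : ParentMap W) v = f v := rfl

theorem spec (f : ParentMap W) (v : W) : f v < v ∨ f v = v ∧ IsBot v := f.lt_or_isBot v

theorem apply_lt (f : ParentMap W) {v : W} (hv : ¬ IsBot v) : f v < v :=
  (f.spec v).resolve_right fun h => hv h.2

theorem apply_eq (f : ParentMap W) {v : W} (hv : IsBot v) : f v = v :=
  (f.spec v).elim (fun h => absurd (hv (f v)) h.not_ge) And.left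

theorem apply_le (f : ParentMap W) (v : W) : f v ≤ v :=
  (f.spec v).elim le_of_lt fun h => h.1.le

instance [Finite W] : Nonempty (ParentMap W) := by
  cases isEmpty_or_nonempty W
  · exact ⟨⟨id, fun v => isEmptyElim v⟩⟩
  · obtain ⟨b, hb⟩ := Finite.exists_min (id : W → W)
    refine ⟨⟨fun _ => b, fun v => ?_⟩⟩
    rcases (hb v).lt_or_eq with h | h
    · exact Or.inl h
    · exact Or.inr ⟨h, fun w => h.ge.trans (hb w)⟩

end ParentMap

section Graph

variable {W : Type*}

/-- The graph whose edges join the vertices `v` with `f v ≠ v` to `f v`. -/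
def parentGraph (f : W → W) : SimpleGraph W where
  Adj a b := a ≠ b ∧ (f a = b ∨ f b = a)
  symm := ⟨fun _ _ h => ⟨h.1.symm, h.2.symm⟩⟩
  loopless := ⟨fun _ h => h.1 rfl⟩

theorem parentGraph_adj (f : W → W) {a b : W} :
    (parentGraph f).Adj a b ↔ a ≠ b ∧ (f a = b ∨ f b = a) := Iff.rfl

theorem parentGraph_map_equiv {W' : Type*} (e : W ≃ W') (f : W → W) :
    (parentGraph f).map e.toEmbedding = parentGraph fun v => e (f (e.symm v)) := by
  ext a b
  rw [SimpleGraph.map_adj]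
  simp only [parentGraph_adj]
  constructor
  · rintro ⟨a, b, h, rfl, rfl⟩
    simpa using h
  · intro h
    refine ⟨e.symm a, e.symm b, ?_, by simp, by simp⟩
    simpa [← Equiv.eq_symm_apply] using h

variable [LinearOrder W]

theorem parentGraph_edge_injOn (f : ParentMap W) :
    Set.InjOn (fun v => s(v, f v)) {v | ¬ IsBot v} := by
  intro u hu v hv h
  have h1 := f.apply_lt hu
  have h2 := f.apply_lt hv
  rcases Sym2.eq_iff.1 h with h | h
  · exact h.1
  · rw [h.2, h.1] at h1
    exact absurd h1 h2.not_gt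

theorem edgeSet_parentGraph (f : ParentMap W) :
    (parentGraph f).edgeSet = (fun v => s(v, f v)) '' {v | ¬ IsBot v} := by
  ext e
  induction e with
  | _ a b =>
    simp only [SimpleGraph.mem_edgeSet, parentGraph_adj, Set.mem_image, Set.mem_ofPred_eq]
    constructor
    · rintro ⟨hne, rfl | rfl⟩
      · exact ⟨a, fun h => hne (f.apply_eq h).symm, rfl⟩
      · exact ⟨b, fun h => hne (f.apply_eq h), Sym2.eq_swap⟩
    · rintro ⟨v, hv, h⟩
      have h1 := f.apply_lt hv
      rcases Sym2.eq_iff.1 h with ⟨rfl, rfl⟩ | ⟨rfl, rfl⟩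
      · exact ⟨h1.ne', Or.inl rfl⟩
      · exact ⟨h1.ne, Or.inr rfl⟩

/-- Cutting the edge above `v` amounts to making `v` a root. -/
theorem parentGraph_deleteEdges (f : ParentMap W) {v : W} (hv : ¬ IsBot v) :
    (parentGraph f).deleteEdges {s(v, f v)} = parentGraph (Function.update f v v) := by
  ext a b
  have hlt := f.apply_lt hv
  have ha := f.apply_le a
  have hb := f.apply_le b
  simp only [SimpleGraph.deleteEdges_adj, parentGraph_adj, Set.mem_singleton_iff, Sym2.eq_iff,
    Function.update_apply]
  by_cases hav : a = v <;> by_cases hbv : b = v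
  · subst hav; subst hbv; simp
  · subst hav
    simp only [hbv, if_true, if_false, true_and]
    constructor
    · rintro ⟨⟨h1, h2 | h2⟩, h3⟩
      · exact absurd (Or.inl h2.symm) h3
      · exact ⟨h1, Or.inr h2⟩
    · rintro ⟨h1, h2 | h2⟩
      · exact absurd h2 h1
      · refine ⟨⟨h1, Or.inr h2⟩, ?_⟩
        rintro (h | h)
        · rw [h2, h] at hb
          exact absurd hlt hb.not_gt
        · exact h.2
  · subst hbv
    simp only [hav, if_true, if_false, false_and, false_or, and_true]
    constructor
    · rintro ⟨⟨h1, h2 | h2⟩, h3⟩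
      · exact ⟨h1, Or.inl h2⟩
      · exact absurd h2.symm h3
    · rintro ⟨h1, h2 | h2⟩
      · refine ⟨⟨h1, Or.inl h2⟩, ?_⟩
        rintro h
        rw [h2] at ha
        rw [← h] at hlt
        exact absurd hlt ha.not_gt
      · exact absurd h2.symm h1
  · simp [hav, hbv]

end Graph

section Tree

variable {W : Type*} [LinearOrder W]

/-- A path that starts by moving away from the root is increasing. -/
theorem pairwise_lt_support_of_isPath (f : ParentMap W) {u v : W}
    (p : (parentGraph f).Walk u v) (hp : p.IsPath) (hu : f u ∉ p.support ∨ f u = u) :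
    p.support.Pairwise (· < ·) := by
  induction p with
  | nil => simp
  | @cons u w v h q ih =>
    rw [SimpleGraph.Walk.cons_isPath_iff] at hp
    have hw : f w = u := by
      rcases (parentGraph_adj f).1 h with ⟨hne, h | h⟩
      · rcases hu with hu | hu
        · refine absurd ?_ hu
          rw [SimpleGraph.Walk.support_cons, h]
          exact List.mem_cons_of_mem _ q.start_mem_support
        · exact absurd (hu.symm.trans h) hne
      · exact h
    have hlt : u < w := lt_of_le_of_ne (hw ▸ f.apply_le w) h.1
    have hq := ih hp.1 (Or.inl (hw ▸ hp.2))
    rw [SimpleGraph.Walk.support_cons, List.pairwise_cons]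
    refine ⟨fun x hx => ?_, hq⟩
    rw [← SimpleGraph.Walk.cons_tail_support] at hq hx
    rcases List.mem_cons.1 hx with rfl | hx
    · exact hlt
    · exact hlt.trans ((List.pairwise_cons.1 hq).1 x hx)

theorem connected_of_forall_exists_adj_lt [Finite W] [Nonempty W] {G : SimpleGraph W}
    (h : ∀ v, ¬ IsBot v → ∃ u < v, G.Adj v u) : G.Connected := by
  obtain ⟨b, hb⟩ := Finite.exists_min (id : W → W)
  have hr : ∀ v, G.Reachable v b := by
    intro v
    induction v using WellFoundedLT.induction with
    | _ v ih =>
      by_cases hv : IsBot v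
      · rw [le_antisymm (hv b) (hb v)]
      · obtain ⟨u, hu, hadj⟩ := h v hv
        exact hadj.reachable.trans (ih u hu)
  exact SimpleGraph.connected_iff _ |>.2 ⟨fun u v => (hr u).trans (hr v).symm, inferInstance⟩

theorem parentGraph_connected [Finite W] [Nonempty W] (f : ParentMap W) :
    (parentGraph f).Connected :=
  connected_of_forall_exists_adj_lt fun v hv =>
    ⟨f v, f.apply_lt hv, (f.apply_lt hv).ne', Or.inl rfl⟩

theorem ncard_edgeSet_parentGraph [Finite W] [Nonempty W] (f : ParentMap W) :
    (parentGraph f).edgeSet.ncard + 1 = Nat.card W := by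
  obtain ⟨b, hb⟩ := Finite.exists_min (id : W → W)
  have : {v : W | ¬ IsBot v} = {b}ᶜ := by
    ext v
    simp only [Set.mem_ofPred_eq, Set.mem_compl_iff, Set.mem_singleton_iff, not_iff_not]
    exact ⟨fun h => le_antisymm (h b) (hb v), fun h => h ▸ hb⟩
  rw [edgeSet_parentGraph, (parentGraph_edge_injOn f).ncard_image, this,
    ← Set.ncard_add_ncard_compl {b}, Set.ncard_singleton, add_comm]

theorem isRecursiveTree_parentGraph [Finite W] [Nonempty W] (f : ParentMap W) :
    IsRecursiveTree (parentGraph f) := by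
  obtain ⟨b, hb⟩ := Finite.exists_min (id : W → W)
  refine ⟨SimpleGraph.isTree_iff_connected_and_card.2 ⟨parentGraph_connected f, ?_⟩, b,
    fun v p hp => pairwise_lt_support_of_isPath f p hp (Or.inr (f.apply_eq hb))⟩
  rw [Nat.card_coe_set_eq, ncard_edgeSet_parentGraph]

theorem exists_adj_lt_of_isRecursiveTree {T : SimpleGraph W} (hT : IsRecursiveTree T) {v : W}
    (hv : ¬ IsBot v) : ∃ u < v, T.Adj v u := by
  obtain ⟨ht, r, hr⟩ := hT
  have key : ∀ w (p : T.Walk w r), p.IsPath → p.support.Pairwise (· > ·) := by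
    intro w p hp
    have := hr w p.reverse hp.reverse
    rwa [SimpleGraph.Walk.support_reverse, List.pairwise_reverse] at this
  have hbot : IsBot r := by
    intro w
    obtain ⟨p, hp⟩ := ht.connected.exists_isPath w r
    have := key w p hp
    rw [← SimpleGraph.Walk.cons_tail_support, List.pairwise_cons] at this
    have hmem : r ∈ p.support := p.end_mem_support
    rw [← SimpleGraph.Walk.cons_tail_support] at hmem
    rcases List.mem_cons.1 hmem with h | h
    · exact h.le
    · exact (this.1 r h).le
  obtain ⟨p, hp⟩ := ht.connected.exists_isPath v r
  have := key v p hp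
  cases p with
  | nil => exact absurd hbot hv
  | @cons _ w _ h q =>
    rw [SimpleGraph.Walk.support_cons, List.pairwise_cons] at this
    exact ⟨w, this.1 w q.start_mem_support, h⟩

/-- The recursive tree with the given parent map. -/
def ParentMap.toRecursiveTree {n : ℕ} (f : ParentMap (Fin (n + 1))) : RecursiveTree (n + 1) :=
  ⟨parentGraph f, isRecursiveTree_parentGraph f⟩

theorem bijective_toRecursiveTree (n : ℕ) :
    Function.Bijective (ParentMap.toRecursiveTree (n := n)) := by
  constructor
  · intro f g h
    have h' : parentGraph f = parentGraph g := congrArg Subtype.val h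
    ext1 v
    by_cases hv : IsBot v
    · rw [f.apply_eq hv, g.apply_eq hv]
    · have hlt := f.apply_lt hv
      have : (parentGraph g).Adj v (f v) := h' ▸ ⟨hlt.ne', Or.inl rfl⟩
      rcases this.2 with h2 | h2
      · exact h2.symm
      · have := g.apply_le (f v)
        rw [h2] at this
        exact absurd this hlt.not_ge
  · intro T
    choose! g hg using fun v (hv : ¬ IsBot v) => exists_adj_lt_of_isRecursiveTree T.2 hv
    classical
    let f : ParentMap (Fin (n + 1)) := ⟨fun v => if IsBot v then v else g v, fun v => by
      by_cases hv : IsBot v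
      · exact Or.inr ⟨if_pos hv, hv⟩
      · exact Or.inl ((if_neg hv).trans_lt (hg v hv).1)⟩
    have hle : parentGraph f ≤ T.1 := by
      intro a b hab
      have : ∀ a b, a ≠ b → f a = b → T.1.Adj a b := by
        intro a b hne hb
        by_cases ha : IsBot a
        · exact absurd ((f.apply_eq ha).symm.trans hb) hne
        · have hfa : f a = g a := if_neg ha
          rw [← hb, hfa]
          exact (hg a ha).2
      rcases hab with ⟨hne, h | h⟩
      · exact this a b hne h
      · exact (this b a hne.symm h).symm
    refine ⟨f, Subtype.ext (le_antisymm hle ?_)⟩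
    exact (SimpleGraph.isTree_iff_minimal_connected.1 T.2.1).2 (parentGraph_connected f) hle

end Tree

section Law

/-- The expectation of `F` at the number of cuts needed to isolate `S` in a random recursive tree
on the linear order `W`. -/
noncomputable def treeExp {W : Type*} [LinearOrder W] [Finite W] (S : Set W) (F : ℕ → ℝ) : ℝ :=
  𝔼 f : ParentMap W, expCuts S (parentGraph f) F

/-- The expectation of `F` at the number of cuts needed to isolate the last `ℓ` nodes in a random
recursive tree of size `n`. -/
noncomputable def expLast (n ℓ : ℕ) (F : ℕ → ℝ) : ℝ :=
  ∫ k, F k ∂(lawL n ℓ).toMeasure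

theorem expLast_eq_treeExp (n ℓ : ℕ) (F : ℕ → ℝ) :
    expLast n ℓ F = treeExp (lastNodes ℓ n) F := by
  cases n with
  | zero =>
    have h : ∀ f : ParentMap (Fin 0), expCuts (lastNodes ℓ 0) (parentGraph f) F = F 0 := by
      intro f
      refine expCuts_of_isEmpty _ _ ?_ _
      ext e
      induction e with
      | _ a b => exact a.elim0
    rw [treeExp, Finset.expect_congr rfl fun f _ => h f, Fintype.expect_const, expLast, lawL,
      isolationLaw, PMF.toMeasure_pure, integral_dirac]
  | succ n =>
    rw [expLast, lawL, isolationLaw]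
    refine (integral_uniformOfFintype_bind (α := RecursiveTree (n + 1)) _ _
      fun T => integrable_cuts _ _ _).trans ?_
    exact (Fintype.expect_bijective _ (bijective_toRecursiveTree n) _ _ fun f => rfl).symm

theorem integrable_lawL (n ℓ : ℕ) (F : ℕ → ℝ) : Integrable F (lawL n ℓ).toMeasure := by
  cases n with
  | zero =>
    rw [lawL, isolationLaw, PMF.toMeasure_pure]
    exact integrable_dirac (by simp)
  | succ n =>
    rw [lawL, isolationLaw]
    exact integrable_uniformOfFintype_bind (α := RecursiveTree (n + 1)) _ _
      fun T => integrable_cuts _ _ _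

theorem ncard_lastNodes {ℓ n : ℕ} (h : ℓ ≤ n) : (lastNodes ℓ n).ncard = ℓ := by
  have : lastNodes ℓ n = (fun i : Fin ℓ => (⟨n - ℓ + i, by omega⟩ : Fin n)) '' Set.univ := by
    ext i
    simp only [lastNodes, Set.mem_ofPred_eq, Set.image_univ, Set.mem_range]
    constructor
    · intro hi
      exact ⟨⟨i - (n - ℓ), by omega⟩, Fin.ext (by simp; omega)⟩
    · rintro ⟨j, rfl⟩
      simp
      omega
  rw [this, Set.ncard_image_of_injective, Set.ncard_univ, Nat.card_fin]
  intro i j hij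
  simpa [Fin.ext_iff] using hij

theorem eq_lastNodes {ℓ n : ℕ} {S : Set (Fin n)} (hS : IsUpperSet S) (hc : S.ncard = ℓ) :
    S = lastNodes ℓ n := by
  have hle : ℓ ≤ n := by
    rw [← hc]
    simpa using Set.ncard_le_ncard (Set.subset_univ S)
  have hu : IsUpperSet (lastNodes ℓ n) := fun i j hij hi => by
    have : (i : ℕ) ≤ j := hij
    simp only [lastNodes, Set.mem_ofPred_eq] at hi ⊢
    omega
  have hcard := ncard_lastNodes hle
  rcases hS.total hu with h | h
  · exact Set.eq_of_subset_of_ncard_le h (by rw [hc, hcard])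
  · exact (Set.eq_of_subset_of_ncard_le h (by rw [hc, hcard])).symm

/-- The law of the number of cuts needed to isolate an upper set depends only on the sizes of the
tree and of the set. -/
theorem treeExp_eq_expLast {W : Type*} [LinearOrder W] [Finite W] {S : Set W} (hS : IsUpperSet S)
    (F : ℕ → ℝ) : treeExp S F = expLast (Nat.card W) S.ncard F := by
  have := Fintype.ofFinite W
  let e : Fin (Nat.card W) ≃o W := Fintype.orderIsoFinOfCardEq W Nat.card_eq_fintype_card.symm
  have hbot : ∀ v : Fin (Nat.card W), IsBot (e v) ↔ IsBot v := fun v =>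
    ⟨fun h w => e.le_iff_le.1 (h (e w)), fun h w => by
      rw [← e.apply_symm_apply w]; exact e.le_iff_le.2 (h _)⟩
  have hS' : e ⁻¹' S = lastNodes S.ncard (Nat.card W) := by
    refine eq_lastNodes (fun i j hij hi => hS (e.monotone hij) hi) ?_
    rw [← Set.ncard_image_of_injective _ e.injective, Set.image_preimage_eq _ e.surjective]
  rw [expLast_eq_treeExp, treeExp, treeExp]
  let E : ParentMap (Fin (Nat.card W)) → ParentMap W := fun f =>
    ⟨fun v => e (f (e.symm v)), fun v => by
      obtain ⟨v, rfl⟩ := e.surjective v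
      simpa only [hbot, e.symm_apply_apply, e.lt_iff_lt, e.injective.eq_iff] using f.spec v⟩
  refine (Fintype.expect_bijective E ⟨fun f g h => ?_, fun f => ?_⟩ _ _ fun f => ?_).symm
  · ext1 v
    have := congrArg (fun g : ParentMap W => g (e v)) h
    simpa [E] using this
  · refine ⟨⟨fun v => e.symm (f (e v)), fun v => ?_⟩, ?_⟩
    · simpa only [← hbot, ← e.lt_iff_lt, ← e.injective.eq_iff, e.apply_symm_apply] using f.spec (e v)
    · ext1 v
      simp [E]
  · rw [← hS']
    have := expCuts_map e.toEquiv.toEmbedding S (parentGraph f) F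
    rw [parentGraph_map_equiv] at this
    exact this.symm

end Law

end NodeIsolation

/-! ### The splitting property of random recursive trees -/

namespace NodeIsolation

open scoped BigOperators

namespace ParentMap

variable {V : Type*} [LinearOrder V]

/-- The vertices of the subtree rooted at `e`. -/
def desc (f : ParentMap V) (e : V) : Set V :=
  {v | ∃ k, f^[k] v = e}

theorem self_mem_desc (f : ParentMap V) (e : V) : e ∈ f.desc e := ⟨0, rfl⟩

theorem apply_mem_desc_iff (f : ParentMap V) {e v : V} (hv : v ≠ e) :
    f v ∈ f.desc e ↔ v ∈ f.desc e := by
  constructor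
  · rintro ⟨k, hk⟩
    exact ⟨k + 1, hk⟩
  · rintro ⟨k, hk⟩
    cases k with
    | zero => exact absurd hk hv
    | succ k => exact ⟨k, hk⟩

theorem le_of_mem_desc (f : ParentMap V) {e v : V} (hv : v ∈ f.desc e) : e ≤ v := by
  obtain ⟨k, hk⟩ := hv
  induction k generalizing v with
  | zero => exact hk.ge
  | succ k ih => exact (ih hk).trans (f.apply_le v)

theorem desc_eq_of_forall [WellFoundedLT V] (f : ParentMap V) {e : V} {B : Set V}
    (heB : IsLeast B e) (h : ∀ v, v ≠ e → (f v ∈ B ↔ v ∈ B)) : f.desc e = B := by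
  ext v
  induction v using WellFoundedLT.induction with
  | _ v ih =>
    by_cases hv : v = e
    · rw [hv]
      exact ⟨fun _ => heB.1, fun _ => f.self_mem_desc e⟩
    · rw [← f.apply_mem_desc_iff hv, ← h v hv]
      by_cases hb : IsBot v
      · rw [f.apply_eq hb]
        constructor <;> intro h'
        · exact absurd (le_antisymm (hb e) (f.le_of_mem_desc h')) hv
        · exact absurd (le_antisymm (hb e) (heB.2 h')) hv
      · exact ih _ (f.apply_lt hb)

open scoped Classical in
/-- The union of the recursive trees `f₁` on `B` and `f₂` on the complement of `B`. -/
noncomputable def union {B : Set V} (f₁ : ParentMap B) (f₂ : ParentMap ↥(Bᶜ)) (v : V) : V :=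
  if h : v ∈ B then f₁ ⟨v, h⟩ else f₂ ⟨v, h⟩

theorem union_of_mem {B : Set V} (f₁ : ParentMap B) (f₂ : ParentMap ↥(Bᶜ)) {v : V} (h : v ∈ B) :
    union f₁ f₂ v = f₁ ⟨v, h⟩ := dif_pos h

theorem union_of_notMem {B : Set V} (f₁ : ParentMap B) (f₂ : ParentMap ↥(Bᶜ)) {v : V}
    (h : v ∉ B) : union f₁ f₂ v = f₂ ⟨v, h⟩ := dif_neg h

theorem union_mem_iff {B : Set V} (f₁ : ParentMap B) (f₂ : ParentMap ↥(Bᶜ)) (v : V) :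
    union f₁ f₂ v ∈ B ↔ v ∈ B := by
  by_cases h : v ∈ B
  · simp [union_of_mem, h]
  · simp only [union_of_notMem f₁ f₂ h, h, iff_false]
    exact (f₂ ⟨v, h⟩).2

theorem parentGraph_union {B : Set V} (f₁ : ParentMap B) (f₂ : ParentMap ↥(Bᶜ)) :
    parentGraph (union f₁ f₂) = (parentGraph f₁).map (Function.Embedding.subtype (· ∈ B))
      ⊔ (parentGraph f₂).map (Function.Embedding.subtype (· ∈ Bᶜ)) := by
  have key : ∀ a b, a ≠ b → union f₁ f₂ a = b →
      ((parentGraph f₁).map (Function.Embedding.subtype (· ∈ B))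
      ⊔ (parentGraph f₂).map (Function.Embedding.subtype (· ∈ Bᶜ))).Adj a b := by
    rintro a b hne rfl
    by_cases h : a ∈ B
    · refine Or.inl (SimpleGraph.map_adj .. |>.2
        ⟨⟨a, h⟩, f₁ ⟨a, h⟩, ⟨?_, Or.inl rfl⟩, rfl, (union_of_mem f₁ f₂ h).symm⟩)
      intro h'
      exact hne ((congrArg Subtype.val h').trans (union_of_mem f₁ f₂ h).symm)
    · refine Or.inr (SimpleGraph.map_adj .. |>.2
        ⟨⟨a, h⟩, f₂ ⟨a, h⟩, ⟨?_, Or.inl rfl⟩, rfl, (union_of_notMem f₁ f₂ h).symm⟩)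
      intro h'
      exact hne ((congrArg Subtype.val h').trans (union_of_notMem f₁ f₂ h).symm)
  refine le_antisymm ?_ (sup_le ?_ ?_)
  · rintro a b ⟨hne, h | h⟩
    · exact key a b hne h
    · exact (key b a hne.symm h).symm
  · intro a b h
    obtain ⟨a, b, ⟨hne, hab⟩, rfl, rfl⟩ := (SimpleGraph.map_adj ..).1 h
    refine ⟨fun h => hne (Subtype.ext h), ?_⟩
    simpa [union_of_mem, Subtype.ext_iff] using hab
  · intro a b h
    obtain ⟨a, b, ⟨hne, hab⟩, rfl, rfl⟩ := (SimpleGraph.map_adj ..).1 h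
    refine ⟨fun h => hne (Subtype.ext h), ?_⟩
    have ha : (a : V) ∉ B := a.2
    have hb : (b : V) ∉ B := b.2
    simpa [union_of_notMem, ha, hb, Subtype.ext_iff] using hab

theorem spec_attach [Finite V] {B : Set V} {e : V} (he : ¬ IsBot e) (heB : IsLeast B e)
    (p : Set.Iio e) (f₁ : ParentMap B) (f₂ : ParentMap ↥(Bᶜ)) (v : V) :
    Function.update (union f₁ f₂) e p v < v
      ∨ Function.update (union f₁ f₂) e p v = v ∧ IsBot v := by
  by_cases hve : v = e
  · subst hve
    rw [Function.update_self]
    exact Or.inl p.2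
  rw [Function.update_of_ne hve]
  by_cases h : v ∈ B
  · rw [union_of_mem f₁ f₂ h]
    refine (f₁.spec ⟨v, h⟩).imp id fun h1 => ?_
    exact absurd (le_antisymm (show v ≤ e from h1.2 ⟨e, heB.1⟩) (heB.2 h)) hve
  · rw [union_of_notMem f₁ f₂ h]
    refine (f₂.spec ⟨v, h⟩).imp id fun h1 => ⟨congrArg Subtype.val h1.1, fun w => ?_⟩
    have : Nonempty V := ⟨v⟩
    obtain ⟨b, hb⟩ := Finite.exists_min (id : V → V)
    have hbB : b ∉ B := fun hb' => he fun w => (heB.2 hb').trans (hb w)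
    exact le_trans (h1.2 ⟨b, hbB⟩) (hb w)

/-- The recursive tree obtained from recursive trees on `B` and its complement by attaching the
root `e` of the former to the vertex `p` of the latter. -/
noncomputable def attach [Finite V] {B : Set V} {e : V} (he : ¬ IsBot e) (heB : IsLeast B e)
    (x : Set.Iio e × ParentMap B × ParentMap ↥(Bᶜ)) : ParentMap V :=
  ⟨Function.update (union x.2.1 x.2.2) e x.1, spec_attach he heB x.1 x.2.1 x.2.2⟩

section Attach

variable [Finite V] {B : Set V} {e : V} (he : ¬ IsBot e) (heB : IsLeast B e)
  (x : Set.Iio e × ParentMap B × ParentMap ↥(Bᶜ))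

theorem attach_self : attach he heB x e = x.1 := Function.update_self ..

theorem attach_of_ne {v : V} (hv : v ≠ e) : attach he heB x v = union x.2.1 x.2.2 v :=
  Function.update_of_ne hv ..

theorem desc_attach : (attach he heB x).desc e = B :=
  desc_eq_of_forall _ heB fun v hv => by rw [attach_of_ne he heB x hv, union_mem_iff]

theorem update_attach : Function.update (attach he heB x) e e = union x.2.1 x.2.2 := by
  have hbot : IsBot (⟨e, heB.1⟩ : B) := fun b => heB.2 b.2
  ext v
  by_cases hv : v = e
  · subst hv
    rw [Function.update_self, union_of_mem _ _ heB.1, x.2.1.apply_eq hbot]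
  · rw [Function.update_of_ne hv, attach_of_ne he heB x hv]

theorem attach_injective : Function.Injective (attach he heB) := by
  intro x y h
  have hu : union x.2.1 x.2.2 = union y.2.1 y.2.2 := by
    rw [← update_attach he heB x, h, update_attach]
  refine Prod.ext (Subtype.ext ?_) (Prod.ext ?_ ?_)
  · rw [← attach_self he heB x, h, attach_self]
  · ext1 v
    refine Subtype.ext ?_
    have := congrFun hu v
    rwa [union_of_mem _ _ v.2, union_of_mem _ _ v.2] at this
  · ext1 v
    refine Subtype.ext ?_
    have := congrFun hu v
    rwa [union_of_notMem _ _ v.2, union_of_notMem _ _ v.2] at this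

theorem exists_attach_eq (f : ParentMap V) (hf : f.desc e = B) : ∃ x, attach he heB x = f := by
  classical
  have hiff : ∀ v, v ≠ e → (f v ∈ B ↔ v ∈ B) := fun v hv => hf ▸ f.apply_mem_desc_iff hv
  have hbot : ∀ {v : V}, IsBot v → v ∉ B := fun {v} hv hvB =>
    he fun w => (heB.2 hvB).trans (hv w)
  let f₁ : ParentMap B := ⟨fun v => if h : (v : V) = e then v else ⟨f v, (hiff v h).2 v.2⟩,
    fun v => by
      by_cases h : (v : V) = e
      · refine Or.inr ⟨dif_pos h, fun b => ?_⟩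
        exact (h ▸ heB.2 b.2 : (v : V) ≤ b)
      · refine Or.inl ?_
        rw [dif_neg h]
        exact (f.apply_lt fun hb => hbot hb v.2 : f v < v)⟩
  have hne : ∀ v ∉ B, v ≠ e := fun v hv h => hv (h ▸ heB.1)
  let f₂ : ParentMap ↥(Bᶜ) := ⟨fun v => ⟨f v, fun h => v.2 ((hiff v (hne v v.2)).1 h)⟩,
    fun v => (f.spec v).imp id fun h => ⟨Subtype.ext h.1, fun w => h.2 w⟩⟩
  refine ⟨⟨⟨f e, f.apply_lt he⟩, f₁, f₂⟩, ?_⟩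
  ext1 v
  by_cases hv : v = e
  · subst hv
    rw [attach_self]
  · rw [attach_of_ne _ _ _ hv]
    by_cases h : v ∈ B
    · rw [union_of_mem _ _ h]
      exact congrArg Subtype.val (dif_neg hv)
    · rw [union_of_notMem _ _ h]
      rfl

end Attach

open scoped Classical in
/-- Given the vertex set `B` of the subtree that is cut off, the two parts of the tree are
independent random recursive trees. -/
theorem sum_filter_desc_eq [Fintype V] {B : Set V} {e : V} (he : ¬ IsBot e) (heB : IsLeast B e)
    (G : (V → V) → ℝ) :
    ∑ f : ParentMap V with f.desc e = B, G (Function.update f e e)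
      = ∑ x : Set.Iio e × ParentMap B × ParentMap ↥(Bᶜ), G (union x.2.1 x.2.2) := by
  symm
  refine Finset.sum_bij (fun x _ => attach he heB x) ?_ ?_ ?_ ?_
  · intro x _
    simp [desc_attach]
  · intro x _ y _ h
    exact attach_injective he heB h
  · intro f hf
    obtain ⟨x, hx⟩ := exists_attach_eq he heB f (Finset.mem_filter.1 hf).2
    exact ⟨x, Finset.mem_univ _, hx⟩
  · intro x _
    rw [update_attach]

end ParentMap

section Splitting

variable {V : Type*} [LinearOrder V] [Finite V]

theorem sum_expCuts_union {B : Set V} {S : Set V} (hS : IsUpperSet S) (F : ℕ → ℝ) :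
    ∑ x : ParentMap B × ParentMap ↥(Bᶜ), expCuts S (parentGraph (ParentMap.union x.1 x.2)) F
      = (Nat.card (ParentMap B) * Nat.card (ParentMap ↥(Bᶜ)) : ℝ)
        * expLast B.ncard (B ∩ S).ncard fun i =>
          expLast Bᶜ.ncard (Bᶜ ∩ S).ncard fun j => F (i + j) := by
  have hup : ∀ C : Set V, IsUpperSet (Subtype.val ⁻¹' S : Set C) := fun C a b hab ha => hS hab ha
  have hcard : ∀ C : Set V, (Subtype.val ⁻¹' S : Set C).ncard = (C ∩ S).ncard := fun C => by
    rw [← Set.ncard_image_of_injective _ Subtype.val_injective, Subtype.image_preimage_coe]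
  have h1 : ∀ (C : Set V) (F : ℕ → ℝ), expLast C.ncard (C ∩ S).ncard F
      = treeExp (Subtype.val ⁻¹' S : Set C) F := fun C F => by
    rw [treeExp_eq_expLast (hup C), hcard, Nat.card_coe_set_eq]
  have h2 : ∀ x : ParentMap B × ParentMap ↥(Bᶜ),
      expCuts S (parentGraph (ParentMap.union x.1 x.2)) F
        = expCuts (Subtype.val ⁻¹' S : Set B) (parentGraph x.1) fun i =>
          expCuts (Subtype.val ⁻¹' S : Set ↥(Bᶜ)) (parentGraph x.2) fun j => F (i + j) := by
    intro x
    rw [ParentMap.parentGraph_union, expCuts_sup, expCuts_map]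
    · simp only [expCuts_map]
      rfl
    · intro u v w h h'
      obtain ⟨a, -, -, rfl, -⟩ := (SimpleGraph.map_adj ..).1 h
      obtain ⟨b, -, -, hb, -⟩ := (SimpleGraph.map_adj ..).1 h'
      exact b.2 (by rw [show (b : V) = a from hb]; exact a.2)
  simp only [h1, h2]
  rw [Fintype.sum_prod_type]
  simp only [← expCuts_sum]
  rw [treeExp, mul_right_comm, Nat.card_eq_fintype_card, Fintype.card_mul_expect, mul_comm,
    Finset.mul_sum]
  refine Finset.sum_congr rfl fun f _ => ?_
  rw [← expCuts_const_mul]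
  congr 1
  ext i
  rw [treeExp, Nat.card_eq_fintype_card, Fintype.card_mul_expect]

/-- For a given `e`, cutting the edge above `e` in a random recursive tree produces two independent
random recursive trees, given the vertex set of the subtree rooted at `e`. -/
theorem sum_expCuts_update {S : Set V} (hS : IsUpperSet S) {e : V} (he : ¬ IsBot e) (F : ℕ → ℝ) :
    ∑ f : ParentMap V, expCuts S (parentGraph (Function.update f e e)) F
      = ∑ f : ParentMap V, expLast (f.desc e).ncard (f.desc e ∩ S).ncard fun i =>
          expLast (f.desc e)ᶜ.ncard ((f.desc e)ᶜ ∩ S).ncard fun j => F (i + j) := by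
  classical
  have := Fintype.ofFinite V
  rw [← Finset.sum_fiberwise _ (fun f : ParentMap V => f.desc e),
    ← Finset.sum_fiberwise _ (fun f : ParentMap V => f.desc e) (fun f => expLast _ _ _)]
  refine Finset.sum_congr rfl fun B _ => ?_
  by_cases hB : IsLeast B e
  · have hcount : (∑ f : ParentMap V with f.desc e = B, (1 : ℝ))
        = Nat.card (Set.Iio e) * (Nat.card (ParentMap B) * Nat.card (ParentMap ↥(Bᶜ))) := by
      rw [ParentMap.sum_filter_desc_eq he hB fun _ => (1 : ℝ)]
      simp [Nat.card_eq_fintype_card]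
    rw [ParentMap.sum_filter_desc_eq he hB fun f => expCuts S (parentGraph f) F,
      Fintype.sum_prod_type]
    simp only [sum_expCuts_union hS]
    rw [Finset.sum_const, Finset.card_univ, nsmul_eq_mul, ← mul_assoc,
      ← Nat.card_eq_fintype_card, ← hcount, Finset.sum_mul]
    refine Finset.sum_congr rfl fun f hf => ?_
    rw [(Finset.mem_filter.1 hf).2, one_mul]
  · have : (Finset.univ.filter fun f : ParentMap V => f.desc e = B) = ∅ := by
      refine Finset.filter_eq_empty_iff.2 fun f _ h => hB ?_
      subst h
      exact ⟨f.self_mem_desc e, fun v hv => f.le_of_mem_desc hv⟩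
    rw [this, Finset.sum_empty, Finset.sum_empty]

end Splitting

section Recursion

theorem isBot_fin_iff {m : ℕ} (v : Fin (m + 1)) : IsBot v ↔ v = 0 :=
  ⟨fun h => le_antisymm (h 0) (Fin.zero_le v), fun h => h ▸ Fin.zero_le⟩

theorem not_isBot_succ {m : ℕ} (i : Fin m) : ¬ IsBot i.succ := by
  rw [isBot_fin_iff]
  exact Fin.succ_ne_zero i

/-- The first cut in a recursive tree. -/
theorem mul_expCuts_parentGraph {m : ℕ} {S : Set (Fin (m + 1))} (hS : S.Nonempty)
    (f : ParentMap (Fin (m + 1))) (F : ℕ → ℝ) :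
    (m : ℝ) * expCuts S (parentGraph f) F
      = ∑ i : Fin m, expCuts S (parentGraph (Function.update f i.succ i.succ))
          fun k => F (k + 1) := by
  classical
  have hav : availableEdges S (parentGraph f) = (parentGraph f).edgeSet := by
    obtain ⟨x, hx⟩ := hS
    ext e
    refine ⟨fun h => h.1, fun h => ⟨h, x, hx, ?_⟩⟩
    induction e with
    | _ a b => exact ⟨a, Sym2.mem_mk_left _ _, (parentGraph_connected f).preconnected x a⟩
  have hinj : Function.Injective fun i : Fin m => s(i.succ, f i.succ) := by
    intro i j h
    exact Fin.succ_injective _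
      (parentGraph_edge_injOn f (not_isBot_succ i) (not_isBot_succ j) h)
  have hset : (parentGraph f).edgeSet = Set.range fun i : Fin m => s(i.succ, f i.succ) := by
    rw [edgeSet_parentGraph]
    ext e
    simp only [Set.mem_image, Set.mem_ofPred_eq, Set.mem_range, isBot_fin_iff]
    constructor
    · rintro ⟨v, hv, rfl⟩
      obtain ⟨i, rfl⟩ := Fin.exists_succ_eq.2 hv
      exact ⟨i, rfl⟩
    · rintro ⟨i, rfl⟩
      exact ⟨i.succ, Fin.succ_ne_zero i, rfl⟩
  have hcard : (availableEdges S (parentGraph f)).ncard = m := by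
    have := ncard_edgeSet_parentGraph f
    rw [Nat.card_fin] at this
    rw [hav]
    omega
  have h := ncard_mul_expCuts S (parentGraph f) F
  rw [hcard] at h
  rw [h]
  have hfin : (availableEdges S (parentGraph f)).toFinite.toFinset
      = Finset.univ.image fun i : Fin m => s(i.succ, f i.succ) := by
    ext e
    simp [hav, hset]
  rw [hfin, Finset.sum_image fun i _ j _ h => hinj h]
  refine Finset.sum_congr rfl fun i _ => ?_
  rw [parentGraph_deleteEdges f (not_isBot_succ i)]

/-- A recursive tree `x.1` of size `m + 1` together with its edge above the vertex `x.2.succ`. -/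
abbrev Cutting (m : ℕ) : Type := ParentMap (Fin (m + 1)) × Fin m

/-- The size of the subtree rooted at the vertex `x.2.succ` of the recursive tree `x.1`. -/
noncomputable def cutSize {m : ℕ} (x : Cutting m) : ℕ :=
  (x.1.desc x.2.succ).ncard

/-- The number of the last `ℓ` nodes in the subtree rooted at the vertex `x.2.succ` of the
recursive tree `x.1`. -/
noncomputable def cutLast {m : ℕ} (ℓ : ℕ) (x : Cutting m) : ℕ :=
  (x.1.desc x.2.succ ∩ lastNodes ℓ (m + 1)).ncard

theorem cutLast_le {m ℓ : ℕ} (hℓ : ℓ ≤ m + 1) (x : Cutting m) :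
    cutLast ℓ x ≤ ℓ := by
  conv_rhs => rw [← ncard_lastNodes hℓ]
  exact Set.ncard_le_ncard Set.inter_subset_right

theorem cutSize_pos {m : ℕ} (x : Cutting m) : 0 < cutSize x :=
  (Set.ncard_pos (Set.toFinite _)).2 ⟨_, x.1.self_mem_desc _⟩

theorem cutSize_le {m : ℕ} (x : Cutting m) : cutSize x ≤ m := by
  have h0 : (0 : Fin (m + 1)) ∈ (x.1.desc x.2.succ)ᶜ := fun h =>
    absurd (x.1.le_of_mem_desc h) (Fin.succ_pos _).not_ge
  have h1 : 0 < (x.1.desc x.2.succ)ᶜ.ncard := (Set.ncard_pos (Set.toFinite _)).2 ⟨_, h0⟩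
  have h2 := Set.ncard_add_ncard_compl (x.1.desc x.2.succ)
  rw [Nat.card_fin] at h2
  rw [cutSize]
  omega

/-- The distributional recursion for the number of cuts. -/
theorem expLast_succ {m ℓ : ℕ} (hm : m ≠ 0) (hℓ : 1 ≤ ℓ) (hℓm : ℓ ≤ m + 1) (F : ℕ → ℝ) :
    expLast (m + 1) ℓ F = 𝔼 x : Cutting m,
      expLast (cutSize x) (cutLast ℓ x) fun i =>
        expLast (m + 1 - cutSize x) (ℓ - cutLast ℓ x) fun j => F (i + j + 1) := by
  have hu : IsUpperSet (lastNodes ℓ (m + 1)) := fun i j hij hi => by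
    have : (i : ℕ) ≤ j := hij
    simp only [lastNodes, Set.mem_ofPred_eq] at hi ⊢
    omega
  have hne : (lastNodes ℓ (m + 1)).Nonempty := by
    rw [← Set.ncard_pos, ncard_lastNodes hℓm]
    exact hℓ
  have hsum : (m : ℝ) * ∑ f : ParentMap (Fin (m + 1)), expCuts (lastNodes ℓ (m + 1)) (parentGraph f) F
      = ∑ x : Cutting m, expLast (cutSize x) (cutLast ℓ x) fun i =>
        expLast (m + 1 - cutSize x) (ℓ - cutLast ℓ x) fun j => F (i + j + 1) := by
    rw [Finset.mul_sum, Finset.sum_congr rfl fun f _ => mul_expCuts_parentGraph hne f F,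
      Finset.sum_comm, Fintype.sum_prod_type_right]
    refine Finset.sum_congr rfl fun i _ => ?_
    rw [sum_expCuts_update hu (not_isBot_succ i)]
    refine Finset.sum_congr rfl fun f _ => ?_
    have h1 : (f.desc i.succ)ᶜ.ncard = m + 1 - cutSize (f, i) := by
      have := Set.ncard_add_ncard_compl (f.desc i.succ)
      rw [Nat.card_fin] at this
      exact (Nat.sub_eq_of_eq_add' this.symm).symm
    have h2 : ((f.desc i.succ)ᶜ ∩ lastNodes ℓ (m + 1)).ncard = ℓ - cutLast ℓ (f, i) := by
      have := Set.ncard_inter_add_ncard_sdiff_eq_ncard (lastNodes ℓ (m + 1)) (f.desc i.succ)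
      rw [ncard_lastNodes hℓm] at this
      rw [cutLast, Set.inter_comm, ← Set.sdiff_eq, Set.inter_comm (ParentMap.desc _ _)]
      exact (Nat.sub_eq_of_eq_add' this.symm).symm
    rw [h1, h2]
    rfl
  rw [expLast_eq_treeExp, treeExp, Fintype.expect_eq_sum_div_card, Fintype.expect_eq_sum_div_card,
    ← hsum, Fintype.card_prod, Fintype.card_fin]
  have : (m : ℝ) ≠ 0 := Nat.cast_ne_zero.2 hm
  push_cast
  rw [mul_comm (Fintype.card _ : ℝ), mul_div_mul_left _ _ this]

end Recursion

end NodeIsolation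

/-! ### Moments of the size of the subtree that is cut off first -/

namespace NodeIsolation

open scoped BigOperators

namespace ParentMap

variable {V : Type*} [LinearOrder V]

/-- The recursive tree obtained by attaching the subtree rooted at `j` to `p`. -/
def reattach (f : ParentMap V) (j : V) (p : Set.Iio j) : ParentMap V :=
  ⟨Function.update f j p, fun v => by
    by_cases h : v = j
    · subst h
      rw [Function.update_self]
      exact Or.inl p.2
    · rw [Function.update_of_ne h]
      exact f.spec v⟩

theorem reattach_self (f : ParentMap V) (j : V) (p : Set.Iio j) : f.reattach j p j = p :=
  Function.update_self ..

theorem reattach_of_ne (f : ParentMap V) {j v : V} (p : Set.Iio j) (h : v ≠ j) :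
    f.reattach j p v = f v :=
  Function.update_of_ne h ..

theorem mem_desc_reattach_iff (f : ParentMap V) {j v : V} (p : Set.Iio j) (hv : v < j) (e : V) :
    v ∈ (f.reattach j p).desc e ↔ v ∈ f.desc e := by
  have key : ∀ k, ∀ w < j, (f.reattach j p)^[k] w = f^[k] w := by
    intro k
    induction k with
    | zero => exact fun w _ => rfl
    | succ k ih =>
      intro w hw
      rw [Function.iterate_succ_apply, Function.iterate_succ_apply, reattach_of_ne f p hw.ne,
        ih _ ((f.apply_le w).trans_lt hw)]
  simp only [desc, Set.mem_ofPred_eq, key _ v hv]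

/-- In a random recursive tree, the parent of `j` is uniformly distributed on the vertices before
`j`, independently of the tree on these vertices. -/
theorem card_mul_sum_apply [Fintype V] {j : V} (hj : ¬ IsBot j) (g : ParentMap V → V → ℝ)
    (hg : ∀ (f : ParentMap V) (p : Set.Iio j) (x : V), x < j → g (f.reattach j p) x = g f x) :
    (Nat.card (Set.Iio j) : ℝ) * ∑ f : ParentMap V, g f (f j)
      = ∑ f : ParentMap V, ∑ p : Set.Iio j, g f p := by
  let σ : ParentMap V × Set.Iio j → ParentMap V × Set.Iio j :=
    fun x => (x.1.reattach j x.2, ⟨x.1 j, x.1.apply_lt hj⟩)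
  have hσ : Function.Involutive σ := by
    rintro ⟨f, p⟩
    refine Prod.ext ?_ (Subtype.ext (f.reattach_self j p))
    ext1 v
    by_cases h : v = j
    · subst h
      exact reattach_self ..
    · exact (reattach_of_ne _ _ h).trans (reattach_of_ne _ _ h)
  have h : ∑ x : ParentMap V × Set.Iio j, g (σ x).1 (σ x).2
      = ∑ x : ParentMap V × Set.Iio j, g x.1 x.2 :=
    Equiv.sum_comp hσ.toPerm fun x => g x.1 x.2
  rw [← Fintype.sum_prod_type', ← h]
  have : ∀ x : ParentMap V × Set.Iio j, g (σ x).1 (σ x).2 = g x.1 (x.1 j) :=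
    fun x => hg x.1 x.2 _ (x.1.apply_lt hj)
  simp only [this]
  rw [Fintype.sum_prod_type, Finset.mul_sum]
  simp [Nat.card_eq_fintype_card]

end ParentMap

open scoped Classical in
/-- The indicator of the event that the vertex `i` belongs to the subtree that is cut off when the
edge above `x.2.succ` is removed from `x.1`. -/
noncomputable def cutInd {m : ℕ} (x : Cutting m) (i : Fin (m + 1)) : ℝ :=
  if i ∈ x.1.desc x.2.succ then 1 else 0

section Common

variable {m : ℕ}

/-- The number of common ancestors of `i` and `j` in a recursive tree other than the root,
where every vertex is an ancestor of itself. -/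
noncomputable def commonAncestors (f : ParentMap (Fin (m + 1))) (i j : Fin (m + 1)) : ℝ :=
  ∑ e : Fin m, cutInd (f, e) i * cutInd (f, e) j

/-- The expected number of common ancestors of two vertices in a random recursive tree. -/
noncomputable def meanCommonAncestors (i j : Fin (m + 1)) : ℝ :=
  𝔼 f : ParentMap (Fin (m + 1)), commonAncestors f i j

theorem commonAncestors_comm (f : ParentMap (Fin (m + 1))) (i j : Fin (m + 1)) :
    commonAncestors f i j = commonAncestors f j i :=
  Finset.sum_congr rfl fun _ _ => mul_comm _ _

theorem meanCommonAncestors_comm (i j : Fin (m + 1)) :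
    meanCommonAncestors i j = meanCommonAncestors j i :=
  Finset.expect_congr rfl fun _ _ => commonAncestors_comm _ _ _

theorem cutInd_congr {x y : Cutting m} {i j : Fin (m + 1)}
    (h : i ∈ x.1.desc x.2.succ ↔ j ∈ y.1.desc y.2.succ) : cutInd x i = cutInd y j := by
  classical
  exact if_congr h rfl rfl

theorem cutInd_apply_of_ne (f : ParentMap (Fin (m + 1))) (e : Fin m) {j : Fin (m + 1)}
    (h : j ≠ e.succ) : cutInd (f, e) (f j) = cutInd (f, e) j :=
  cutInd_congr (f.apply_mem_desc_iff h)

theorem cutInd_of_lt (f : ParentMap (Fin (m + 1))) (e : Fin m) {j : Fin (m + 1)}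
    (h : j < e.succ) : cutInd (f, e) j = 0 :=
  if_neg fun h' => (f.le_of_mem_desc h').not_gt h

theorem cutInd_succ (f : ParentMap (Fin (m + 1))) (e : Fin m) : cutInd (f, e) e.succ = 1 :=
  if_pos (f.self_mem_desc _)

theorem cutInd_mul_self (x : Cutting m) (i : Fin (m + 1)) :
    cutInd x i * cutInd x i = cutInd x i := by
  unfold cutInd
  split_ifs <;> simp

theorem commonAncestors_of_lt (f : ParentMap (Fin (m + 1))) {i j : Fin (m + 1)} (h : i < j) :
    commonAncestors f i j = commonAncestors f i (f j) := by
  refine Finset.sum_congr rfl fun e _ => ?_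
  by_cases hj : j = e.succ
  · rw [cutInd_of_lt f e (hj ▸ h), zero_mul, zero_mul]
  · rw [cutInd_apply_of_ne f e hj]

theorem commonAncestors_self (f : ParentMap (Fin (m + 1))) (j : Fin m) :
    commonAncestors f j.succ j.succ = 1 + commonAncestors f (f j.succ) (f j.succ) := by
  rw [commonAncestors, commonAncestors, ← Finset.add_sum_erase _ _ (Finset.mem_univ j),
    ← Finset.add_sum_erase _ (fun e => cutInd (f, e) (f j.succ) * cutInd (f, e) (f j.succ))
      (Finset.mem_univ j), cutInd_succ, cutInd_of_lt f j (f.apply_lt (not_isBot_succ j))]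
  rw [mul_one, mul_zero, zero_add]
  congr 1
  refine Finset.sum_congr rfl fun e he => ?_
  rw [cutInd_apply_of_ne f e fun h => Finset.ne_of_mem_erase he (Fin.succ_injective _ h).symm]

theorem commonAncestors_zero (f : ParentMap (Fin (m + 1))) (j : Fin (m + 1)) :
    commonAncestors f 0 j = 0 :=
  Finset.sum_eq_zero fun e _ => by rw [cutInd_of_lt f e (Fin.succ_pos e), zero_mul]

theorem commonAncestors_reattach (f : ParentMap (Fin (m + 1))) {i j k : Fin (m + 1)}
    (p : Set.Iio k) (hi : i < k) (hj : j < k) :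
    commonAncestors (f.reattach k p) i j = commonAncestors f i j := by
  exact Finset.sum_congr rfl fun e _ => congrArg₂ _
    (cutInd_congr (f.mem_desc_reattach_iff p hi _)) (cutInd_congr (f.mem_desc_reattach_iff p hj _))

theorem mul_expect_apply {j : Fin (m + 1)} (hj : j ≠ 0)
    (g : ParentMap (Fin (m + 1)) → Fin (m + 1) → ℝ)
    (hg : ∀ (f : ParentMap (Fin (m + 1))) (p : Set.Iio j) (x : Fin (m + 1)), x < j →
      g (f.reattach j p) x = g f x) :
    (j : ℝ) * 𝔼 f : ParentMap (Fin (m + 1)), g f (f j)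
      = ∑ p ∈ Finset.Iio j, 𝔼 f : ParentMap (Fin (m + 1)), g f p := by
  have h := ParentMap.card_mul_sum_apply (by rwa [isBot_fin_iff]) g hg
  have hc : Nat.card (Set.Iio j) = j := by
    simp
  rw [hc, Finset.sum_comm] at h
  simp only [Fintype.expect_eq_sum_div_card]
  rw [← mul_div_assoc, h, ← Finset.sum_div]
  congr 1
  exact (Finset.sum_subtype (p := (· ∈ Set.Iio j)) _ (by simp)
    fun p => ∑ f : ParentMap (Fin (m + 1)), g f p).symm

theorem sum_Iio_val (j : Fin (m + 1)) (g : ℕ → ℝ) :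
    ∑ p ∈ Finset.Iio j, g p = ∑ p ∈ Finset.range j, g p := by
  have := Fin.map_valEmbedding_Iio j
  rw [← Nat.Iio_eq_range, ← this, Finset.sum_map]
  rfl

theorem sum_range_harmonic (n : ℕ) :
    ∑ i ∈ Finset.range n, (harmonic i : ℝ) = n * harmonic n - n := by
  induction n with
  | zero => simp
  | succ n ih =>
    rw [Finset.sum_range_succ, ih, harmonic_succ]
    push_cast
    have : (n : ℝ) + 1 ≠ 0 := by positivity
    field_simp
    ring

/-- The expected depth of a vertex of a random recursive tree. -/
theorem meanCommonAncestors_self (i : Fin (m + 1)) :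
    meanCommonAncestors i i = harmonic i := by
  induction i using WellFoundedLT.induction with
  | _ i ih =>
    obtain rfl | ⟨j, rfl⟩ := Fin.eq_zero_or_eq_succ i
    · simp [meanCommonAncestors, commonAncestors_zero]
    · have h := mul_expect_apply (Fin.succ_ne_zero j) (fun f x => commonAncestors f x x)
        fun f p x hx => commonAncestors_reattach f p hx hx
      have h2 : ∑ p ∈ Finset.Iio j.succ, 𝔼 f : ParentMap (Fin (m + 1)), commonAncestors f p p
          = ∑ p ∈ Finset.Iio j.succ, (harmonic p : ℝ) :=
        Finset.sum_congr rfl fun p hp => ih p (Finset.mem_Iio.1 hp)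
      rw [h2, sum_Iio_val j.succ fun p => (harmonic p : ℝ), sum_range_harmonic] at h
      have h3 : meanCommonAncestors j.succ j.succ
          = 1 + 𝔼 f : ParentMap (Fin (m + 1)), commonAncestors f (f j.succ) (f j.succ) := by
        simp only [meanCommonAncestors, commonAncestors_self, Finset.expect_add_distrib,
          Fintype.expect_const]
      have hpos : ((j.succ : Fin (m + 1)) : ℝ) ≠ 0 := by simp; positivity
      refine mul_left_cancel₀ hpos ?_
      rw [h3, mul_add, h]
      ring

theorem sum_range_div (n : ℕ) :
    ∑ i ∈ Finset.range n, (i : ℝ) / (i + 1) = n - harmonic n := by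
  induction n with
  | zero => simp
  | succ n ih =>
    rw [Finset.sum_range_succ, ih, harmonic_succ]
    push_cast
    have : (n : ℝ) + 1 ≠ 0 := by positivity
    field_simp
    ring

theorem meanCommonAncestors_of_lt {i j : Fin (m + 1)} (hij : i < j) :
    meanCommonAncestors i j = (i : ℝ) / (i + 1) := by
  induction j using WellFoundedLT.induction generalizing i with
  | _ j ih =>
    have hj : j ≠ 0 := (lt_of_le_of_lt (Fin.zero_le i) hij).ne'
    have h := mul_expect_apply hj (fun f x => commonAncestors f i x)
      fun f p x hx => commonAncestors_reattach f p hij hx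
    let g : ℕ → ℝ := fun p => if p < i then (p : ℝ) / (p + 1)
      else if p = i then (harmonic i : ℝ) else (i : ℝ) / (i + 1)
    have h2 : ∑ p ∈ Finset.Iio j, 𝔼 f : ParentMap (Fin (m + 1)), commonAncestors f i p
        = ∑ p ∈ Finset.Iio j, g p := by
      refine Finset.sum_congr rfl fun p hp => ?_
      have hp := Finset.mem_Iio.1 hp
      change meanCommonAncestors i p = g p
      rcases lt_trichotomy p i with hpi | rfl | hpi
      · rw [meanCommonAncestors_comm, ih i hij hpi]
        exact (if_pos hpi).symm
      · rw [meanCommonAncestors_self]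
        simp [g]
      · rw [ih p hp hpi]
        have h1 : ¬ (p : ℕ) < i := not_lt.2 (Fin.le_def.1 hpi.le)
        have h2 : (p : ℕ) ≠ i := (Fin.lt_def.1 hpi).ne'
        simp [g, h1, h2]
    have h3 : ∀ n, (i : ℕ) + 1 ≤ n → ∑ p ∈ Finset.range n, g p = (i : ℝ) / (i + 1) * n := by
      intro n hn
      induction n, hn using Nat.le_induction with
      | base =>
        rw [Finset.sum_range_succ]
        have : ∑ p ∈ Finset.range i, g p = ∑ p ∈ Finset.range i, (p : ℝ) / (p + 1) :=
          Finset.sum_congr rfl fun p hp => if_pos (Finset.mem_range.1 hp)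
        have hgi : g i = harmonic i := by simp [g]
        rw [this, sum_range_div, hgi]
        push_cast
        have : ((i : ℕ) : ℝ) + 1 ≠ 0 := by positivity
        field_simp
        ring
      | succ n hn ih =>
        have h1 : ¬ n < i := by omega
        have h2 : n ≠ i := by omega
        have hgn : g n = (i : ℝ) / (i + 1) := by simp [g, h1, h2]
        rw [Finset.sum_range_succ, ih, hgn]
        push_cast
        ring
    have h4 : meanCommonAncestors i j
        = 𝔼 f : ParentMap (Fin (m + 1)), commonAncestors f i (f j) :=
      Finset.expect_congr rfl fun f _ => commonAncestors_of_lt f hij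
    have hpos : ((j : ℕ) : ℝ) ≠ 0 := by
      rw [Nat.cast_ne_zero]
      exact fun h => hj (Fin.ext h)
    refine mul_left_cancel₀ hpos ?_
    rw [h4, h, h2, sum_Iio_val, h3 j (Fin.lt_def.1 hij), mul_comm]

theorem meanCommonAncestors_le_one {i j : Fin (m + 1)} (h : i ≠ j) :
    meanCommonAncestors i j ≤ 1 := by
  have key : ∀ i j : Fin (m + 1), i < j → meanCommonAncestors i j ≤ 1 := fun i j h => by
    rw [meanCommonAncestors_of_lt h]
    exact div_le_one_of_le₀ (by linarith) (by positivity)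
  rcases h.lt_or_gt with h | h
  · exact key i j h
  · rw [meanCommonAncestors_comm]
    exact key j i h

end Common

section Moments

variable {m : ℕ}

theorem mul_expect_cutInd_mul (i j : Fin (m + 1)) (hm : m ≠ 0) :
    (m : ℝ) * 𝔼 x : Cutting m, cutInd x i * cutInd x j
      = meanCommonAncestors i j := by
  have hm' : (m : ℝ) ≠ 0 := Nat.cast_ne_zero.2 hm
  rw [Fintype.expect_eq_sum_div_card, meanCommonAncestors, Fintype.expect_eq_sum_div_card,
    Fintype.sum_prod_type, Fintype.card_prod, Fintype.card_fin]
  push_cast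
  rw [mul_comm (Fintype.card _ : ℝ), ← mul_div_assoc, mul_div_mul_left _ _ hm']
  rfl

theorem mul_expect_cutInd (i : Fin (m + 1)) (hm : m ≠ 0) :
    (m : ℝ) * 𝔼 x : Cutting m, cutInd x i = harmonic i := by
  rw [← meanCommonAncestors_self, ← mul_expect_cutInd_mul i i hm]
  simp only [cutInd_mul_self]

theorem cutSize_eq_sum (x : Cutting m) :
    (cutSize x : ℝ) = ∑ i, cutInd x i := by
  classical
  rw [cutSize, Set.ncard_eq_toFinset_card']
  simp [cutInd, Finset.sum_boole, Set.toFinset]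

theorem cutLast_eq_sum (ℓ : ℕ) (x : Cutting m) :
    (cutLast ℓ x : ℝ) = ∑ i ∈ (lastNodes ℓ (m + 1)).toFinite.toFinset, cutInd x i := by
  classical
  rw [cutLast, Set.ncard_eq_toFinset_card _ (Set.toFinite _)]
  simp only [cutInd]
  rw [Finset.sum_boole]
  congr 2
  ext i
  simp [and_comm]

theorem card_lastNodes {ℓ : ℕ} (hℓ : ℓ ≤ m + 1) :
    (lastNodes ℓ (m + 1)).toFinite.toFinset.card = ℓ := by
  rw [← Set.ncard_eq_toFinset_card, ncard_lastNodes hℓ]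

theorem mul_expect_sum_mul_sum (hm : m ≠ 0) (A B : Finset (Fin (m + 1))) :
    (m : ℝ) * 𝔼 x : Cutting m,
        (∑ i ∈ A, cutInd x i) * ∑ j ∈ B, cutInd x j
      = ∑ i ∈ A, ∑ j ∈ B, meanCommonAncestors i j := by
  have h : ∀ x : Cutting m, (∑ i ∈ A, cutInd x i) * ∑ j ∈ B, cutInd x j
      = ∑ i ∈ A, ∑ j ∈ B, cutInd x i * cutInd x j := fun x => Finset.sum_mul_sum ..
  simp only [h, Finset.expect_sum_comm]
  simp only [Finset.mul_sum (a := (m : ℝ)) (s := A), Finset.mul_sum (a := (m : ℝ)) (s := B),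
    mul_expect_cutInd_mul _ _ hm]

theorem harmonic_le (n : ℕ) : (harmonic n : ℝ) ≤ n := by
  induction n with
  | zero => simp
  | succ n ih =>
    rw [harmonic_succ]
    push_cast
    have : ((n : ℝ) + 1)⁻¹ ≤ 1 := inv_le_one_of_one_le₀ (by linarith [Nat.cast_nonneg (α := ℝ) n])
    linarith

theorem sum_sum_meanCommonAncestors_le (A B : Finset (Fin (m + 1))) :
    ∑ i ∈ A, ∑ j ∈ B, meanCommonAncestors i j
      ≤ A.card * B.card + ∑ i ∈ A, (harmonic i : ℝ) := by
  classical
  have hh : ∀ i : ℕ, (0 : ℝ) ≤ harmonic i := fun i => by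
    rw [harmonic]
    push_cast
    positivity
  have h : ∀ i j : Fin (m + 1), meanCommonAncestors i j
      ≤ 1 + if i = j then (harmonic i : ℝ) else 0 := by
    intro i j
    split_ifs with hij
    · rw [← hij, meanCommonAncestors_self]
      linarith
    · simpa using meanCommonAncestors_le_one hij
  calc ∑ i ∈ A, ∑ j ∈ B, meanCommonAncestors i j
      ≤ ∑ i ∈ A, ((B.card : ℝ) + (harmonic i : ℝ)) := by
        refine Finset.sum_le_sum fun i _ => (Finset.sum_le_sum fun j _ => h i j).trans ?_
        rw [Finset.sum_add_distrib, Finset.sum_ite_eq, Finset.sum_const, nsmul_one]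
        split_ifs
        · exact le_rfl
        · simpa using hh i
    _ = _ := by rw [Finset.sum_add_distrib, Finset.sum_const, nsmul_eq_mul]

theorem expect_cutSize (hm : m ≠ 0) :
    (m : ℝ) * 𝔼 x : Cutting m, (cutSize x : ℝ)
      = (m + 1) * harmonic (m + 1) - (m + 1) := by
  simp only [cutSize_eq_sum, Finset.expect_sum_comm, Finset.mul_sum]
  simp only [mul_expect_cutInd _ hm]
  rw [Fin.sum_univ_eq_sum_range fun i => (harmonic i : ℝ), sum_range_harmonic]
  push_cast
  ring

theorem expect_cutLast (ℓ : ℕ) (hm : m ≠ 0) :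
    (m : ℝ) * 𝔼 x : Cutting m, (cutLast ℓ x : ℝ)
      = ∑ i ∈ (lastNodes ℓ (m + 1)).toFinite.toFinset, (harmonic i : ℝ) := by
  simp only [cutLast_eq_sum, Finset.expect_sum_comm, Finset.mul_sum]
  simp only [mul_expect_cutInd _ hm]

theorem expect_cutSize_sq_le (hm : m ≠ 0) :
    (m : ℝ) * 𝔼 x : Cutting m, (cutSize x : ℝ) ^ 2
      ≤ 2 * (m + 1) ^ 2 := by
  simp only [cutSize_eq_sum, sq]
  rw [mul_expect_sum_mul_sum hm]
  refine (sum_sum_meanCommonAncestors_le _ _).trans ?_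
  have : ∑ i : Fin (m + 1), (harmonic i : ℝ) ≤ ∑ i : Fin (m + 1), ((m : ℝ) + 1) :=
    Finset.sum_le_sum fun i _ => (harmonic_le i).trans (by exact_mod_cast i.2.le)
  simp only [Finset.sum_const, Finset.card_univ, Fintype.card_fin, nsmul_eq_mul] at this ⊢
  push_cast at this ⊢
  linarith

theorem expect_cutSize_mul_cutLast_le {ℓ : ℕ} (hℓ : ℓ ≤ m + 1) (hm : m ≠ 0) :
    (m : ℝ) * 𝔼 x : Cutting m, (cutLast ℓ x : ℝ) * (cutSize x : ℝ)
      ≤ 2 * ℓ * (m + 1) := by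
  simp only [cutSize_eq_sum, cutLast_eq_sum]
  rw [mul_expect_sum_mul_sum hm]
  refine (sum_sum_meanCommonAncestors_le _ _).trans ?_
  have : ∑ i ∈ (lastNodes ℓ (m + 1)).toFinite.toFinset, (harmonic i : ℝ)
      ≤ ∑ i ∈ (lastNodes ℓ (m + 1)).toFinite.toFinset, ((m : ℝ) + 1) :=
    Finset.sum_le_sum fun i _ => (harmonic_le i).trans (by exact_mod_cast i.2.le)
  simp only [Finset.sum_const, Finset.card_univ, Fintype.card_fin, nsmul_eq_mul,
    card_lastNodes hℓ] at this ⊢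
  push_cast at this ⊢
  linarith

theorem expect_cutLast_mul_pred_le {ℓ : ℕ} (hℓ : ℓ ≤ m + 1) (hm : m ≠ 0) :
    (m : ℝ) * 𝔼 x : Cutting m, (cutLast ℓ x : ℝ) * ((cutLast ℓ x : ℝ) - 1)
      ≤ ℓ ^ 2 := by
  have h : ∀ x : Cutting m,
      (cutLast ℓ x : ℝ) * ((cutLast ℓ x : ℝ) - 1)
        = (cutLast ℓ x : ℝ) * (cutLast ℓ x : ℝ) - (cutLast ℓ x : ℝ) := fun x => by ring
  simp only [h]
  rw [Finset.expect_sub_distrib, mul_sub, expect_cutLast _ hm]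
  simp only [cutLast_eq_sum]
  rw [mul_expect_sum_mul_sum hm]
  have := sum_sum_meanCommonAncestors_le (lastNodes ℓ (m + 1)).toFinite.toFinset
    (lastNodes ℓ (m + 1)).toFinite.toFinset
  rw [card_lastNodes hℓ] at this
  linarith [sq (ℓ : ℝ)]

end Moments
end NodeIsolation

/-! ### Estimates for powers of `n` and `log n` -/

namespace NodeIsolation

open scoped BigOperators

/-- The shifted logarithm `log (n + 3)`, which is at least `1` for all `n`. -/
noncomputable def lg (n : ℕ) : ℝ := Real.log (n + 3)

theorem one_le_lg (n : ℕ) : 1 ≤ lg n := by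
  rw [lg, Real.le_log_iff_exp_le (by positivity)]
  linarith [Real.exp_one_lt_d9, Nat.cast_nonneg (α := ℝ) n]

theorem lg_pos (n : ℕ) : 0 < lg n := one_pos.trans_le (one_le_lg n)

theorem lg_mono {k n : ℕ} (h : k ≤ n) : lg k ≤ lg n :=
  Real.log_le_log (by positivity) (by gcongr)

theorem one_le_lg_pow (n q : ℕ) : 1 ≤ lg n ^ q := one_le_pow₀ (one_le_lg n)

theorem lg_pow_le (q : ℕ) {n : ℕ} (hn : 1 ≤ n) : lg n ^ q ≤ 4 * (q.factorial : ℝ) * n := by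
  have hn' : (1 : ℝ) ≤ n := by exact_mod_cast hn
  have h := Real.pow_div_factorial_le_exp (lg n) (lg_pos n).le q
  have hq : (0 : ℝ) < q.factorial := by exact_mod_cast q.factorial_pos
  rw [div_le_iff₀ hq, lg, Real.exp_log (by positivity)] at h
  rw [lg]
  nlinarith

theorem exists_lg_pow_le_sqrt (q : ℕ) :
    ∃ C : ℝ, 0 ≤ C ∧ ∀ n : ℕ, 1 ≤ n → lg n ^ q ≤ C * √(n : ℝ) := by
  refine ⟨√(4 * ((2 * q).factorial : ℝ)), by positivity, fun n hn => ?_⟩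
  rw [← Real.sqrt_mul (by positivity)]
  refine Real.le_sqrt_of_sq_le ?_
  rw [← pow_mul, mul_comm q]
  exact lg_pow_le _ hn

theorem lg_le_two_mul_lg {k n : ℕ} (h : n ≤ k ^ 2 + 6 * k + 6) : lg n ≤ 2 * lg k := by
  have h' : (n : ℝ) ≤ k ^ 2 + 6 * k + 6 := by exact_mod_cast h
  rw [lg, lg, ← Nat.cast_two, ← Real.log_pow]
  refine Real.log_le_log (by positivity) ?_
  nlinarith

theorem div_lg_pow_le_of_lg_le {k n : ℕ} (q : ℕ) (h : lg n ≤ 2 * lg k) :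
    1 / lg k ^ q ≤ 2 ^ q / lg n ^ q := by
  rw [div_le_div_iff₀ (pow_pos (lg_pos k) q) (pow_pos (lg_pos n) q), one_mul, ← mul_pow]
  exact pow_le_pow_left₀ (lg_pos n).le h q

/-- A bound that isolates the contribution of small `k`, for which `log k` and `log n` are not
comparable. -/
theorem div_lg_pow_le (q k n : ℕ) :
    (k : ℝ) / lg k ^ q ≤ √(n : ℝ) + 2 ^ q * k / lg n ^ q := by
  by_cases h : k ^ 2 ≤ n
  · have h1 : (k : ℝ) / lg k ^ q ≤ k := div_le_self (by positivity) (one_le_lg_pow k q)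
    have h2 : (k : ℝ) ≤ √(n : ℝ) := Real.le_sqrt_of_sq_le (by exact_mod_cast h)
    have h3 : 0 ≤ 2 ^ q * k / lg n ^ q := by have := lg_pos n; positivity
    linarith
  · have h1 := div_lg_pow_le_of_lg_le q (lg_le_two_mul_lg (k := k) (n := n) (by nlinarith))
    have h2 := mul_le_mul_of_nonneg_left h1 (Nat.cast_nonneg (α := ℝ) k)
    have h3 : (k : ℝ) / lg k ^ q = k * (1 / lg k ^ q) := by ring
    have h4 : 2 ^ q * (k : ℝ) / lg n ^ q = k * (2 ^ q / lg n ^ q) := by ring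
    rw [h3, h4]
    linarith [Real.sqrt_nonneg (n : ℝ)]

theorem exists_div_lg_pow_le (q : ℕ) :
    ∃ C : ℝ, 0 ≤ C ∧ ∀ k n : ℕ, 1 ≤ n → k ≤ n → (k : ℝ) / lg k ^ q ≤ C * (n / lg n ^ q) := by
  obtain ⟨C, hC, h⟩ := exists_lg_pow_le_sqrt q
  refine ⟨C + 2 ^ q, by positivity, fun k n hn hk => (div_lg_pow_le q k n).trans ?_⟩
  have hl := pow_pos (lg_pos n) q
  have hk' : (k : ℝ) ≤ n := by exact_mod_cast hk
  rw [add_mul]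
  refine add_le_add ?_ ?_
  · rw [mul_div_assoc', le_div_iff₀ hl]
    calc √(n : ℝ) * lg n ^ q ≤ √(n : ℝ) * (C * √(n : ℝ)) := by gcongr; exact h n hn
      _ = C * (√(n : ℝ) * √(n : ℝ)) := by ring
      _ = C * n := by rw [Real.mul_self_sqrt (by positivity)]
  · rw [mul_div_assoc]
    gcongr

/-- The function `n ^ s / log ^ q n` that measures the growth of the moments. -/
noncomputable def gauge (s q n : ℕ) : ℝ := (n : ℝ) ^ s / lg n ^ q

theorem gauge_nonneg (s q n : ℕ) : 0 ≤ gauge s q n := by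
  have := lg_pos n
  unfold gauge
  positivity

theorem gauge_pos (s q : ℕ) {n : ℕ} (hn : 1 ≤ n) : 0 < gauge s q n := by
  have := lg_pos n
  have : (0 : ℝ) < n := by exact_mod_cast hn
  unfold gauge
  positivity

theorem gauge_succ_eq (s q n : ℕ) : gauge (s + 1) q n = n * gauge s q n := by
  unfold gauge
  ring

theorem gauge_eq_lg_mul (s q n : ℕ) : gauge s q n = lg n * gauge s (q + 1) n := by
  have := (lg_pos n).ne'
  unfold gauge
  field_simp
  ring

theorem gauge_add (s t p q n : ℕ) : gauge (s + t) (p + q) n = gauge s p n * gauge t q n := by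
  unfold gauge
  rw [pow_add, pow_add, mul_div_mul_comm]

theorem gauge_pow (s n : ℕ) : gauge s s n = gauge 1 1 n ^ s := by
  unfold gauge
  rw [pow_one, pow_one, div_pow]

theorem gauge_le_gauge {s p q n : ℕ} (h : q ≤ p) : gauge s p n ≤ gauge s q n := by
  have := lg_pos n
  unfold gauge
  gcongr
  exact one_le_lg n

theorem exists_gauge_mono (s q : ℕ) :
    ∃ C : ℝ, 0 ≤ C ∧ ∀ k n : ℕ, 1 ≤ n → k ≤ n → gauge (s + 1) q k ≤ C * gauge (s + 1) q n := by
  obtain ⟨C, hC, h⟩ := exists_div_lg_pow_le q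
  refine ⟨C, hC, fun k n hn hk => ?_⟩
  have hl := pow_pos (lg_pos n) q
  have hk' : (k : ℝ) ≤ n := by exact_mod_cast hk
  have h1 := h k n hn hk
  calc gauge (s + 1) q k = (k : ℝ) ^ s * (k / lg k ^ q) := by unfold gauge; ring
    _ ≤ (n : ℝ) ^ s * (C * (n / lg n ^ q)) := by
        have := pow_pos (lg_pos k) q
        gcongr
    _ = C * gauge (s + 1) q n := by unfold gauge; ring

theorem exists_gauge_le_gauge (s q p : ℕ) :
    ∃ C : ℝ, 0 ≤ C ∧ ∀ n : ℕ, 1 ≤ n → gauge s q n ≤ C * gauge (s + 1) p n := by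
  refine ⟨4 * (p.factorial : ℝ), by positivity, fun n hn => ?_⟩
  refine (gauge_le_gauge (Nat.zero_le q)).trans ?_
  have hl := pow_pos (lg_pos n) p
  have := lg_pow_le p hn
  unfold gauge
  rw [pow_zero, div_one, mul_div_assoc', le_div_iff₀ hl, pow_succ]
  calc (n : ℝ) ^ s * lg n ^ p ≤ (n : ℝ) ^ s * (4 * p.factorial * n) := by gcongr
    _ = _ := by ring

theorem one_le_gauge_one {n : ℕ} (hn : 1 ≤ n) : 1 ≤ 3 * gauge 1 1 n := by
  have hn' : (1 : ℝ) ≤ n := by exact_mod_cast hn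
  unfold gauge
  rw [mul_div_assoc', le_div_iff₀ (by simpa using lg_pos n), pow_one, pow_one, lg]
  have := Real.log_le_sub_one_of_pos (x := (n : ℝ) + 3) (by positivity)
  linarith

/-- Bernoulli's inequality and its second order counterpart. -/
theorem abs_one_sub_pow_sub_le (s : ℕ) {t : ℝ} (h0 : 0 ≤ t) (h1 : t ≤ 1) :
    |1 - (1 - t) ^ s - s * t| ≤ s ^ 2 * t ^ 2 := by
  have hu : 0 ≤ 1 - t := by linarith
  have key : 1 - s * t ≤ (1 - t) ^ s ∧ (1 - t) ^ s ≤ 1 - s * t + s ^ 2 * t ^ 2 := by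
    induction s with
    | zero => simp
    | succ s ih =>
      have hs : (0 : ℝ) ≤ s := Nat.cast_nonneg s
      rw [pow_succ]
      push_cast
      constructor
      · nlinarith [mul_le_mul_of_nonneg_right ih.1 hu, mul_nonneg hs (sq_nonneg t)]
      · nlinarith [mul_le_mul_of_nonneg_right ih.2 hu, mul_nonneg hs (sq_nonneg t),
          mul_nonneg (sq_nonneg (s : ℝ)) (mul_nonneg h0 (sq_nonneg t)), sq_nonneg t]
  rw [abs_le]
  constructor <;> linarith [key.1, key.2]

theorem abs_pow_sub_pow_sub_le (s : ℕ) {n x : ℝ} (hn : 0 < n) (hx : 0 ≤ x) (hxn : x ≤ n) :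
    |n ^ (s + 1) - x ^ (s + 1) - (s + 1) * (n - x) * n ^ s|
      ≤ (s + 1) ^ 2 * ((n - x) ^ 2 / n) * n ^ s := by
  have h := abs_one_sub_pow_sub_le (s + 1) (t := (n - x) / n) (div_nonneg (by linarith) hn.le)
    ((div_le_one hn).2 (by linarith))
  have hxe : 1 - (n - x) / n = x / n := by field_simp; ring
  rw [hxe] at h
  have hp : 0 < n ^ (s + 1) := by positivity
  have h2 := mul_le_mul_of_nonneg_left h hp.le
  rw [← abs_of_pos hp, ← abs_mul, abs_of_pos hp] at h2
  have e1 : n ^ (s + 1) * (1 - (x / n) ^ (s + 1) - ((s + 1 : ℕ) : ℝ) * ((n - x) / n))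
      = n ^ (s + 1) - x ^ (s + 1) - (s + 1) * (n - x) * n ^ s := by
    push_cast
    rw [div_pow]
    field_simp
    ring
  have e2 : n ^ (s + 1) * (((s + 1 : ℕ) : ℝ) ^ 2 * ((n - x) / n) ^ 2)
      = (s + 1) ^ 2 * ((n - x) ^ 2 / n) * n ^ s := by
    push_cast
    field_simp
    ring
  rwa [e1, e2] at h2

theorem lg_sub_lg_le {x n : ℕ} (hn : 1 ≤ n) (hx : x ≤ n) (h : n ≤ 2 * x) :
    lg n - lg x ≤ 2 * ((n : ℝ) - x) / n := by
  have hn' : (0 : ℝ) < n := by exact_mod_cast hn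
  have hx' : (x : ℝ) ≤ n := by exact_mod_cast hx
  have h' : (n : ℝ) ≤ 2 * x := by exact_mod_cast h
  rw [lg, lg, ← Real.log_div (by positivity) (by positivity)]
  refine (Real.log_le_sub_one_of_pos (by positivity)).trans ?_
  rw [div_sub_one (by positivity), div_le_div_iff₀ (by positivity) hn']
  nlinarith

theorem one_div_lg_pow_sub_le {x n : ℕ} (q : ℕ) :
    1 / lg x ^ q - 1 / lg n ^ q ≤ q * (lg n - lg x) / lg n * (1 / lg x ^ q) := by
  have hx := lg_pos x
  have hn := lg_pos n
  have h := one_add_mul_le_pow (a := lg x / lg n - 1)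
    (by linarith [div_pos hx hn]) q
  rw [add_sub_cancel, div_pow] at h
  have h2 := mul_le_mul_of_nonneg_left h (by positivity : 0 ≤ 1 / lg x ^ q)
  have e1 : 1 / lg x ^ q * (lg x ^ q / lg n ^ q) = 1 / lg n ^ q := by field_simp
  have e2 : q * (lg n - lg x) / lg n * (1 / lg x ^ q)
      = - (1 / lg x ^ q * (q * (lg x / lg n - 1))) := by
    field_simp
    ring
  rw [e1, mul_add] at h2
  rw [e2]
  linarith

theorem exists_lg_correction_le (s q : ℕ) :
    ∃ C : ℝ, 0 ≤ C ∧ ∀ x n : ℕ, 1 ≤ n → x ≤ n →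
      (x : ℝ) ^ (s + 1) * (1 / lg x ^ q - 1 / lg n ^ q)
        ≤ C * gauge s q n * (((n : ℝ) - x) / lg n + ((n : ℝ) - x) ^ 2 / n) := by
  obtain ⟨C, hC, hmono⟩ := exists_gauge_mono s q
  refine ⟨2 ^ (q + 1) * q + 4 * C, by positivity, fun x n hn hx => ?_⟩
  have hln := lg_pos n
  have hlx := lg_pos x
  have hg := gauge_nonneg s q n
  have hn' : (0 : ℝ) < n := by exact_mod_cast hn
  have hx' : (x : ℝ) ≤ n := by exact_mod_cast hx
  have hk : 0 ≤ (n : ℝ) - x := by linarith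
  by_cases h : n ≤ 2 * x
  · have h1 := div_lg_pow_le_of_lg_le q (lg_le_two_mul_lg (k := x) (n := n) (by nlinarith))
    have hll : 0 ≤ lg n - lg x := by linarith [lg_mono hx]
    calc (x : ℝ) ^ (s + 1) * (1 / lg x ^ q - 1 / lg n ^ q)
        ≤ (n : ℝ) ^ (s + 1) * (q * (2 * ((n : ℝ) - x) / n) / lg n * (2 ^ q / lg n ^ q)) := by
          refine mul_le_mul (by gcongr) ((one_div_lg_pow_sub_le q).trans ?_) ?_ (by positivity)
          · have := lg_sub_lg_le hn hx h
            gcongr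
          · rw [sub_nonneg]
            gcongr
            exact lg_mono hx
      _ = 2 ^ (q + 1) * q * gauge s q n * (((n : ℝ) - x) / lg n) := by
          unfold gauge
          field_simp
          ring
      _ ≤ _ := by
          gcongr
          · linarith
          · have : 0 ≤ ((n : ℝ) - x) ^ 2 / n := by positivity
            linarith
  · have h2 : (n : ℝ) ≤ 4 * (((n : ℝ) - x) ^ 2 / n) := by
      have : (2 : ℝ) * x ≤ n := by exact_mod_cast (not_le.1 h).le
      rw [mul_div_assoc', le_div_iff₀ hn']
      nlinarith
    calc (x : ℝ) ^ (s + 1) * (1 / lg x ^ q - 1 / lg n ^ q)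
        ≤ gauge (s + 1) q x := by
          unfold gauge
          rw [mul_sub, mul_one_div]
          have : 0 ≤ (x : ℝ) ^ (s + 1) * (1 / lg n ^ q) := by positivity
          linarith
      _ ≤ C * (n * gauge s q n) := by
          rw [← gauge_succ_eq]
          exact hmono x n hn hx
      _ ≤ C * (4 * (((n : ℝ) - x) ^ 2 / n) * gauge s q n) := by gcongr
      _ = 4 * C * gauge s q n * (((n : ℝ) - x) ^ 2 / n) := by ring
      _ ≤ _ := by
          have : 0 ≤ ((n : ℝ) - x) / lg n := by positivity
          gcongr
          · have : (0 : ℝ) ≤ 2 ^ (q + 1) * q := by positivity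
            linarith
          · linarith

/-- First order expansion of the gauge function. -/
theorem exists_abs_gauge_sub_sub_le (s q : ℕ) :
    ∃ C : ℝ, 0 ≤ C ∧ ∀ k n : ℕ, 1 ≤ n → k ≤ n →
      |gauge (s + 1) q n - gauge (s + 1) q (n - k) - (s + 1) * k * gauge s q n|
        ≤ C * gauge s q n * (k / lg n + (k : ℝ) ^ 2 / n) := by
  obtain ⟨C, hC, h⟩ := exists_lg_correction_le s q
  refine ⟨(s + 1) ^ 2 + C, by positivity, fun k n hn hk => ?_⟩
  have hln := lg_pos n
  have hg := gauge_nonneg s q n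
  have hn' : (0 : ℝ) < n := by exact_mod_cast hn
  have hk' : (k : ℝ) ≤ n := by exact_mod_cast hk
  have hx : ((n - k : ℕ) : ℝ) = n - k := Nat.cast_sub hk
  have hk0 : (0 : ℝ) ≤ k := Nat.cast_nonneg k
  have h1 := abs_pow_sub_pow_sub_le s hn' (x := n - k) (by linarith) (by linarith)
  have h2 := h (n - k) n hn (Nat.sub_le n k)
  have h3 : 0 ≤ ((n - k : ℕ) : ℝ) ^ (s + 1) * (1 / lg (n - k) ^ q - 1 / lg n ^ q) := by
    refine mul_nonneg (by positivity) ?_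
    rw [sub_nonneg]
    have := lg_pos (n - k)
    gcongr
    exact lg_mono (Nat.sub_le n k)
  rw [hx] at h2 h3
  rw [sub_sub_cancel] at h1 h2
  have e : gauge (s + 1) q n - gauge (s + 1) q (n - k) - (s + 1) * k * gauge s q n
      = ((n : ℝ) ^ (s + 1) - (n - k) ^ (s + 1) - (s + 1) * k * n ^ s) / lg n ^ q
        - (n - k) ^ (s + 1) * (1 / lg (n - k) ^ q - 1 / lg n ^ q) := by
    unfold gauge
    rw [hx]
    ring
  have h4 : |((n : ℝ) ^ (s + 1) - (n - k) ^ (s + 1) - (s + 1) * k * n ^ s) / lg n ^ q|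
      ≤ (s + 1) ^ 2 * gauge s q n * ((k : ℝ) ^ 2 / n) := by
    rw [abs_div, abs_of_pos (pow_pos hln q), div_le_iff₀ (pow_pos hln q)]
    refine h1.trans (le_of_eq ?_)
    unfold gauge
    field_simp
  rw [e]
  refine (abs_sub _ _).trans ?_
  rw [abs_of_nonneg h3]
  have : 0 ≤ (s + 1 : ℝ) ^ 2 * gauge s q n * (k / lg n) := by positivity
  calc _ ≤ (s + 1) ^ 2 * gauge s q n * ((k : ℝ) ^ 2 / n)
        + C * gauge s q n * (k / lg n + (k : ℝ) ^ 2 / n) := add_le_add h4 h2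
    _ ≤ _ := by linarith

theorem exists_abs_gauge_sub_le (s q : ℕ) :
    ∃ C : ℝ, 0 ≤ C ∧ ∀ k n : ℕ, 1 ≤ n → k ≤ n →
      |gauge (s + 1) q n - gauge (s + 1) q (n - k)| ≤ C * (k * gauge s q n) := by
  obtain ⟨C, hC, h⟩ := exists_abs_gauge_sub_sub_le s q
  refine ⟨s + 1 + 2 * C, by positivity, fun k n hn hk => ?_⟩
  have hg := gauge_nonneg s q n
  have hn' : (0 : ℝ) < n := by exact_mod_cast hn
  have hk' : (k : ℝ) ≤ n := by exact_mod_cast hk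
  have hk0 : (0 : ℝ) ≤ k := Nat.cast_nonneg k
  have h1 : (k : ℝ) / lg n ≤ k := div_le_self hk0 (one_le_lg n)
  have h2 : (k : ℝ) ^ 2 / n ≤ k := by
    rw [div_le_iff₀ hn']
    nlinarith
  have h3 := h k n hn hk
  have h4 : C * gauge s q n * (k / lg n + (k : ℝ) ^ 2 / n) ≤ C * gauge s q n * (k + k) := by
    gcongr
  rw [abs_le] at h3 ⊢
  constructor
  · have : 0 ≤ (s + 1 : ℝ) * k * gauge s q n := by positivity
    linarith
  · linarith

end NodeIsolation

/-! ### Averages over the first cut -/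

namespace NodeIsolation

open scoped BigOperators

theorem nonempty_cutting {m : ℕ} (hm : m ≠ 0) : Nonempty (Cutting m) :=
  ⟨⟨Classical.arbitrary _, ⟨0, Nat.pos_of_ne_zero hm⟩⟩⟩

section Moments

variable {m : ℕ}

theorem log_le_lg (n : ℕ) : Real.log n ≤ lg n := by
  rcases Nat.eq_zero_or_pos n with rfl | hn
  · simpa using (lg_pos 0).le
  · have : (0 : ℝ) < n := by exact_mod_cast hn
    exact Real.log_le_log this (by linarith)

theorem lg_le_log_add_one_add (n : ℕ) : lg n ≤ Real.log (n + 1) + 2 := by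
  have h : (n : ℝ) + 3 ≤ 3 * (n + 1) := by linarith [Nat.cast_nonneg (α := ℝ) n]
  have h1 := Real.log_le_log (by positivity) h
  rw [Real.log_mul (by norm_num) (by positivity)] at h1
  have h2 := Real.log_le_sub_one_of_pos (x := 3) (by norm_num)
  rw [lg]
  linarith

theorem abs_expect_cutSize_sub_le (hm : m ≠ 0) :
    |𝔼 x : Cutting m, (cutSize x : ℝ) - lg (m + 1)| ≤ 3 := by
  have hm' : (0 : ℝ) < m := by exact_mod_cast Nat.pos_of_ne_zero hm
  have h := expect_cutSize hm
  set E := 𝔼 x : Cutting m, (cutSize x : ℝ)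
  have h1 := harmonic_le_one_add_log (m + 1)
  have h2 := log_add_one_le_harmonic (m + 1)
  have h3 := log_le_lg (m + 1)
  have h4 := lg_le_log_add_one_add (m + 1)
  have h5 := harmonic_le (m + 1)
  push_cast at h1 h2 h3 h4 h5
  set H : ℝ := (harmonic (m + 1) : ℝ)
  have hH : E = (H - 1) + (H - 1) / m := by
    field_simp
    linarith
  have h6 : (H - 1) / m ≤ 1 := (div_le_one hm').2 (by linarith)
  have h7 : 1 ≤ H := by
    have hle : harmonic 1 ≤ harmonic (m + 1) :=
      Finset.sum_le_sum_of_subset_of_nonneg (by simp) fun i _ _ => by positivity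
    have h01 : harmonic 1 = 1 := by norm_num [harmonic]
    rw [h01] at hle
    have hle' := (Rat.cast_le (K := ℝ)).2 hle
    rwa [Rat.cast_one] at hle'
  have h8 : 0 ≤ (H - 1) / m := div_nonneg (by linarith) hm'.le
  rw [abs_le]
  constructor <;> linarith

theorem expect_cutSize_sq_le_four_mul (hm : m ≠ 0) :
    𝔼 x : Cutting m, (cutSize x : ℝ) ^ 2 ≤ 4 * (m + 1) := by
  have hm' : (1 : ℝ) ≤ m := by exact_mod_cast Nat.pos_of_ne_zero hm
  have h := expect_cutSize_sq_le hm
  refine le_of_mul_le_mul_left (h.trans ?_) (by linarith : (0 : ℝ) < m)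
  nlinarith

theorem expect_cutLast_mul_cutSize_le {ℓ : ℕ} (hℓ : ℓ ≤ m + 1) (hm : m ≠ 0) :
    𝔼 x : Cutting m, (cutLast ℓ x : ℝ) * (cutSize x : ℝ) ≤ 4 * ℓ := by
  have hm' : (1 : ℝ) ≤ m := by exact_mod_cast Nat.pos_of_ne_zero hm
  have h := expect_cutSize_mul_cutLast_le hℓ hm
  refine le_of_mul_le_mul_left (h.trans ?_) (by linarith : (0 : ℝ) < m)
  nlinarith [Nat.cast_nonneg (α := ℝ) ℓ]

theorem mul_expect_cutLast_mul_pred_le {ℓ : ℕ} (hℓ : ℓ ≤ m + 1) (hm : m ≠ 0) :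
    ((m : ℝ) + 1) * 𝔼 x : Cutting m, (cutLast ℓ x : ℝ) * ((cutLast ℓ x : ℝ) - 1)
      ≤ 2 * ℓ ^ 2 := by
  have hm' : (1 : ℝ) ≤ m := by exact_mod_cast Nat.pos_of_ne_zero hm
  have h := expect_cutLast_mul_pred_le hℓ hm
  have h0 : 0 ≤ 𝔼 x : Cutting m, (cutLast ℓ x : ℝ) * ((cutLast ℓ x : ℝ) - 1) := by
    refine Finset.expect_nonneg fun x _ => ?_
    rcases Nat.eq_zero_or_pos (cutLast ℓ x) with h | h
    · simp [h]
    · have : (1 : ℝ) ≤ cutLast ℓ x := by exact_mod_cast h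
      exact mul_nonneg (by linarith) (by linarith)
  nlinarith

theorem abs_mul_expect_cutLast_sub_le {ℓ : ℕ} (hℓ0 : 1 ≤ ℓ) (hℓ : ℓ ≤ m + 1) (hm : m ≠ 0) :
    |((m : ℝ) + 1) * 𝔼 x : Cutting m, (cutLast ℓ x : ℝ) - ℓ * lg (m + 1)| ≤ 6 * ℓ ^ 2 := by
  have hm' : (1 : ℝ) ≤ m := by exact_mod_cast Nat.pos_of_ne_zero hm
  have hℓ' : (1 : ℝ) ≤ ℓ := by exact_mod_cast hℓ0
  have h := expect_cutLast ℓ hm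
  have h0 : 0 ≤ 𝔼 x : Cutting m, (cutLast ℓ x : ℝ) := Finset.expect_nonneg fun x _ => by positivity
  set E := 𝔼 x : Cutting m, (cutLast ℓ x : ℝ)
  set A := (lastNodes ℓ (m + 1)).toFinite.toFinset
  have hcard : (A.card : ℝ) = ℓ := by exact_mod_cast card_lastNodes hℓ
  have hmem : ∀ i ∈ A, m + 1 ≤ ℓ + i := by
    intro i hi
    have : m + 1 + 1 - ℓ ≤ (i : ℕ) + 1 := by
      simpa [A, lastNodes] using hi
    omega
  have hup : ∑ i ∈ A, (harmonic i : ℝ) ≤ ℓ * (1 + lg (m + 1)) := by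
    rw [← hcard, ← nsmul_eq_mul]
    refine Finset.sum_le_card_nsmul _ _ _ fun i _ => ?_
    refine (harmonic_le_one_add_log i).trans ?_
    have := (log_le_lg i).trans (lg_mono i.2.le)
    linarith
  have hlow : ℓ * (lg (m + 1) - 4 * ℓ) ≤ ∑ i ∈ A, (harmonic i : ℝ) := by
    rw [← hcard, ← nsmul_eq_mul, hcard]
    refine Finset.card_nsmul_le_sum _ _ _ fun i hi => ?_
    refine le_trans ?_ (log_add_one_le_harmonic i)
    have h1 : ((m + 1 : ℕ) : ℝ) + 3 ≤ 4 * ℓ * ((i + 1 : ℕ) : ℝ) := by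
      have h2 : (m : ℝ) + 1 ≤ ℓ + i := by exact_mod_cast hmem i hi
      have h3 : (0 : ℝ) ≤ (i : ℕ) := Nat.cast_nonneg _
      push_cast
      nlinarith
    have h2 := Real.log_le_log (by positivity) h1
    rw [Real.log_mul (by positivity) (by positivity)] at h2
    have h3 := Real.log_le_sub_one_of_pos (x := 4 * (ℓ : ℝ)) (by positivity)
    rw [lg]
    linarith
  have hE : (m : ℝ) * E ≤ ℓ * m := by
    rw [h, ← hcard, ← nsmul_eq_mul]
    refine Finset.sum_le_card_nsmul _ _ _ fun i _ => ?_
    exact (harmonic_le i).trans (by exact_mod_cast Nat.lt_succ_iff.1 i.2)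
  have hE' : E ≤ ℓ := by nlinarith
  have e : ((m : ℝ) + 1) * E = (∑ i ∈ A, (harmonic i : ℝ)) + E := by rw [← h]; ring
  rw [e, abs_le]
  constructor <;> nlinarith

theorem mul_expect_cutLast_le {ℓ : ℕ} (hℓ0 : 1 ≤ ℓ) (hℓ : ℓ ≤ m + 1) (hm : m ≠ 0) :
    ((m : ℝ) + 1) * 𝔼 x : Cutting m, (cutLast ℓ x : ℝ) ≤ 7 * ℓ ^ 2 * lg (m + 1) := by
  have h := (abs_le.1 (abs_mul_expect_cutLast_sub_le hℓ0 hℓ hm)).2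
  have h1 := one_le_lg (m + 1)
  have hℓ' : (1 : ℝ) ≤ ℓ := by exact_mod_cast hℓ0
  nlinarith [mul_le_mul_of_nonneg_right hℓ' (by positivity : 0 ≤ (ℓ : ℝ) * lg (m + 1))]

theorem expect_cutSize_le (hm : m ≠ 0) :
    𝔼 x : Cutting m, (cutSize x : ℝ) ≤ 4 * lg (m + 1) := by
  have h := (abs_le.1 (abs_expect_cutSize_sub_le hm)).2
  linarith [one_le_lg (m + 1)]

end Moments

/-- The mean decrease of the gauge function in the first cut. -/
theorem exists_abs_expect_gauge_sub_le (s q : ℕ) :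
    ∃ C : ℝ, 0 ≤ C ∧ ∀ m : ℕ, m ≠ 0 →
      |gauge (s + 1) q (m + 1) - 𝔼 x : Cutting m, gauge (s + 1) q (m + 1 - cutSize x)
        - (s + 1) * lg (m + 1) * gauge s q (m + 1)| ≤ C * gauge s q (m + 1) := by
  obtain ⟨C, hC, h⟩ := exists_abs_gauge_sub_sub_le s q
  refine ⟨C * 8 + (s + 1) * 3, by positivity, fun m hm => ?_⟩
  have := nonempty_cutting hm
  have hl := lg_pos (m + 1)
  have hg := gauge_nonneg s q (m + 1)
  have h1 : |𝔼 x : Cutting m, (gauge (s + 1) q (m + 1) - gauge (s + 1) q (m + 1 - cutSize x)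
        - (s + 1) * cutSize x * gauge s q (m + 1))| ≤ C * gauge s q (m + 1) * 8 := by
    refine (Finset.abs_expect_le _ _).trans ?_
    refine (Finset.expect_le_expect fun x _ =>
      h (cutSize x) (m + 1) (by omega) ((cutSize_le x).trans (by omega))).trans ?_
    rw [← Finset.mul_expect, Finset.expect_add_distrib, ← Finset.expect_div, ← Finset.expect_div]
    gcongr
    have h2 := expect_cutSize_le hm
    have h3 := expect_cutSize_sq_le_four_mul hm
    have h4 : (𝔼 x : Cutting m, (cutSize x : ℝ)) / lg (m + 1) ≤ 4 := (div_le_iff₀ hl).2 h2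
    have h5 : (𝔼 x : Cutting m, (cutSize x : ℝ) ^ 2) / ((m + 1 : ℕ) : ℝ) ≤ 4 := by
      rw [div_le_iff₀ (by positivity)]
      exact_mod_cast h3
    linarith
  have e : 𝔼 x : Cutting m, (gauge (s + 1) q (m + 1) - gauge (s + 1) q (m + 1 - cutSize x)
        - (s + 1) * cutSize x * gauge s q (m + 1))
      = (gauge (s + 1) q (m + 1) - 𝔼 x : Cutting m, gauge (s + 1) q (m + 1 - cutSize x)
        - (s + 1) * lg (m + 1) * gauge s q (m + 1))
        - (s + 1) * gauge s q (m + 1) * (𝔼 x : Cutting m, (cutSize x : ℝ) - lg (m + 1)) := by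
    rw [Finset.expect_sub_distrib, Finset.expect_sub_distrib, Fintype.expect_const,
      ← Finset.expect_mul, ← Finset.mul_expect]
    ring
  have h6 : |(s + 1) * gauge s q (m + 1) * (𝔼 x : Cutting m, (cutSize x : ℝ) - lg (m + 1))|
      ≤ (s + 1) * gauge s q (m + 1) * 3 := by
    rw [abs_mul, abs_of_nonneg (by positivity)]
    gcongr
    exact abs_expect_cutSize_sub_le hm
  rw [e] at h1
  rw [abs_le] at h1 h6 ⊢
  constructor <;> linarith

/-- The mean contribution of a subtree that contains some of the last nodes. -/
theorem exists_expect_cutLast_mul_gauge_le (s q ℓ : ℕ) (hℓ0 : 1 ≤ ℓ) :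
    ∃ C : ℝ, 0 ≤ C ∧ ∀ m : ℕ, m ≠ 0 → ℓ ≤ m + 1 →
      𝔼 x : Cutting m, (cutLast ℓ x : ℝ) * gauge (s + 1) q (cutSize x)
        ≤ C * gauge s q (m + 1) := by
  obtain ⟨C, hC, h⟩ := exists_lg_pow_le_sqrt (q + 1)
  refine ⟨7 * ℓ ^ 2 * C + 2 ^ q * (4 * ℓ), by positivity, fun m hm hℓ => ?_⟩
  have hl := lg_pos (m + 1)
  have hlq := pow_pos hl q
  set n : ℝ := ((m + 1 : ℕ) : ℝ) with hn
  have hnpos : 0 < n := by positivity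
  have hpt : ∀ x : Cutting m, (cutLast ℓ x : ℝ) * gauge (s + 1) q (cutSize x)
      ≤ n ^ s * (√n * cutLast ℓ x + 2 ^ q / lg (m + 1) ^ q * (cutLast ℓ x * cutSize x)) := by
    intro x
    have h1 := div_lg_pow_le q (cutSize x) (m + 1)
    have h2 : (cutSize x : ℝ) ≤ n := Nat.cast_le.2 ((cutSize_le x).trans (Nat.le_succ m))
    have h3 := pow_pos (lg_pos (cutSize x)) q
    calc (cutLast ℓ x : ℝ) * gauge (s + 1) q (cutSize x)
        = cutLast ℓ x * ((cutSize x : ℝ) ^ s * (cutSize x / lg (cutSize x) ^ q)) := by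
          unfold gauge; ring
      _ ≤ cutLast ℓ x * (n ^ s * (√n + 2 ^ q * cutSize x / lg (m + 1) ^ q)) := by
          gcongr
      _ = _ := by ring
  refine (Finset.expect_le_expect fun x _ => hpt x).trans ?_
  rw [← Finset.mul_expect, Finset.expect_add_distrib, ← Finset.mul_expect, ← Finset.mul_expect]
  have h4 := expect_cutLast_mul_cutSize_le hℓ hm
  have h5 := mul_expect_cutLast_le hℓ0 hℓ hm
  have h6 := h (m + 1) (by omega)
  set E := 𝔼 x : Cutting m, (cutLast ℓ x : ℝ)
  have hE : 0 ≤ E := Finset.expect_nonneg fun x _ => by positivity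
  have h7 : √n * E ≤ 7 * ℓ ^ 2 * C / lg (m + 1) ^ q := by
    rw [le_div_iff₀ hlq]
    have hs : 0 < √n := Real.sqrt_pos.2 hnpos
    refine le_of_mul_le_mul_left ?_ hs
    calc √n * (√n * E * lg (m + 1) ^ q) = (√n * √n) * E * lg (m + 1) ^ q := by ring
      _ = n * E * lg (m + 1) ^ q := by rw [Real.mul_self_sqrt hnpos.le]
      _ ≤ 7 * ℓ ^ 2 * lg (m + 1) * lg (m + 1) ^ q := by
          refine mul_le_mul_of_nonneg_right ?_ hlq.le
          rw [hn, Nat.cast_add_one]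
          exact h5
      _ = 7 * ℓ ^ 2 * lg (m + 1) ^ (q + 1) := by ring
      _ ≤ 7 * ℓ ^ 2 * (C * √n) := by gcongr
      _ = _ := by ring
  have h8 : 2 ^ q / lg (m + 1) ^ q * 𝔼 x : Cutting m, (cutLast ℓ x : ℝ) * (cutSize x : ℝ)
      ≤ 2 ^ q / lg (m + 1) ^ q * (4 * ℓ) := by gcongr
  calc _ ≤ n ^ s * (7 * ℓ ^ 2 * C / lg (m + 1) ^ q + 2 ^ q / lg (m + 1) ^ q * (4 * ℓ)) := by
        gcongr
    _ = _ := by unfold gauge; rw [← hn]; ring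

/-- A sequence that satisfies the recursive inequality coming from the first cut is bounded by a
multiple of the gauge function whose mean decrease compensates the toll. The term with the factor
`A`, which accounts for selected nodes in the subtree that is cut off, is harmless: for the gauge
function it is smaller than the mean decrease by a factor `lg n`. -/
theorem exists_le_gauge_of_le_expect (s q ℓ : ℕ) (hℓ0 : 1 ≤ ℓ) (a : ℕ → ℝ)
    {A B : ℝ} (hA : 0 ≤ A) (hB : 0 ≤ B) (n₁ : ℕ)
    (h : ∀ m : ℕ, m ≠ 0 → n₁ ≤ m + 1 →
      a (m + 1) ≤ 𝔼 x : Cutting m, a (m + 1 - cutSize x)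
        + A * 𝔼 x : Cutting m, (cutLast ℓ x : ℝ) * a (cutSize x) + B * gauge s q (m + 1)) :
    ∃ C : ℝ, 0 ≤ C ∧ ∀ n : ℕ, 1 ≤ n → a n ≤ C * gauge (s + 1) (q + 1) n := by
  obtain ⟨C₁, hC₁, h₁⟩ := exists_abs_expect_gauge_sub_le s (q + 1)
  obtain ⟨C₂, hC₂, h₂⟩ := exists_expect_cutLast_mul_gauge_le s (q + 1) ℓ hℓ0
  have hlim : Tendsto lg atTop atTop := by
    refine Real.tendsto_log_atTop.comp ?_
    exact tendsto_atTop_add_const_right _ _ tendsto_natCast_atTop_atTop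
  obtain ⟨n₂, hn₂⟩ := (hlim.eventually_ge_atTop (2 * (C₁ + A * C₂))).exists_forall_of_atTop
  -- the sum makes the bound true for `n < n₀`
  set n₀ := n₁ + n₂ + ℓ + 2
  set D : ℝ := 2 * B + ∑ n ∈ Finset.range n₀, |a n| / gauge (s + 1) (q + 1) n
  have hD : 0 ≤ D := add_nonneg (by linarith)
    (Finset.sum_nonneg fun n _ => div_nonneg (abs_nonneg _) (gauge_nonneg _ _ _))
  refine ⟨D, hD, fun n => ?_⟩
  induction n using Nat.strong_induction_on with
  | _ n ih =>
    intro hn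
    by_cases hlt : n < n₀
    · rw [← div_le_iff₀ (gauge_pos _ _ hn)]
      have h3 : |a n| / gauge (s + 1) (q + 1) n
          ≤ ∑ n ∈ Finset.range n₀, |a n| / gauge (s + 1) (q + 1) n :=
        Finset.single_le_sum (f := fun n => |a n| / gauge (s + 1) (q + 1) n)
          (fun n _ => div_nonneg (abs_nonneg _) (gauge_nonneg _ _ _)) (Finset.mem_range.2 hlt)
      have h4 : a n / gauge (s + 1) (q + 1) n ≤ |a n| / gauge (s + 1) (q + 1) n :=
        div_le_div_of_nonneg_right (le_abs_self _) (gauge_nonneg _ _ _)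
      linarith
    · obtain ⟨m, rfl⟩ : ∃ m, n = m + 1 := ⟨n - 1, by omega⟩
      have hm : m ≠ 0 := by omega
      have e1 : 𝔼 x : Cutting m, a (m + 1 - cutSize x)
          ≤ D * 𝔼 x : Cutting m, gauge (s + 1) (q + 1) (m + 1 - cutSize x) := by
        rw [Finset.mul_expect]
        refine Finset.expect_le_expect fun x _ => ih _ ?_ ?_
        · have := cutSize_pos x
          omega
        · have := cutSize_le x
          omega
      have e2 : 𝔼 x : Cutting m, (cutLast ℓ x : ℝ) * a (cutSize x)
          ≤ D * 𝔼 x : Cutting m, (cutLast ℓ x : ℝ) * gauge (s + 1) (q + 1) (cutSize x) := by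
        rw [Finset.mul_expect]
        refine Finset.expect_le_expect fun x _ => ?_
        have := ih (cutSize x) (Nat.lt_succ_of_le (cutSize_le x)) (cutSize_pos x)
        calc (cutLast ℓ x : ℝ) * a (cutSize x)
            ≤ cutLast ℓ x * (D * gauge (s + 1) (q + 1) (cutSize x)) := by gcongr
          _ = _ := by ring
      have e3 := (abs_le.1 (h₁ m hm)).1
      have e4 := h₂ m hm (by omega)
      have e5 := h m hm (by omega)
      -- for `n ≥ n₀` at most half of the mean decrease is needed for the error terms, and the
      -- other half exceeds the toll, since `D ≥ 2 * B`
      have e6 : gauge s q (m + 1) = lg (m + 1) * gauge s (q + 1) (m + 1) := gauge_eq_lg_mul _ _ _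
      have e7 := hn₂ (m + 1) (by omega)
      have hg := gauge_nonneg s (q + 1) (m + 1)
      have hl := lg_pos (m + 1)
      set g := gauge s (q + 1) (m + 1)
      have e8 : D * ((C₁ + A * C₂) * g) ≤ D * (lg (m + 1) / 2 * g) := by
        gcongr
        linarith
      have e9 : D * (𝔼 x : Cutting m, gauge (s + 1) (q + 1) (m + 1 - cutSize x))
          ≤ D * (gauge (s + 1) (q + 1) (m + 1) - (s + 1) * lg (m + 1) * g + C₁ * g) := by
        gcongr
        linarith
      have e10 : A * (D * 𝔼 x : Cutting m, (cutLast ℓ x : ℝ) * gauge (s + 1) (q + 1) (cutSize x))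
          ≤ A * (D * (C₂ * g)) := by gcongr
      have e11 : A * 𝔼 x : Cutting m, (cutLast ℓ x : ℝ) * a (cutSize x)
          ≤ A * (D * 𝔼 x : Cutting m, (cutLast ℓ x : ℝ) * gauge (s + 1) (q + 1) (cutSize x)) := by
        gcongr
      have e12 : 2 * B * (lg (m + 1) * g) ≤ D * (lg (m + 1) * g) := by
        gcongr
        exact le_add_of_nonneg_right
          (Finset.sum_nonneg fun n _ => div_nonneg (abs_nonneg _) (gauge_nonneg _ _ _))
      have e13 : 0 ≤ D * (s * (lg (m + 1) * g)) := by positivity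
      rw [e6] at e5
      linarith

end NodeIsolation

/-! ### The asymptotics of the moments -/

namespace NodeIsolation

open scoped BigOperators

section ExpLast

variable (n ℓ : ℕ)

theorem expLast_add (F G : ℕ → ℝ) :
    expLast n ℓ (fun k => F k + G k) = expLast n ℓ F + expLast n ℓ G :=
  integral_add (integrable_lawL n ℓ F) (integrable_lawL n ℓ G)

theorem expLast_const_mul (c : ℝ) (F : ℕ → ℝ) :
    expLast n ℓ (fun k => c * F k) = c * expLast n ℓ F :=
  integral_const_mul _ _

theorem expLast_mul_const (c : ℝ) (F : ℕ → ℝ) :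
    expLast n ℓ (fun k => F k * c) = expLast n ℓ F * c :=
  integral_mul_const _ _

theorem expLast_const (c : ℝ) : expLast n ℓ (fun _ => c) = c := by
  simp [expLast]

theorem expLast_mono {F G : ℕ → ℝ} (h : ∀ k, F k ≤ G k) : expLast n ℓ F ≤ expLast n ℓ G :=
  integral_mono (integrable_lawL n ℓ F) (integrable_lawL n ℓ G) h

theorem expLast_nonneg {F : ℕ → ℝ} (h : ∀ k, 0 ≤ F k) : 0 ≤ expLast n ℓ F :=
  integral_nonneg h

theorem expLast_zero (F : ℕ → ℝ) : expLast n 0 F = F 0 := by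
  have h : ∀ f : ParentMap (Fin n), expCuts (lastNodes 0 n) (parentGraph f) F = F 0 := by
    intro f
    refine expCuts_of_isEmpty _ _ ?_ _
    ext e
    refine ⟨?_, fun h => h.elim⟩
    rintro ⟨-, x, hx, -⟩
    have : n + 1 - 0 ≤ (x : ℕ) + 1 := hx
    exact absurd x.2 (by omega)
  rw [expLast_eq_treeExp, treeExp, Finset.expect_congr rfl fun f _ => h f, Fintype.expect_const]

end ExpLast

/-- The `s`-th moment of the number of cuts needed to isolate the last `ℓ` nodes. -/
noncomputable def moment (n ℓ s : ℕ) : ℝ := expLast n ℓ fun k => (k : ℝ) ^ s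

theorem moment_nonneg (n ℓ s : ℕ) : 0 ≤ moment n ℓ s :=
  expLast_nonneg _ _ fun _ => by positivity

theorem moment_zero_right (n ℓ : ℕ) : moment n ℓ 0 = 1 := by
  simp [moment, expLast_const]

theorem moment_zero_succ (n s : ℕ) : moment n 0 (s + 1) = 0 := by
  simp [moment, expLast_zero]

/-- The `s`-th moment of one plus the sum of two independent numbers of cuts, as they arise from
the first cut when the part that is cut off has size `k` and contains `r` selected nodes. -/
noncomputable def pairMoment (k r n ℓ s : ℕ) : ℝ :=
  expLast k r fun i => expLast n ℓ fun j => ((i : ℝ) + j + 1) ^ s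

theorem moment_succ {m ℓ : ℕ} (hm : m ≠ 0) (hℓ : 1 ≤ ℓ) (hℓm : ℓ ≤ m + 1) (s : ℕ) :
    moment (m + 1) ℓ s = 𝔼 x : Cutting m,
      pairMoment (cutSize x) (cutLast ℓ x) (m + 1 - cutSize x) (ℓ - cutLast ℓ x) s := by
  rw [moment, expLast_succ hm hℓ hℓm]
  simp [pairMoment]

theorem add_pow_sub_pow_le {x y : ℝ} (hx : 0 ≤ x) (hy : 0 ≤ y) (t : ℕ) :
    (x + y) ^ (t + 1) - x ^ (t + 1) ≤ (t + 1) * y * (x + y) ^ t := by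
  induction t with
  | zero => simp
  | succ t ih =>
    have h1 : x ^ (t + 1) ≤ (x + y) ^ (t + 1) := by gcongr; linarith
    have h2 := mul_le_mul_of_nonneg_left ih (by linarith : 0 ≤ x + y)
    have h3 := mul_le_mul_of_nonneg_left h1 hy
    rw [pow_succ (x + y) (t + 1), pow_succ x (t + 1)]
    push_cast
    have e : (x + y) * ((t + 1) * y * (x + y) ^ t) = (t + 1) * y * (x + y) ^ (t + 1) := by ring
    nlinarith

theorem add_pow_le_two_pow {x y : ℝ} (hx : 0 ≤ x) (hy : 0 ≤ y) (t : ℕ) :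
    (x + y) ^ t ≤ 2 ^ t * (x ^ t + y ^ t) := by
  refine (add_pow_le hx hy t).trans ?_
  gcongr
  · norm_num
  · omega

theorem expLast_succ_pow_le (n ℓ t : ℕ) :
    expLast n ℓ (fun k => ((k : ℝ) + 1) ^ t) ≤ 2 ^ t * (moment n ℓ t + 1) := by
  have h := expLast_mono n ℓ fun k => add_pow_le_two_pow (Nat.cast_nonneg (α := ℝ) k) zero_le_one t
  rw [expLast_const_mul, expLast_add] at h
  simpa [expLast_const, moment] using h

theorem pairMoment_zero (k n ℓ s : ℕ) :
    pairMoment k 0 n ℓ s = expLast n ℓ fun j => ((j : ℝ) + 1) ^ s := by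
  simp [pairMoment, expLast_zero]

theorem moment_le_pairMoment (k r n ℓ s : ℕ) : moment n ℓ s ≤ pairMoment k r n ℓ s := by
  rw [← expLast_const k r (moment n ℓ s)]
  refine expLast_mono _ _ fun i => expLast_mono _ _ fun j => ?_
  gcongr
  linarith [Nat.cast_nonneg (α := ℝ) i]

theorem pairMoment_sub_le (k r n ℓ t : ℕ) :
    pairMoment k r n ℓ (t + 1) - moment n ℓ (t + 1)
      ≤ (t + 1) * 2 ^ t * ((moment k r 1 + 1) * moment n ℓ t
        + 2 ^ (t + 1) * (moment k r (t + 1) + 1)) := by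
  have hpt : ∀ i j : ℕ, ((i : ℝ) + j + 1) ^ (t + 1) ≤ (j : ℝ) ^ (t + 1)
      + (t + 1) * 2 ^ t * (((i : ℝ) ^ 1 + 1) * (j : ℝ) ^ t + ((i : ℝ) + 1) ^ (t + 1)) := by
    intro i j
    have hi : (0 : ℝ) ≤ i := Nat.cast_nonneg i
    have hj : (0 : ℝ) ≤ j := Nat.cast_nonneg j
    have h1 := add_pow_sub_pow_le hj (by linarith : (0 : ℝ) ≤ i + 1) t
    have h2 := add_pow_le_two_pow hj (by linarith : (0 : ℝ) ≤ i + 1) t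
    have h3 : (t + 1 : ℝ) * (i + 1) * ((j : ℝ) + (i + 1)) ^ t
        ≤ (t + 1) * (i + 1) * (2 ^ t * ((j : ℝ) ^ t + (i + 1) ^ t)) := by gcongr
    have e1 : (j : ℝ) + (i + 1) = i + j + 1 := by ring
    have e2 : (t + 1 : ℝ) * (i + 1) * (2 ^ t * ((j : ℝ) ^ t + (i + 1) ^ t))
        = (t + 1) * 2 ^ t * (((i : ℝ) ^ 1 + 1) * (j : ℝ) ^ t + ((i : ℝ) + 1) ^ (t + 1)) := by
      ring
    rw [e1] at h1 h3
    rw [e2] at h3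
    linarith
  have h := expLast_mono k r fun i => expLast_mono n ℓ (hpt i)
  simp only [expLast_add, expLast_const_mul, expLast_const, expLast_mul_const] at h
  have h4 := expLast_succ_pow_le k r (t + 1)
  have h5 : (t + 1 : ℝ) * 2 ^ t * expLast k r (fun i => ((i : ℝ) + 1) ^ (t + 1))
      ≤ (t + 1) * 2 ^ t * (2 ^ (t + 1) * (moment k r (t + 1) + 1)) := by gcongr
  unfold pairMoment
  unfold moment at h4 h5 ⊢
  linarith

theorem pairMoment_le (k r n ℓ s : ℕ) :
    pairMoment k r n ℓ s ≤ 4 ^ s * (moment n ℓ s + (moment k r s + 1)) := by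
  have hpt : ∀ i j : ℕ, ((i : ℝ) + j + 1) ^ s ≤ 4 ^ s * ((j : ℝ) ^ s + ((i : ℝ) ^ s + 1)) := by
    intro i j
    have hi : (0 : ℝ) ≤ i := Nat.cast_nonneg i
    have hj : (0 : ℝ) ≤ j := Nat.cast_nonneg j
    have h2 := add_pow_le_two_pow hj (by linarith : (0 : ℝ) ≤ i + 1) s
    have h3 := add_pow_le_two_pow hi zero_le_one s
    have h4 : (1 : ℝ) ≤ 2 ^ s := one_le_pow₀ (by norm_num)
    have e1 : (j : ℝ) + (i + 1) = i + j + 1 := by ring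
    have e2 : (4 : ℝ) ^ s = 2 ^ s * 2 ^ s := by rw [← mul_pow]; norm_num
    rw [e1] at h2
    rw [one_pow] at h3
    rw [e2, mul_assoc]
    refine h2.trans ?_
    gcongr
    have : 0 ≤ (j : ℝ) ^ s := by positivity
    nlinarith
  have h := expLast_mono k r fun i => expLast_mono n ℓ (hpt i)
  simp only [expLast_add, expLast_const_mul, expLast_const] at h
  exact h

/-- The moments of order `s` are at most of order `(n / log n) ^ s`. -/
def MomentBound (s ℓ : ℕ) : Prop :=
  ∃ C : ℝ, 0 ≤ C ∧ ∀ n : ℕ, 1 ≤ n → moment n ℓ s ≤ C * gauge s s n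

/-- The coefficient `ℓ / (s + ℓ)` is the `s`-th moment of the beta distribution with parameters
`ℓ` and `1`. -/
noncomputable def betaMoment (ℓ s : ℕ) : ℝ := (ℓ : ℝ) / (s + ℓ)

/-- The expansion of the moments of order `s`. -/
def MomentExpansion (s ℓ : ℕ) : Prop :=
  ∃ C : ℝ, 0 ≤ C ∧ ∀ n : ℕ, 1 ≤ n →
    |moment n ℓ s - betaMoment ℓ s * gauge s s n| ≤ C * gauge s (s + 1) n

theorem betaMoment_nonneg (ℓ s : ℕ) : 0 ≤ betaMoment ℓ s := by
  unfold betaMoment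
  positivity

theorem betaMoment_le_one (ℓ s : ℕ) : betaMoment ℓ s ≤ 1 :=
  div_le_one_of_le₀ (by linarith [Nat.cast_nonneg (α := ℝ) s]) (by positivity)

/-- The identity between the moments of beta distributions that balances the leading terms of the
recursion. -/
theorem betaMoment_identity {ℓ : ℕ} (hℓ : 1 ≤ ℓ) (t : ℕ) :
    (t + 1) * betaMoment ℓ t + ℓ * (betaMoment (ℓ - 1) (t + 1) - betaMoment ℓ (t + 1))
      = (t + 1) * betaMoment ℓ (t + 1) := by
  obtain ⟨r, rfl⟩ : ∃ r, ℓ = r + 1 := ⟨ℓ - 1, by omega⟩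
  unfold betaMoment
  push_cast
  have h1 : (t : ℝ) + (r + 1) ≠ 0 := by positivity
  have h2 : (t : ℝ) + 1 + (r + 1) ≠ 0 := by positivity
  have h3 : (t : ℝ) + 1 + r ≠ 0 := by positivity
  field_simp
  ring

theorem exists_uniform_momentBound {s ℓ : ℕ} (h : ∀ r < ℓ, MomentBound s r) :
    ∃ C : ℝ, 0 ≤ C ∧ ∀ r < ℓ, ∀ n : ℕ, 1 ≤ n → moment n r s ≤ C * gauge s s n := by
  choose! C hC h using h
  refine ⟨∑ r ∈ Finset.range ℓ, C r, Finset.sum_nonneg fun r hr => hC r (Finset.mem_range.1 hr),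
    fun r hr n hn => (h r hr n hn).trans ?_⟩
  refine mul_le_mul_of_nonneg_right ?_ (gauge_nonneg _ _ _)
  exact Finset.single_le_sum (f := C) (fun r hr => hC r (Finset.mem_range.1 hr))
    (Finset.mem_range.2 hr)

theorem exists_gauge_self_mono (s : ℕ) :
    ∃ C : ℝ, 0 ≤ C ∧ ∀ k n : ℕ, 1 ≤ n → k ≤ n → gauge s s k ≤ C * gauge s s n := by
  cases s with
  | zero => exact ⟨1, zero_le_one, fun k n _ _ => by simp [gauge]⟩
  | succ s => exact exists_gauge_mono s (s + 1)

theorem one_le_gauge_self (s : ℕ) {n : ℕ} (hn : 1 ≤ n) : 1 ≤ 3 ^ s * gauge s s n := by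
  rw [gauge_pow, ← mul_pow]
  exact one_le_pow₀ (one_le_gauge_one hn)

theorem momentBound_of_expansion {s ℓ : ℕ} (h : MomentExpansion s ℓ) : MomentBound s ℓ := by
  obtain ⟨C, hC, h⟩ := h
  refine ⟨1 + C, by positivity, fun n hn => ?_⟩
  have h1 := (abs_le.1 (h n hn)).2
  have h2 : gauge s (s + 1) n ≤ gauge s s n := gauge_le_gauge (Nat.le_succ s)
  have h3 := mul_le_mul_of_nonneg_left h2 hC
  have h4 := mul_le_mul_of_nonneg_right (betaMoment_le_one ℓ s) (gauge_nonneg s s n)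
  linarith

theorem momentExpansion_zero {ℓ : ℕ} (hℓ : 1 ≤ ℓ) : MomentExpansion 0 ℓ := by
  refine ⟨0, le_rfl, fun n _ => ?_⟩
  have : (ℓ : ℝ) ≠ 0 := by positivity
  simp [moment_zero_right, betaMoment, gauge, this]

theorem momentExpansion_succ_zero (s : ℕ) : MomentExpansion (s + 1) 0 :=
  ⟨0, le_rfl, fun n _ => by simp [moment_zero_succ, betaMoment]⟩

/-- The inductive step for the upper bound. If no selected node is cut off, then the power grows
by a moment of lower order. Otherwise, the crude bound `pairMoment_le` suffices, since this event
has a probability of order `log n / n`; the moment of the part that is cut off has to be kept in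
the recursion only because this part may contain all of the selected nodes. -/
theorem momentBound_succ {t ℓ : ℕ} (hℓ : 1 ≤ ℓ) (ht : ∀ r, MomentBound t r)
    (hr : ∀ r < ℓ, MomentBound (t + 1) r) : MomentBound (t + 1) ℓ := by
  obtain ⟨C₁, hC₁, h₁⟩ := ht ℓ
  obtain ⟨C₂, hC₂, h₂⟩ := exists_uniform_momentBound hr
  obtain ⟨C₃, hC₃, h₃⟩ := exists_gauge_self_mono t
  obtain ⟨C₄, hC₄, h₄⟩ := exists_gauge_self_mono (t + 1)
  set A : ℝ := 4 ^ (t + 1) with hA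
  set B₁ : ℝ := (t + 1) * 2 ^ t * (C₁ * C₃ + 2 ^ (t + 1) * 3 ^ t) with hB₁
  set B₂ : ℝ := A * (2 * (C₂ * C₄) + 3 ^ (t + 1)) with hB₂
  have hA0 : 0 ≤ A := by positivity
  have hB₁0 : 0 ≤ B₁ := by positivity
  have hB₂0 : 0 ≤ B₂ := by positivity
  refine exists_le_gauge_of_le_expect t t ℓ hℓ (fun n => moment n ℓ (t + 1)) (A := A)
    (B := B₁ + B₂ * (7 * ℓ ^ 2)) hA0 (by positivity) ℓ fun m hm hℓm => ?_
  have := nonempty_cutting hm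
  have hg0 := gauge_nonneg t t (m + 1)
  have hg1 := gauge_nonneg (t + 1) (t + 1) (m + 1)
  have hpt : ∀ x : Cutting m,
      pairMoment (cutSize x) (cutLast ℓ x) (m + 1 - cutSize x) (ℓ - cutLast ℓ x) (t + 1)
        ≤ moment (m + 1 - cutSize x) ℓ (t + 1) + B₁ * gauge t t (m + 1)
          + (B₂ * gauge (t + 1) (t + 1) (m + 1) * cutLast ℓ x
            + A * (cutLast ℓ x * moment (cutSize x) ℓ (t + 1))) := by
    intro x
    have hK := cutSize_pos x
    have hKm := cutSize_le x
    rcases Nat.eq_zero_or_pos (cutLast ℓ x) with h0 | hpos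
    · have h5 := pairMoment_sub_le (cutSize x) 0 (m + 1 - cutSize x) ℓ t
      rw [show moment (cutSize x) 0 1 = 0 from moment_zero_succ _ 0, moment_zero_succ] at h5
      have h6 := (h₁ (m + 1 - cutSize x) (by omega)).trans
        (mul_le_mul_of_nonneg_left (h₃ _ (m + 1) (by omega) (Nat.sub_le _ _)) hC₁)
      have h7 := one_le_gauge_self t (n := m + 1) (by omega)
      have h8 : (t + 1 : ℝ) * 2 ^ t * ((0 + 1) * moment (m + 1 - cutSize x) ℓ t
          + 2 ^ (t + 1) * (0 + 1)) ≤ B₁ * gauge t t (m + 1) := by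
        calc _ = (t + 1 : ℝ) * 2 ^ t * (moment (m + 1 - cutSize x) ℓ t
              + 2 ^ (t + 1) * 1) := by ring
          _ ≤ (t + 1 : ℝ) * 2 ^ t * (C₁ * (C₃ * gauge t t (m + 1))
              + 2 ^ (t + 1) * (3 ^ t * gauge t t (m + 1))) := by gcongr
          _ = _ := by rw [hB₁]; ring
      rw [h0]
      simp only [Nat.cast_zero, mul_zero, zero_mul, add_zero, Nat.sub_zero]
      linarith
    · have h5 := pairMoment_le (cutSize x) (cutLast ℓ x) (m + 1 - cutSize x)
        (ℓ - cutLast ℓ x) (t + 1)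
      have h6 := (h₂ (ℓ - cutLast ℓ x) (by omega) (m + 1 - cutSize x) (by omega)).trans
        (mul_le_mul_of_nonneg_left (h₄ _ (m + 1) (by omega) (Nat.sub_le _ _)) hC₂)
      have h7 : moment (cutSize x) (cutLast ℓ x) (t + 1)
          ≤ C₂ * (C₄ * gauge (t + 1) (t + 1) (m + 1)) + moment (cutSize x) ℓ (t + 1) := by
        rcases (cutLast_le hℓm x).lt_or_eq with hlt | heq
        · have := (h₂ (cutLast ℓ x) hlt (cutSize x) (by omega)).trans
            (mul_le_mul_of_nonneg_left (h₄ _ (m + 1) (by omega) (by omega)) hC₂)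
          linarith [moment_nonneg (cutSize x) ℓ (t + 1)]
        · rw [heq]
          have : 0 ≤ C₂ * (C₄ * gauge (t + 1) (t + 1) (m + 1)) := by positivity
          linarith
      have h8 := one_le_gauge_self (t + 1) (n := m + 1) (by omega)
      have h9 : (1 : ℝ) ≤ cutLast ℓ x := by exact_mod_cast hpos
      have h10 := moment_nonneg (m + 1 - cutSize x) ℓ (t + 1)
      have h11 := moment_nonneg (cutSize x) ℓ (t + 1)
      have h12 : A * (moment (m + 1 - cutSize x) (ℓ - cutLast ℓ x) (t + 1)
          + (moment (cutSize x) (cutLast ℓ x) (t + 1) + 1))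
          ≤ B₂ * gauge (t + 1) (t + 1) (m + 1) + A * moment (cutSize x) ℓ (t + 1) := by
        calc _ ≤ A * (C₂ * (C₄ * gauge (t + 1) (t + 1) (m + 1))
              + (C₂ * (C₄ * gauge (t + 1) (t + 1) (m + 1)) + moment (cutSize x) ℓ (t + 1)
                + 3 ^ (t + 1) * gauge (t + 1) (t + 1) (m + 1))) := by gcongr
          _ = _ := by rw [hB₂]; ring
      have h13 : 0 ≤ B₂ * gauge (t + 1) (t + 1) (m + 1) := by positivity
      have h14 : 0 ≤ A * moment (cutSize x) ℓ (t + 1) := by positivity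
      have h15 : 0 ≤ B₁ * gauge t t (m + 1) := by positivity
      nlinarith
  rw [moment_succ hm hℓ hℓm]
  refine (Finset.expect_le_expect fun x _ => hpt x).trans ?_
  rw [Finset.expect_add_distrib, Finset.expect_add_distrib, Finset.expect_add_distrib,
    Fintype.expect_const, ← Finset.mul_expect, ← Finset.mul_expect]
  have h5 := mul_expect_cutLast_le hℓ hℓm hm
  have hl := lg_pos (m + 1)
  have h6 : gauge (t + 1) (t + 1) (m + 1) * 𝔼 x : Cutting m, (cutLast ℓ x : ℝ)
      ≤ 7 * ℓ ^ 2 * gauge t t (m + 1) := by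
    rw [gauge_succ_eq, gauge_eq_lg_mul t t]
    push_cast
    calc _ = (((m : ℝ) + 1) * 𝔼 x : Cutting m, (cutLast ℓ x : ℝ)) * gauge t (t + 1) (m + 1) := by
          ring
      _ ≤ 7 * ℓ ^ 2 * lg (m + 1) * gauge t (t + 1) (m + 1) :=
          mul_le_mul_of_nonneg_right h5 (gauge_nonneg _ _ _)
      _ = _ := by ring
  have h7 := mul_le_mul_of_nonneg_left h6 hB₂0
  linarith

end NodeIsolation

/-! ### The leading terms of the recursion for the moments -/

namespace NodeIsolation

open scoped BigOperators

theorem add_pow_sub_pow_ge {x y : ℝ} (hx : 0 ≤ x) (hy : 0 ≤ y) (t : ℕ) :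
    (t + 1) * y * x ^ t ≤ (x + y) ^ (t + 1) - x ^ (t + 1) := by
  induction t with
  | zero => simp
  | succ t ih =>
    have h2 := mul_le_mul_of_nonneg_left ih (by linarith : 0 ≤ x + y)
    rw [pow_succ (x + y) (t + 1), pow_succ x (t + 1)]
    push_cast
    have e : (x + y) * ((t + 1) * y * x ^ t)
        = (t + 1) * y * x ^ (t + 1) + (t + 1) * y ^ 2 * x ^ t := by ring
    have : 0 ≤ (t + 1) * y ^ 2 * x ^ t := by positivity
    nlinarith

/-- The first cut when none of the last nodes is separated from the root. -/
theorem exists_abs_expLast_succ_sub_le {t ℓ : ℕ} (ht : MomentExpansion t ℓ) (hℓ : 1 ≤ ℓ)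
    (hb : ∀ u ≤ t, MomentBound u ℓ) :
    ∃ C : ℝ, 0 ≤ C ∧ ∀ k n : ℕ, k < n →
      |expLast (n - k) ℓ (fun j => ((j : ℝ) + 1) ^ (t + 1)) - moment (n - k) ℓ (t + 1)
          - (t + 1) * betaMoment ℓ t * gauge t t n|
        ≤ C * (gauge t (t + 1) n + k * gauge t (t + 2) n) := by
  cases t with
  | zero =>
    refine ⟨0, le_rfl, fun k n _ => ?_⟩
    have h1 : betaMoment ℓ 0 = 1 := by
      have : (ℓ : ℝ) ≠ 0 := by positivity
      simp [betaMoment, this]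
    have h2 : expLast (n - k) ℓ (fun j => ((j : ℝ) + 1) ^ (0 + 1))
        = moment (n - k) ℓ (0 + 1) + 1 := by
      simp only [zero_add, pow_one, expLast_add, expLast_const, moment]
    rw [h1, h2]
    simp [gauge]
  | succ u =>
    obtain ⟨C₁, hC₁, h₁⟩ := ht
    obtain ⟨C₂, hC₂, h₂⟩ := hb u (Nat.le_succ u)
    obtain ⟨C₃, hC₃, h₃⟩ := exists_gauge_self_mono u
    obtain ⟨C₄, hC₄, h₄⟩ := exists_gauge_le_gauge u u (u + 2)
    obtain ⟨C₅, hC₅, h₅⟩ := exists_gauge_mono u (u + 2)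
    obtain ⟨C₆, hC₆, h₆⟩ := exists_abs_gauge_sub_le u (u + 1)
    obtain ⟨C₇, hC₇, h₇⟩ := exists_gauge_le_gauge u (u + 1) (u + 3)
    set D₁ : ℝ := (u + 2) * (u + 1) * 2 ^ u * (C₂ * C₃ * C₄ + 3 ^ u * C₄) with hD₁
    refine ⟨D₁ + (u + 2) * (C₁ * C₅ + C₆ * C₇), by positivity, fun k n hkn => ?_⟩
    have hn : 1 ≤ n := by omega
    set N := n - k
    have hN : 1 ≤ N := by omega
    have hNn : N ≤ n := Nat.sub_le n k
    have hpt : ∀ j : ℕ, ((j : ℝ) + 1) ^ (u + 1 + 1)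
        ≤ (j : ℝ) ^ (u + 1 + 1) + ((u + 2) * (j : ℝ) ^ (u + 1)
          + (u + 2) * (u + 1) * ((j : ℝ) + 1) ^ u) := by
      intro j
      have h1 := add_pow_sub_pow_le (Nat.cast_nonneg (α := ℝ) j) zero_le_one (u + 1)
      have h2 := add_pow_sub_pow_le (Nat.cast_nonneg (α := ℝ) j) zero_le_one u
      push_cast at h1
      have h3 : (0 : ℝ) ≤ u + 2 := by positivity
      nlinarith
    have hpt' : ∀ j : ℕ, (j : ℝ) ^ (u + 1 + 1) + (u + 2) * (j : ℝ) ^ (u + 1)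
        ≤ ((j : ℝ) + 1) ^ (u + 1 + 1) := by
      intro j
      have h1 := add_pow_sub_pow_ge (Nat.cast_nonneg (α := ℝ) j) zero_le_one (u + 1)
      push_cast at h1
      linarith
    have hup := expLast_mono N ℓ hpt
    have hlow := expLast_mono N ℓ hpt'
    simp only [expLast_add, expLast_const_mul] at hup hlow
    change _ ≤ moment N ℓ (u + 1 + 1) + ((u + 2) * moment N ℓ (u + 1) + _) at hup
    change moment N ℓ (u + 1 + 1) + (u + 2) * moment N ℓ (u + 1) ≤ _ at hlow
    have hrem : (u + 2 : ℝ) * (u + 1) * expLast N ℓ (fun j => ((j : ℝ) + 1) ^ u)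
        ≤ D₁ * gauge (u + 1) (u + 2) n := by
      have e1 : moment N ℓ u ≤ C₂ * (C₃ * (C₄ * gauge (u + 1) (u + 2) n)) :=
        (h₂ N hN).trans (mul_le_mul_of_nonneg_left ((h₃ N n hn hNn).trans
          (mul_le_mul_of_nonneg_left (h₄ n hn) hC₃)) hC₂)
      have e2 : 1 ≤ 3 ^ u * (C₄ * gauge (u + 1) (u + 2) n) :=
        (one_le_gauge_self u hn).trans (mul_le_mul_of_nonneg_left (h₄ n hn) (by positivity))
      calc _ ≤ (u + 2 : ℝ) * (u + 1) * (2 ^ u * (moment N ℓ u + 1)) := by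
            gcongr
            exact expLast_succ_pow_le N ℓ u
        _ ≤ (u + 2 : ℝ) * (u + 1) * (2 ^ u * (C₂ * (C₃ * (C₄ * gauge (u + 1) (u + 2) n))
            + 3 ^ u * (C₄ * gauge (u + 1) (u + 2) n))) := by gcongr
        _ = _ := by rw [hD₁]; ring
    have hexp : |moment N ℓ (u + 1) - betaMoment ℓ (u + 1) * gauge (u + 1) (u + 1) N|
        ≤ C₁ * (C₅ * gauge (u + 1) (u + 2) n) :=
      (h₁ N hN).trans (mul_le_mul_of_nonneg_left (h₅ N n hn hNn) hC₁)
    have hg : |gauge (u + 1) (u + 1) n - gauge (u + 1) (u + 1) N|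
        ≤ C₆ * (k * (C₇ * gauge (u + 1) (u + 3) n)) := by
      refine (h₆ k n hn hkn.le).trans ?_
      have := h₇ n hn
      gcongr
    have hg' : |betaMoment ℓ (u + 1) * (gauge (u + 1) (u + 1) n - gauge (u + 1) (u + 1) N)|
        ≤ C₆ * (k * (C₇ * gauge (u + 1) (u + 3) n)) := by
      rw [abs_mul, abs_of_nonneg (betaMoment_nonneg _ _)]
      exact (mul_le_of_le_one_left (abs_nonneg _) (betaMoment_le_one _ _)).trans hg
    set P := expLast N ℓ (fun j => ((j : ℝ) + 1) ^ (u + 1 + 1))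
    set g₁ := gauge (u + 1) (u + 2) n with hg₁
    set g₂ := gauge (u + 1) (u + 3) n with hg₂
    have hg₁0 : 0 ≤ g₁ := gauge_nonneg _ _ _
    have hg₂0 : 0 ≤ g₂ := gauge_nonneg _ _ _
    have hk0 : (0 : ℝ) ≤ k := Nat.cast_nonneg k
    have hD₁0 : 0 ≤ D₁ := by positivity
    have hu : (0 : ℝ) ≤ u + 2 := by positivity
    rw [abs_le] at hexp hg' ⊢
    have a1 := mul_le_mul_of_nonneg_left hexp.1 hu
    have a2 := mul_le_mul_of_nonneg_left hexp.2 hu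
    have a3 := mul_le_mul_of_nonneg_left hg'.1 hu
    have a4 := mul_le_mul_of_nonneg_left hg'.2 hu
    have b1 : 0 ≤ D₁ * (k * g₂) := by positivity
    have b2 : 0 ≤ (u + 2) * (C₁ * C₅) * (k * g₂) := by positivity
    have b3 : 0 ≤ (u + 2) * (C₆ * C₇) * g₁ := by positivity
    have b4 : 0 ≤ D₁ * g₁ := by positivity
    push_cast
    constructor <;> nlinarith

set_option maxHeartbeats 400000 in
/-- The first cut when some of the last nodes are separated from the root. -/
theorem exists_abs_pairMoment_sub_le {t ℓ : ℕ}
    (hr : MomentExpansion (t + 1) (ℓ - 1)) (hb : ∀ u ≤ t + 1, ∀ r, MomentBound u r) :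
    ∃ C : ℝ, 0 ≤ C ∧ ∀ k r n : ℕ, 1 ≤ k → k < n → 1 ≤ r → r ≤ ℓ →
      |pairMoment k r (n - k) (ℓ - r) (t + 1)
          - betaMoment ℓ (t + 1) * gauge (t + 1) (t + 1) (n - k)
          - (t + 1) * betaMoment ℓ t * gauge t t n
          - r * ((betaMoment (ℓ - 1) (t + 1) - betaMoment ℓ (t + 1)) * gauge (t + 1) (t + 1) n)|
        ≤ C * (gauge t t n * (r * gauge 1 1 k) + gauge (t + 1) (t + 2) n * r
          + gauge t (t + 1) n * (r * k) + gauge (t + 1) (t + 1) n * (r * ((r : ℝ) - 1))) := by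
  obtain ⟨C₁, hC₁, h₁⟩ := exists_uniform_momentBound (s := 1) (ℓ := ℓ + 1)
    fun r _ => hb 1 (by omega) r
  obtain ⟨C₂, hC₂, h₂⟩ := exists_uniform_momentBound (s := t) (ℓ := ℓ + 1)
    fun r _ => hb t (by omega) r
  obtain ⟨C₃, hC₃, h₃⟩ := exists_uniform_momentBound (s := t + 1) (ℓ := ℓ + 1)
    fun r _ => hb (t + 1) le_rfl r
  obtain ⟨C₄, hC₄, h₄⟩ := exists_gauge_self_mono t
  obtain ⟨C₅, hC₅, h₅⟩ := exists_gauge_self_mono (t + 1)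
  obtain ⟨C₆, hC₆, h₆⟩ := hr
  obtain ⟨C₇, hC₇, h₇⟩ := exists_gauge_mono t (t + 2)
  obtain ⟨C₈, hC₈, h₈⟩ := exists_abs_gauge_sub_le t (t + 1)
  set D₁ : ℝ := (t + 1) * 2 ^ t * ((C₁ + 3) * (C₂ * C₄)
    + 2 ^ (t + 1) * ((C₃ * C₄) + 3 ^ (t + 1) * C₄)) with hD₁
  set D₂ : ℝ := C₃ * C₅ + C₅ + 1 with hD₂
  refine ⟨D₁ + 3 * (t + 1) + C₆ * C₇ + C₈ + D₂, by positivity,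
    fun k r n hk hkn hr1 hrℓ => ?_⟩
  have hn : 1 ≤ n := by omega
  have hN : 1 ≤ n - k := by omega
  have hNn : n - k ≤ n := Nat.sub_le n k
  have hrR : (1 : ℝ) ≤ r := by exact_mod_cast hr1
  have hkR : (1 : ℝ) ≤ k := by exact_mod_cast hk
  have hgk := one_le_gauge_one hk
  set G := gauge 1 1 k with hG
  have hG0 : 0 ≤ G := gauge_nonneg _ _ _
  set g := gauge t t n with hg
  have hg0 : 0 ≤ g := gauge_nonneg _ _ _
  have hkk : gauge (t + 1) (t + 1) k ≤ C₄ * (G * g) := by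
    have e : gauge (t + 1) (t + 1) k = G * gauge t t k := by
      rw [hG, add_comm t 1, gauge_add]
    rw [e]
    calc G * gauge t t k ≤ G * (C₄ * g) := by
          gcongr
          exact h₄ k n hn hkn.le
      _ = _ := by ring
  -- replacing the sum of both parts by the part that contains the root
  have p1 : |pairMoment k r (n - k) (ℓ - r) (t + 1) - moment (n - k) (ℓ - r) (t + 1)|
      ≤ D₁ * (G * g) := by
    rw [abs_of_nonneg (sub_nonneg.2 (moment_le_pairMoment _ _ _ _ _))]
    refine (pairMoment_sub_le _ _ _ _ _).trans ?_
    have e1 : moment k r 1 + 1 ≤ (C₁ + 3) * G := by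
      have := h₁ r (by omega) k hk
      linarith
    have e2 : moment (n - k) (ℓ - r) t ≤ C₂ * (C₄ * g) :=
      (h₂ _ (by omega) _ hN).trans (mul_le_mul_of_nonneg_left (h₄ _ n hn hNn) hC₂)
    have e3 : moment k r (t + 1) + 1 ≤ C₃ * (C₄ * (G * g)) + 3 ^ (t + 1) * (C₄ * (G * g)) := by
      have e4 := (h₃ r (by omega) k hk).trans (mul_le_mul_of_nonneg_left hkk hC₃)
      have e5 := (one_le_gauge_self (t + 1) hk).trans
        (mul_le_mul_of_nonneg_left hkk (by positivity))
      linarith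
    have e6 := moment_nonneg (n - k) (ℓ - r) t
    calc _ ≤ (t + 1 : ℝ) * 2 ^ t * ((C₁ + 3) * G * (C₂ * (C₄ * g))
          + 2 ^ (t + 1) * (C₃ * (C₄ * (G * g)) + 3 ^ (t + 1) * (C₄ * (G * g)))) := by gcongr
      _ = _ := by rw [hD₁]; ring
  set h := gauge (t + 1) (t + 1) n with hh
  have hh0 : 0 ≤ h := gauge_nonneg _ _ _
  set h' := gauge (t + 1) (t + 1) (n - k) with hh'
  have hh'0 : 0 ≤ h' := gauge_nonneg _ _ _
  have hh'h : h' ≤ C₅ * h := h₅ _ n hn hNn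
  have hc0 := betaMoment_nonneg ℓ (t + 1)
  have hc1 := betaMoment_le_one ℓ (t + 1)
  have hd0 := betaMoment_nonneg (ℓ - 1) (t + 1)
  have hd1 := betaMoment_le_one (ℓ - 1) (t + 1)
  have hct0 := betaMoment_nonneg ℓ t
  have hct1 := betaMoment_le_one ℓ t
  set c := betaMoment ℓ (t + 1)
  set d := betaMoment (ℓ - 1) (t + 1)
  set γ := gauge (t + 1) (t + 2) n
  have hγ0 : 0 ≤ γ := gauge_nonneg _ _ _
  set β := gauge t (t + 1) n
  have hβ0 : 0 ≤ β := gauge_nonneg _ _ _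
  have p2 : |(t + 1) * betaMoment ℓ t * g| ≤ 3 * (t + 1) * (G * g) := by
    rw [abs_of_nonneg (by positivity)]
    calc (t + 1) * betaMoment ℓ t * g ≤ (t + 1) * 1 * ((3 * G) * g) := by
          gcongr
          nlinarith
      _ = _ := by ring
  have p3 : |moment (n - k) (ℓ - r) (t + 1) - c * h' - r * ((d - c) * h)|
      ≤ C₆ * C₇ * γ + C₈ * (k * β) + D₂ * (h * (r * ((r : ℝ) - 1))) := by
    have hm0 := moment_nonneg (n - k) (ℓ - r) (t + 1)
    have hdc : |d - c| ≤ 1 := by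
      rw [abs_le]
      constructor <;> linarith
    rcases hr1.eq_or_lt with rfl | hr2
    · have q1 : |moment (n - k) (ℓ - 1) (t + 1) - d * h'| ≤ C₆ * (C₇ * γ) :=
        (h₆ _ hN).trans (mul_le_mul_of_nonneg_left (h₇ _ n hn hNn) hC₆)
      have q2 : |(d - c) * (h - h')| ≤ 1 * (C₈ * (k * β)) := by
        rw [abs_mul]
        exact mul_le_mul hdc (h₈ k n hn hkn.le) (abs_nonneg _) zero_le_one
      rw [abs_le] at q1 q2 ⊢
      push_cast
      constructor <;> linarith
    · have hr2R : (2 : ℝ) ≤ r := by exact_mod_cast hr2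
      have q1 : moment (n - k) (ℓ - r) (t + 1) ≤ C₃ * (C₅ * h) :=
        (h₃ _ (by omega) _ hN).trans (mul_le_mul_of_nonneg_left hh'h hC₃)
      have q2 : c * h' ≤ 1 * (C₅ * h) := mul_le_mul hc1 hh'h hh'0 zero_le_one
      have q2' : 0 ≤ c * h' := by positivity
      have q3 : |r * ((d - c) * h)| ≤ r * (1 * h) := by
        rw [abs_mul, abs_mul, abs_of_nonneg hh0, Nat.abs_cast]
        gcongr
      have q4 : (r : ℝ) ≤ r * ((r : ℝ) - 1) := by nlinarith
      have q5 : (1 : ℝ) ≤ r * ((r : ℝ) - 1) := by linarith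
      have q6 : (C₃ * C₅ + C₅) * h * 1 ≤ (C₃ * C₅ + C₅) * h * (r * ((r : ℝ) - 1)) := by gcongr
      have q7 : h * r ≤ h * (r * ((r : ℝ) - 1)) := by gcongr
      have q8 : 0 ≤ C₆ * C₇ * γ := by positivity
      have q9 : 0 ≤ C₈ * (k * β) := by positivity
      rw [abs_le] at q3 ⊢
      rw [hD₂]
      constructor <;> linarith
  have hE1 : G * g ≤ g * (r * G) := by nlinarith [mul_nonneg hg0 hG0]
  have hE2 : γ ≤ γ * r := by nlinarith
  have hE3 : k * β ≤ β * (r * k) := by nlinarith [mul_nonneg hβ0 (by linarith : (0 : ℝ) ≤ k)]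
  have hE4 : 0 ≤ h * (r * ((r : ℝ) - 1)) := by
    have : (0 : ℝ) ≤ (r : ℝ) - 1 := by linarith
    positivity
  set E₁ := g * (r * G)
  set E₂ := γ * r
  set E₃ := β * (r * k)
  set E₄ := h * (r * ((r : ℝ) - 1))
  have hD₁0 : 0 ≤ D₁ := by positivity
  have hD₂0 : 0 ≤ D₂ := by positivity
  have hGg : 0 ≤ G * g := by positivity
  have hkβ : 0 ≤ k * β := by positivity
  set D := D₁ + 3 * (t + 1) + C₆ * C₇ + C₈ + D₂ with hD
  have f1 : D₁ * (G * g) + 3 * (t + 1) * (G * g) ≤ D * E₁ := by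
    calc _ = (D₁ + 3 * (t + 1)) * (G * g) := by ring
      _ ≤ D * E₁ := by
        refine mul_le_mul ?_ hE1 hGg (by positivity)
        rw [hD]
        have : 0 ≤ C₆ * C₇ := by positivity
        linarith
  have f2 : C₆ * C₇ * γ ≤ D * E₂ := by
    refine mul_le_mul ?_ hE2 hγ0 (by positivity)
    rw [hD]
    have : (0 : ℝ) ≤ 3 * (t + 1) := by positivity
    linarith
  have f3 : C₈ * (k * β) ≤ D * E₃ := by
    refine mul_le_mul ?_ hE3 hkβ (by positivity)
    rw [hD]
    have : (0 : ℝ) ≤ 3 * (t + 1) := by positivity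
    have : 0 ≤ C₆ * C₇ := by positivity
    linarith
  have f4 : D₂ * E₄ ≤ D * E₄ := by
    refine mul_le_mul_of_nonneg_right ?_ hE4
    rw [hD]
    have : (0 : ℝ) ≤ 3 * (t + 1) := by positivity
    have : 0 ≤ C₆ * C₇ := by positivity
    linarith
  rw [abs_le] at p1 p2 p3 ⊢
  constructor <;> linarith

end NodeIsolation

/-! ### The expansion of the moments -/

namespace NodeIsolation

open scoped BigOperators

/-- The inductive step for the expansion of the moments: the deviation of the moment from its
leading term satisfies the recursive inequality of `exists_le_gauge_of_le_expect` with a toll that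
is smaller than that of the moment itself by a factor `log n`, because the leading terms cancel by
`betaMoment_identity`. -/
theorem momentExpansion_succ {t ℓ : ℕ} (hℓ : 1 ≤ ℓ) (ht : MomentExpansion t ℓ)
    (hr : MomentExpansion (t + 1) (ℓ - 1)) (hb : ∀ u ≤ t + 1, ∀ r, MomentBound u r) :
    MomentExpansion (t + 1) ℓ := by
  obtain ⟨C₀, hC₀, h₀⟩ := exists_abs_expLast_succ_sub_le ht hℓ fun u hu => hb u (by omega) ℓ
  obtain ⟨C₁, hC₁, h₁⟩ := exists_abs_pairMoment_sub_le hr hb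
  obtain ⟨C₂, hC₂, h₂⟩ := exists_abs_expect_gauge_sub_le t (t + 1)
  obtain ⟨C₃, hC₃, h₃⟩ := exists_expect_cutLast_mul_gauge_le 0 1 ℓ hℓ
  set c := betaMoment ℓ (t + 1) with hc
  set d := betaMoment (ℓ - 1) (t + 1) with hd
  have hc0 : 0 ≤ c := betaMoment_nonneg _ _
  have hc1 : c ≤ 1 := betaMoment_le_one _ _
  have hdc : |d - c| ≤ 1 := by
    have hd0 : 0 ≤ d := betaMoment_nonneg _ _
    have hd1 : d ≤ 1 := betaMoment_le_one _ _
    rw [abs_le]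
    constructor <;> linarith
  set B : ℝ := C₀ * 5 + C₁ * (C₃ + 7 * ℓ ^ 2 + 4 * ℓ + 2 * ℓ ^ 2) + 6 * ℓ ^ 2 + C₂ with hB
  refine exists_le_gauge_of_le_expect t (t + 1) ℓ hℓ
    (fun n => |moment n ℓ (t + 1) - c * gauge (t + 1) (t + 1) n|) (A := 0) (B := B)
    le_rfl (by positivity) ℓ fun m hm hℓm => ?_
  have := nonempty_cutting hm
  have hl := lg_pos (m + 1)
  have hg' : gauge t t (m + 1) = lg (m + 1) * gauge t (t + 1) (m + 1) := gauge_eq_lg_mul _ _ _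
  have hβ' : gauge t (t + 1) (m + 1) = lg (m + 1) * gauge t (t + 2) (m + 1) :=
    gauge_eq_lg_mul _ _ _
  have hh' : gauge (t + 1) (t + 1) (m + 1) = ((m : ℝ) + 1) * gauge t (t + 1) (m + 1) := by
    rw [gauge_succ_eq]
    push_cast
    rfl
  have hγ' : gauge (t + 1) (t + 2) (m + 1) = ((m : ℝ) + 1) * gauge t (t + 2) (m + 1) := by
    rw [gauge_succ_eq]
    push_cast
    rfl
  have hβ0 := gauge_nonneg t (t + 1) (m + 1)
  have hδ0 := gauge_nonneg t (t + 2) (m + 1)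
  have hγ0 := gauge_nonneg (t + 1) (t + 2) (m + 1)
  have hh0 := gauge_nonneg (t + 1) (t + 1) (m + 1)
  have hg0 := gauge_nonneg t t (m + 1)
  have h₂m := h₂ m hm
  have h₃m := h₃ m hm hℓm
  set g := gauge t t (m + 1)
  set h := gauge (t + 1) (t + 1) (m + 1)
  set γ := gauge (t + 1) (t + 2) (m + 1)
  set β := gauge t (t + 1) (m + 1)
  set δ := gauge t (t + 2) (m + 1)
  -- the deviation of the conditional moment from its leading terms, given the first cut
  set lead : Cutting m → ℝ := fun x =>
    pairMoment (cutSize x) (cutLast ℓ x) (m + 1 - cutSize x) (ℓ - cutLast ℓ x) (t + 1)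
      - c * gauge (t + 1) (t + 1) (m + 1 - cutSize x) - (t + 1) * betaMoment ℓ t * g
      - cutLast ℓ x * ((d - c) * h) with hlead
  -- the bound for this deviation, apart from that of the moment of the remaining tree
  set err : Cutting m → ℝ := fun x =>
    C₀ * (β + cutSize x * δ) + C₁ * (g * (cutLast ℓ x * gauge 1 1 (cutSize x))
      + γ * cutLast ℓ x + β * (cutLast ℓ x * cutSize x)
      + h * (cutLast ℓ x * ((cutLast ℓ x : ℝ) - 1))) with herr
  have hpt : ∀ x, |lead x| ≤ |moment (m + 1 - cutSize x) ℓ (t + 1)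
      - c * gauge (t + 1) (t + 1) (m + 1 - cutSize x)| + err x := by
    intro x
    have hK := cutSize_pos x
    have hKm := cutSize_le x
    simp only [hlead, herr]
    rcases Nat.eq_zero_or_pos (cutLast ℓ x) with hR | hR
    · have e := h₀ (cutSize x) (m + 1) (by omega)
      rw [hR, pairMoment_zero]
      simp only [Nat.cast_zero, zero_mul, mul_zero, add_zero, sub_zero, Nat.sub_zero]
      refine le_trans ?_ (add_le_add le_rfl e)
      refine le_trans (le_of_eq ?_) (abs_add_le _ _)
      congr 1
      ring
    · have e := h₁ (cutSize x) (cutLast ℓ x) (m + 1) hK (by omega) hR (cutLast_le hℓm x)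
      refine e.trans ?_
      have e1 : 0 ≤ C₀ * (β + cutSize x * δ) := by positivity
      have e2 := abs_nonneg (moment (m + 1 - cutSize x) ℓ (t + 1)
        - c * gauge (t + 1) (t + 1) (m + 1 - cutSize x))
      linarith
  have hR := abs_mul_expect_cutLast_sub_le hℓ hℓm hm
  have hR' := mul_expect_cutLast_le hℓ hℓm hm
  have hK := expect_cutSize_le hm
  have hRK := expect_cutLast_mul_cutSize_le hℓm hm
  have hRR := mul_expect_cutLast_mul_pred_le hℓm hm
  set ER := 𝔼 x : Cutting m, (cutLast ℓ x : ℝ)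
  have herr_le : 𝔼 x, err x ≤ (C₀ * 5 + C₁ * (C₃ + 7 * ℓ ^ 2 + 4 * ℓ + 2 * ℓ ^ 2)) * β := by
    have e0 : 𝔼 x, err x = C₀ * (β + (𝔼 x : Cutting m, (cutSize x : ℝ)) * δ)
        + C₁ * (g * (𝔼 x : Cutting m, (cutLast ℓ x : ℝ) * gauge 1 1 (cutSize x)) + γ * ER
          + β * (𝔼 x : Cutting m, (cutLast ℓ x : ℝ) * (cutSize x : ℝ))
          + h * 𝔼 x : Cutting m, (cutLast ℓ x : ℝ) * ((cutLast ℓ x : ℝ) - 1)) := by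
      simp only [herr, Finset.expect_add_distrib, ← Finset.mul_expect, ← Finset.expect_mul,
        Fintype.expect_const]
      rfl
    have e1 : (𝔼 x : Cutting m, (cutSize x : ℝ)) * δ ≤ 4 * β := by
      rw [hβ', ← mul_assoc]
      exact mul_le_mul_of_nonneg_right hK hδ0
    have e2 : g * (𝔼 x : Cutting m, (cutLast ℓ x : ℝ) * gauge 1 1 (cutSize x)) ≤ C₃ * β := by
      calc _ ≤ g * (C₃ * gauge 0 1 (m + 1)) := mul_le_mul_of_nonneg_left h₃m hg0
        _ = _ := by
          rw [hg']
          unfold gauge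
          field_simp
    have e3 : γ * ER ≤ 7 * ℓ ^ 2 * β := by
      calc γ * ER = (((m : ℝ) + 1) * ER) * δ := by rw [hγ']; ring
        _ ≤ (7 * ℓ ^ 2 * lg (m + 1)) * δ := mul_le_mul_of_nonneg_right hR' hδ0
        _ = _ := by rw [hβ']; ring
    have e4 : β * (𝔼 x : Cutting m, (cutLast ℓ x : ℝ) * (cutSize x : ℝ)) ≤ 4 * ℓ * β := by
      rw [mul_comm]
      exact mul_le_mul_of_nonneg_right hRK hβ0
    have e5 : h * 𝔼 x : Cutting m, (cutLast ℓ x : ℝ) * ((cutLast ℓ x : ℝ) - 1)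
        ≤ 2 * ℓ ^ 2 * β := by
      rw [hh', mul_right_comm]
      exact mul_le_mul_of_nonneg_right hRR hβ0
    rw [e0]
    calc _ ≤ C₀ * (β + 4 * β) + C₁ * (C₃ * β + 7 * ℓ ^ 2 * β + 4 * ℓ * β + 2 * ℓ ^ 2 * β) := by
          gcongr
      _ = _ := by ring
  have hmain : |𝔼 x, lead x| ≤ 𝔼 x : Cutting m, |moment (m + 1 - cutSize x) ℓ (t + 1)
      - c * gauge (t + 1) (t + 1) (m + 1 - cutSize x)|
      + (C₀ * 5 + C₁ * (C₃ + 7 * ℓ ^ 2 + 4 * ℓ + 2 * ℓ ^ 2)) * β := by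
    refine (Finset.abs_expect_le _ _).trans ?_
    refine (Finset.expect_le_expect fun x _ => hpt x).trans ?_
    rw [Finset.expect_add_distrib]
    linarith
  set Eh := 𝔼 x : Cutting m, gauge (t + 1) (t + 1) (m + 1 - cutSize x)
  have hlead_eq : 𝔼 x, lead x = moment (m + 1) ℓ (t + 1) - c * Eh
      - (t + 1) * betaMoment ℓ t * g - ER * ((d - c) * h) := by
    simp only [hlead, Finset.expect_sub_distrib, ← Finset.mul_expect, ← Finset.expect_mul,
      Fintype.expect_const, moment_succ hm hℓ hℓm]
    rfl
  have hid := betaMoment_identity hℓ t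
  have f1 : |(d - c) * (ER * h - ℓ * lg (m + 1) * β)| ≤ 6 * ℓ ^ 2 * β := by
    have e : ER * h - ℓ * lg (m + 1) * β = (((m : ℝ) + 1) * ER - ℓ * lg (m + 1)) * β := by
      rw [hh']
      ring
    rw [e, abs_mul, abs_mul, abs_of_nonneg hβ0, ← one_mul (6 * (ℓ : ℝ) ^ 2 * β)]
    gcongr
  have f2 : |c * (h - Eh - (t + 1) * lg (m + 1) * β)| ≤ C₂ * β := by
    rw [abs_mul, abs_of_nonneg hc0]
    exact (mul_le_of_le_one_left (abs_nonneg _) hc1).trans h₂m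
  have hfin : moment (m + 1) ℓ (t + 1) - c * h
      = 𝔼 x, lead x + (d - c) * (ER * h - ℓ * lg (m + 1) * β)
        - c * (h - Eh - (t + 1) * lg (m + 1) * β) := by
    rw [hlead_eq, hg']
    linear_combination (lg (m + 1) * β) * hid
  have f3 := abs_sub (𝔼 x, lead x + (d - c) * (ER * h - ℓ * lg (m + 1) * β))
    (c * (h - Eh - (t + 1) * lg (m + 1) * β))
  have f4 := abs_add_le (𝔼 x, lead x) ((d - c) * (ER * h - ℓ * lg (m + 1) * β))
  rw [hfin, hB, zero_mul, add_zero]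
  linarith

theorem momentBound_zero (ℓ : ℕ) : MomentBound 0 ℓ :=
  ⟨1, zero_le_one, fun n _ => by simp [moment_zero_right, gauge]⟩

/-- All moments, by induction on the order, and for each order by induction on `ℓ`. -/
theorem momentBound_and_momentExpansion (s : ℕ) :
    (∀ u ≤ s, ∀ ℓ, MomentBound u ℓ) ∧ ∀ ℓ, 1 ≤ ℓ → MomentExpansion s ℓ := by
  induction s with
  | zero =>
    refine ⟨fun u hu ℓ => ?_, fun ℓ hℓ => momentExpansion_zero hℓ⟩
    rw [Nat.le_zero.1 hu]
    exact momentBound_zero ℓ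
  | succ t ih =>
    have hb : ∀ ℓ, MomentBound (t + 1) ℓ := by
      intro ℓ
      induction ℓ using Nat.strong_induction_on with
      | _ ℓ ihℓ =>
        rcases Nat.eq_zero_or_pos ℓ with rfl | hℓ
        · exact momentBound_of_expansion (momentExpansion_succ_zero t)
        · exact momentBound_succ hℓ (ih.1 t le_rfl) ihℓ
    have hb' : ∀ u ≤ t + 1, ∀ ℓ, MomentBound u ℓ := by
      intro u hu
      rcases hu.lt_or_eq with h | rfl
      · exact ih.1 u (Nat.lt_succ_iff.1 h)
      · exact hb
    refine ⟨hb', fun ℓ hℓ => ?_⟩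
    obtain ⟨r, rfl⟩ : ∃ r, ℓ = r + 1 := ⟨ℓ - 1, by omega⟩
    clear hℓ
    induction r with
    | zero =>
      exact momentExpansion_succ le_rfl (ih.2 1 le_rfl) (momentExpansion_succ_zero t) hb'
    | succ r ihr => exact momentExpansion_succ (by omega) (ih.2 _ (by omega)) ihr hb'

end NodeIsolation

/-! ### The method of moments for a limit with bounded support -/

namespace NodeIsolation

open scoped BigOperators Topology

theorem integrable_eval {μ : Measure ℝ} (hμ : ∀ s : ℕ, Integrable (fun x => x ^ s) μ)
    (p : Polynomial ℝ) : Integrable (fun x => p.eval x) μ := by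
  simp only [Polynomial.eval_eq_sum_range]
  exact integrable_finsetSum _ fun i _ => (hμ i).const_mul _

theorem integral_eval {μ : Measure ℝ} (hμ : ∀ s : ℕ, Integrable (fun x => x ^ s) μ)
    (p : Polynomial ℝ) :
    ∫ x, p.eval x ∂μ = ∑ i ∈ Finset.range (p.natDegree + 1), p.coeff i * ∫ x, x ^ i ∂μ := by
  simp only [Polynomial.eval_eq_sum_range]
  rw [integral_finsetSum _ fun i _ => (hμ i).const_mul _]
  simp only [integral_const_mul]

/-- A bounded continuous function is close to a polynomial on `[-2, 2]`, and outside of this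
interval the difference is at most a small multiple of a high even power. -/
theorem exists_polynomial_abs_sub_le (f : BoundedContinuousFunction ℝ ℝ) {ε : ℝ} (hε : 0 < ε) :
    ∃ (p : Polynomial ℝ) (r : ℕ) (c : ℝ), 0 ≤ c ∧ c ≤ ε ∧
      ∀ x, |f x - p.eval x| ≤ ε + c * x ^ (2 * r) := by
  obtain ⟨p, hp⟩ := exists_polynomial_near_of_continuousOn (-2) 2 f f.continuous.continuousOn ε hε
  set d := p.natDegree
  set A : ℝ := ‖f‖ + ∑ i ∈ Finset.range (d + 1), |p.coeff i| with hA
  have hA0 : 0 ≤ A := by positivity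
  obtain ⟨m, hm⟩ := exists_pow_lt_of_lt_one (show 0 < ε / (A + 1) by positivity)
    (show (1 / 4 : ℝ) < 1 by norm_num)
  refine ⟨p, d + m, A * (1 / 4) ^ m, by positivity, ?_, fun x => ?_⟩
  · rw [lt_div_iff₀ (by positivity)] at hm
    have : (0 : ℝ) < (1 / 4) ^ m := by positivity
    nlinarith
  rcases le_or_gt |x| 2 with hx | hx
  · have h1 := hp x (abs_le.mp hx)
    rw [abs_sub_comm] at h1
    have : 0 ≤ A * (1 / 4) ^ m * x ^ (2 * (d + m)) :=
      mul_nonneg (by positivity) (by rw [pow_mul]; positivity)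
    linarith
  · have hone : 1 ≤ |x| := by linarith
    have h1 : |f x| ≤ ‖f‖ * |x| ^ (2 * d) :=
      (f.norm_coe_le_norm x).trans (le_mul_of_one_le_right (norm_nonneg _) (one_le_pow₀ hone))
    have h2 : |p.eval x| ≤ (∑ i ∈ Finset.range (d + 1), |p.coeff i|) * |x| ^ (2 * d) := by
      rw [Polynomial.eval_eq_sum_range, Finset.sum_mul]
      refine (Finset.abs_sum_le_sum_abs _ _).trans (Finset.sum_le_sum fun i hi => ?_)
      rw [abs_mul, abs_pow]
      have : i ≤ 2 * d := by have := Finset.mem_range.mp hi; omega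
      gcongr
    have h3 : (4 : ℝ) ^ m ≤ |x| ^ (2 * m) := by
      rw [pow_mul]
      gcongr
      nlinarith
    have h4 : x ^ (2 * (d + m)) = |x| ^ (2 * d) * |x| ^ (2 * m) := by
      rw [← pow_add, ← mul_add, pow_mul, pow_mul, sq_abs]
    have h5 : (1 : ℝ) ≤ (1 / 4) ^ m * |x| ^ (2 * m) := by
      calc (1 : ℝ) = (1 / 4) ^ m * 4 ^ m := by rw [← mul_pow]; norm_num
        _ ≤ _ := by gcongr
    calc |f x - p.eval x| ≤ |f x| + |p.eval x| := abs_sub _ _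
      _ ≤ A * |x| ^ (2 * d) := by rw [hA, add_mul]; exact add_le_add h1 h2
      _ ≤ A * |x| ^ (2 * d) * ((1 / 4) ^ m * |x| ^ (2 * m)) :=
        le_mul_of_one_le_right (by positivity) h5
      _ = A * (1 / 4) ^ m * x ^ (2 * (d + m)) := by rw [h4]; ring
      _ ≤ _ := by linarith

theorem abs_integral_sub_integral_eval_le {μ : Measure ℝ} [IsProbabilityMeasure μ]
    (hμ : ∀ s : ℕ, Integrable (fun x => x ^ s) μ) (f : BoundedContinuousFunction ℝ ℝ)
    {p : Polynomial ℝ} {r : ℕ} {c ε : ℝ} (h : ∀ x, |f x - p.eval x| ≤ ε + c * x ^ (2 * r)) :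
    |∫ x, f x ∂μ - ∫ x, p.eval x ∂μ| ≤ ε + c * ∫ x, x ^ (2 * r) ∂μ := by
  rw [← integral_sub (f.integrable μ) (integrable_eval hμ p)]
  refine (norm_integral_le_of_norm_le (f := fun x => f x - p.eval x)
    (g := fun x => ε + c * x ^ (2 * r))
    ((integrable_const ε).add ((hμ (2 * r)).const_mul c)) (ae_of_all _ h)).trans_eq ?_
  rw [integral_add (integrable_const ε) ((hμ (2 * r)).const_mul c), integral_const_mul]
  simp

/-- The method of moments, for a limit that is concentrated on `[-1, 1]`. -/
theorem tendsto_of_tendsto_moments (μ : ℕ → ProbabilityMeasure ℝ) (ν : ProbabilityMeasure ℝ)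
    (hμ : ∀ (n : ℕ) (s : ℕ), Integrable (fun x => x ^ s) (μ n : Measure ℝ))
    (hν : ∀ᵐ x ∂(ν : Measure ℝ), |x| ≤ 1)
    (h : ∀ s : ℕ, Tendsto (fun n => ∫ x, x ^ s ∂(μ n : Measure ℝ)) atTop
      (𝓝 (∫ x, x ^ s ∂(ν : Measure ℝ)))) :
    Tendsto μ atTop (𝓝 ν) := by
  have hpow : ∀ s : ℕ, ∀ᵐ x ∂(ν : Measure ℝ), ‖x ^ s‖ ≤ 1 := fun s => hν.mono fun x hx => by
    rw [Real.norm_eq_abs, abs_pow]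
    exact pow_le_one₀ (abs_nonneg x) hx
  have hνs : ∀ s : ℕ, Integrable (fun x => x ^ s) (ν : Measure ℝ) := fun s =>
    Integrable.of_bound (by fun_prop) 1 (hpow s)
  have hνle : ∀ s : ℕ, ∫ x, x ^ s ∂(ν : Measure ℝ) ≤ 1 := fun s => by
    have := norm_integral_le_of_norm_le_const (hpow s)
    rw [probReal_univ, mul_one] at this
    exact (le_abs_self _).trans this
  rw [ProbabilityMeasure.tendsto_iff_forall_integral_tendsto]
  intro f
  rw [Metric.tendsto_atTop]
  intro ε hε
  obtain ⟨p, r, c, hc0, hc, hp⟩ := exists_polynomial_abs_sub_le f (show 0 < ε / 8 by positivity)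
  have hpoly : Tendsto (fun n => ∫ x, p.eval x ∂(μ n : Measure ℝ)) atTop
      (𝓝 (∫ x, p.eval x ∂(ν : Measure ℝ))) := by
    simp only [integral_eval (hμ _), integral_eval hνs]
    exact tendsto_finsetSum _ fun i _ => (h i).const_mul _
  obtain ⟨N₁, hN₁⟩ := Metric.tendsto_atTop.mp hpoly (ε / 8) (by positivity)
  obtain ⟨N₂, hN₂⟩ := Metric.tendsto_atTop.mp (h (2 * r)) 1 one_pos
  refine ⟨max N₁ N₂, fun n hn => ?_⟩
  have e1 := hN₁ n ((le_max_left _ _).trans hn)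
  have e2 := hN₂ n ((le_max_right _ _).trans hn)
  rw [Real.dist_eq] at e1 e2 ⊢
  have e3 := abs_integral_sub_integral_eval_le (hμ n) f hp
  have e4 := abs_integral_sub_integral_eval_le hνs f hp
  have e5 : c * ∫ x, x ^ (2 * r) ∂(μ n : Measure ℝ) ≤ ε / 8 * 2 := by
    refine (mul_le_mul_of_nonneg_left ?_ hc0).trans (mul_le_mul_of_nonneg_right hc zero_le_two)
    linarith [hνle (2 * r), (abs_lt.mp e2).2]
  have e6 : c * ∫ x, x ^ (2 * r) ∂(ν : Measure ℝ) ≤ ε / 8 :=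
    (mul_le_of_le_one_right hc0 (hνle _)).trans hc
  rw [abs_lt] at e1 ⊢
  rw [abs_le] at e3 e4
  constructor <;> linarith

/-! ### The beta distribution with second parameter one -/

theorem betaPDFReal_one (a : ℝ) (ha : 0 < a) {x : ℝ} (hx : x ∈ Set.Ioo (0 : ℝ) 1) :
    betaPDFReal a 1 x = a * x ^ (a - 1) := by
  have hb : beta a 1 = 1 / a := by
    rw [beta, Real.Gamma_one, mul_one, Real.Gamma_add_one ha.ne']
    have := (Real.Gamma_pos_of_pos ha).ne'
    field_simp
  simp [betaPDFReal, hx.1, hx.2, hb]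

theorem ae_betaMeasure_abs_le_one (a b : ℝ) : ∀ᵐ x ∂betaMeasure a b, |x| ≤ 1 := by
  rw [betaMeasure, ae_withDensity_iff (by unfold betaPDF; fun_prop)]
  refine ae_of_all _ fun x hx => ?_
  by_contra! h
  refine hx ?_
  rcases lt_abs.mp h with h | h
  · exact betaPDF_eq_zero_of_one_le h.le
  · exact betaPDF_eq_zero_of_nonpos (by linarith)

theorem integral_pow_betaMeasure_one {ℓ : ℕ} (hℓ : 1 ≤ ℓ) (s : ℕ) :
    ∫ x, x ^ s ∂betaMeasure (ℓ : ℝ) 1 = betaMoment ℓ s := by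
  have hℓ' : (0 : ℝ) < ℓ := Nat.cast_pos.mpr hℓ
  rw [betaMeasure, integral_withDensity_eq_integral_toReal_smul (f := betaPDF (ℓ : ℝ) 1) (by unfold betaPDF; fun_prop)
    (ae_of_all _ fun x => ENNReal.ofReal_lt_top)]
  have h1 : ∀ x : ℝ, (betaPDF (ℓ : ℝ) 1 x).toReal • x ^ s
      = Set.indicator (Set.Ioo 0 1) (fun x : ℝ => (ℓ : ℝ) * x ^ (ℓ - 1 + s)) x := by
    intro x
    by_cases hx : x ∈ Set.Ioo (0 : ℝ) 1
    · rw [Set.indicator_of_mem hx, betaPDF, betaPDFReal_one _ hℓ' hx, ENNReal.toReal_ofReal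
        (mul_nonneg hℓ'.le (Real.rpow_nonneg hx.1.le _)), smul_eq_mul, mul_assoc, pow_add,
        ← Real.rpow_natCast x (ℓ - 1), Nat.cast_sub hℓ, Nat.cast_one]
    · rw [Set.indicator_of_notMem hx]
      have : betaPDF (ℓ : ℝ) 1 x = 0 := by
        rcases le_or_gt x 0 with h | h
        · exact betaPDF_eq_zero_of_nonpos h
        · exact betaPDF_eq_zero_of_one_le (not_lt.mp fun h' => hx ⟨h, h'⟩)
      simp [this]
  simp only [h1]
  rw [integral_indicator measurableSet_Ioo, ← integral_Ioc_eq_integral_Ioo,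
    ← intervalIntegral.integral_of_le zero_le_one, intervalIntegral.integral_const_mul,
    integral_pow, betaMoment]
  have h2 : ((ℓ - 1 + s : ℕ) : ℝ) + 1 = s + ℓ := by
    push_cast [Nat.cast_sub hℓ]
    ring
  rw [h2, one_pow, zero_pow (by omega), sub_zero, mul_one_div]

end NodeIsolation

/-! ### From shifted to plain logarithms -/

namespace NodeIsolation

open scoped BigOperators Topology

theorem lg_le_log_add_three {n : ℕ} (hn : 1 ≤ n) : lg n ≤ Real.log n + 3 := by
  have hn' : (1 : ℝ) ≤ n := by exact_mod_cast hn
  have h : lg n ≤ Real.log (n * 4) := Real.log_le_log (by positivity) (by linarith)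
  rw [Real.log_mul (by positivity) (by norm_num)] at h
  linarith [Real.log_le_sub_one_of_pos (show (0 : ℝ) < 4 by norm_num)]

/-- Replacing `lg n` by `log n` in the main term changes it by no more than the error term. -/
theorem abs_gauge_sub_le {n : ℕ} (hn : 2 ≤ n) (s : ℕ) :
    |gauge s s n - (n : ℝ) ^ s / Real.log n ^ s|
      ≤ 3 * s * ((n : ℝ) ^ s / Real.log n ^ (s + 1)) := by
  have hL : 0 < Real.log n := Real.log_pos (by exact_mod_cast hn)
  have h1 := log_le_lg n
  have h2 := lg_le_log_add_three (show 1 ≤ n by omega)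
  have hlg := lg_pos n
  unfold gauge
  set L := Real.log n
  set l := lg n
  -- Bernoulli's inequality for `(L / l) ^ s`
  have hB := one_add_mul_le_pow (a := L / l - 1)
    (by linarith [div_nonneg hL.le hlg.le]) s
  rw [add_sub_cancel, div_pow] at hB
  have h3 : 1 - L / l ≤ 3 / L := by
    rw [one_sub_div hlg.ne', div_le_div_iff₀ hlg hL]
    nlinarith
  have hle : (n : ℝ) ^ s / l ^ s ≤ (n : ℝ) ^ s / L ^ s := by gcongr
  rw [abs_sub_comm, abs_of_nonneg (by linarith)]
  have e1 : (n : ℝ) ^ s / L ^ s - (n : ℝ) ^ s / l ^ s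
      = (n : ℝ) ^ s / L ^ s * (1 - L ^ s / l ^ s) := by
    field_simp
  have e2 : 3 * s * ((n : ℝ) ^ s / L ^ (s + 1)) = (n : ℝ) ^ s / L ^ s * (s * (3 / L)) := by
    rw [pow_succ]
    field_simp
  rw [e1, e2]
  refine mul_le_mul_of_nonneg_left ?_ (by positivity)
  have := mul_le_mul_of_nonneg_left h3 (Nat.cast_nonneg (α := ℝ) s)
  linarith

theorem gauge_le_div_log_pow {n : ℕ} (hn : 2 ≤ n) (s q : ℕ) :
    gauge s q n ≤ (n : ℝ) ^ s / Real.log n ^ q := by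
  have hL : 0 < Real.log n := Real.log_pos (by exact_mod_cast hn)
  have := log_le_lg n
  unfold gauge
  gcongr

theorem moment_eq_integral (n ℓ s : ℕ) :
    moment n ℓ s = ∫ k : ℕ, (k : ℝ) ^ s ∂(lawL n ℓ).toMeasure := rfl

theorem moment_sub_isBigO {ℓ : ℕ} (hℓ : 1 ≤ ℓ) (s : ℕ) :
    (fun n : ℕ => moment n ℓ s - betaMoment ℓ s * ((n : ℝ) ^ s / Real.log n ^ s))
      =O[atTop] fun n : ℕ => (n : ℝ) ^ s / Real.log n ^ (s + 1) := by
  obtain ⟨C, hC, h⟩ := (momentBound_and_momentExpansion s).2 ℓ hℓ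
  refine IsBigO.of_bound (C + 3 * s) ?_
  filter_upwards [eventually_ge_atTop 2] with n hn
  have hL : 0 < Real.log n := Real.log_pos (by exact_mod_cast hn)
  have h0 : (0 : ℝ) ≤ (n : ℝ) ^ s / Real.log n ^ (s + 1) := by positivity
  rw [Real.norm_eq_abs, Real.norm_eq_abs, abs_of_nonneg h0, add_mul]
  have h1 := h n (by omega)
  have h2 := mul_le_mul_of_nonneg_left (gauge_le_div_log_pow hn s (s + 1)) hC
  have h3 := mul_le_mul (betaMoment_le_one ℓ s) (abs_gauge_sub_le hn s) (abs_nonneg _) zero_le_one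
  calc |moment n ℓ s - betaMoment ℓ s * ((n : ℝ) ^ s / Real.log n ^ s)|
      = |(moment n ℓ s - betaMoment ℓ s * gauge s s n)
          + betaMoment ℓ s * (gauge s s n - (n : ℝ) ^ s / Real.log n ^ s)| := by ring_nf
    _ ≤ |moment n ℓ s - betaMoment ℓ s * gauge s s n|
          + betaMoment ℓ s * |gauge s s n - (n : ℝ) ^ s / Real.log n ^ s| := by
        refine (abs_add_le _ _).trans_eq ?_
        rw [abs_mul, abs_of_nonneg (betaMoment_nonneg ℓ s)]
    _ ≤ _ := by linarith

theorem tendsto_rescaled_moment {ℓ : ℕ} (hℓ : 1 ≤ ℓ) (s : ℕ) :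
    Tendsto (fun n : ℕ => (Real.log n / n) ^ s * moment n ℓ s) atTop (𝓝 (betaMoment ℓ s)) := by
  have hlog : Tendsto (fun n : ℕ => (Real.log n)⁻¹) atTop (𝓝 0) :=
    tendsto_inv_atTop_zero.comp (Real.tendsto_log_atTop.comp tendsto_natCast_atTop_atTop)
  have hO := (isBigO_refl (fun n : ℕ => (Real.log n / n) ^ s) atTop).mul (moment_sub_isBigO hℓ s)
  have h0 : Tendsto (fun n : ℕ => (Real.log n / n) ^ s
      * (moment n ℓ s - betaMoment ℓ s * ((n : ℝ) ^ s / Real.log n ^ s))) atTop (𝓝 0) := by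
    refine hO.trans_tendsto (hlog.congr' ?_)
    filter_upwards [eventually_ge_atTop 2] with n hn
    have hL : 0 < Real.log n := Real.log_pos (by exact_mod_cast hn)
    have hn0 : (0 : ℝ) < n := by positivity
    rw [pow_succ, div_pow]
    field_simp
  have h1 := h0.add_const (betaMoment ℓ s)
  rw [zero_add] at h1
  refine h1.congr' ?_
  filter_upwards [eventually_ge_atTop 2] with n hn
  have hL : 0 < Real.log n := Real.log_pos (by exact_mod_cast hn)
  have hn0 : (0 : ℝ) < n := by positivity
  rw [div_pow]
  field_simp
  ring

end NodeIsolation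

theorem theorem2 (ℓ : ℕ) (hℓ : 1 ≤ ℓ) :
    (∀ s : ℕ, 1 ≤ s →
      (fun n : ℕ => (∫ k : ℕ, (k : ℝ) ^ s ∂(NodeIsolation.lawL n ℓ).toMeasure)
          - (ℓ : ℝ) / ((s : ℝ) + (ℓ : ℝ)) * ((n : ℝ) ^ s / (Real.log (n : ℝ)) ^ s))
        =O[atTop] fun n : ℕ => (n : ℝ) ^ s / (Real.log (n : ℝ)) ^ (s + 1)) ∧
    (haveI : IsProbabilityMeasure (betaMeasure (ℓ : ℝ) 1) :=
        isProbabilityMeasureBeta (Nat.cast_pos.mpr hℓ) one_pos;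
      TendstoInDistribution
        (fun (n : ℕ) (k : ℕ) => Real.log (n : ℝ) / (n : ℝ) * (k : ℝ)) atTop (id : ℝ → ℝ)
        (fun n : ℕ => (NodeIsolation.lawL n ℓ).toMeasure) (betaMeasure (ℓ : ℝ) 1)) := by
  refine ⟨fun s _ => NodeIsolation.moment_sub_isBigO hℓ s, ?_⟩
  have : IsProbabilityMeasure (betaMeasure (ℓ : ℝ) 1) :=
    isProbabilityMeasureBeta (Nat.cast_pos.mpr hℓ) one_pos
  have hmeas : ∀ n : ℕ, AEMeasurable (fun k : ℕ => Real.log (n : ℝ) / (n : ℝ) * (k : ℝ))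
      (NodeIsolation.lawL n ℓ).toMeasure := fun n => (measurable_of_countable _).aemeasurable
  refine ⟨hmeas, aemeasurable_id, NodeIsolation.tendsto_of_tendsto_moments _ _ ?_ ?_ ?_⟩
  · intro n s
    exact (integrable_map_measure (by fun_prop) (hmeas n)).mpr
      (NodeIsolation.integrable_lawL n ℓ _)
  · simpa using NodeIsolation.ae_betaMeasure_abs_le_one (ℓ : ℝ) 1
  · intro s
    simp only [ProbabilityMeasure.coe_mk, Measure.map_id]
    rw [NodeIsolation.integral_pow_betaMeasure_one hℓ s]
    refine (NodeIsolation.tendsto_rescaled_moment hℓ s).congr fun n => ?_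
    rw [integral_map (hmeas n) (by fun_prop)]
    simp only [mul_pow]
    rw [integral_const_mul, NodeIsolation.moment_eq_integral]
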